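/- **Language.** Arithmetic expressions and propositions are $e ::= i \mid e+e \mid e-e \mid i\times e \mid n$ ($i\in\mathbb N$ a constant, $n$ an index variable) and $\phi ::= e=e \mid e>e \mid \top \mid \bot \mid \phi\land\phi \mid \phi\lor\phi \mid \lnot\phi \mid \exists n.\phi \mid \forall n.\phi$. Index variables and quantifiers range over $\mathbb N$; expressions are evaluated in $\mathbb Z$. $\mathcal V;\mathcal C\vDash\phi$ means that every assignment of natural numbers to $\mathcal V$ satisfying $\mathcal C$ satisfies $\phi$, and $\mathcal V;\mathcal C\vdash e:\mathsf{nat}$ means $\mathcal V;\mathcal C\vDash e\ge 0$. All syntax is well scoped, and taken up to renaming of bound variables. Types are $A ::= \oplus\{\ell:A_\ell\}_{\ell\in L} \mid \&\{\ell:A_\ell\}_{\ell\in L} \mid A\otimes A \mid A\multimap A \mid \mathbf 1 \mid V[\overline e] \mid\ ?\{\phi\}.A \mid\ !\{\phi\}.A \mid \exists n.A \mid \forall n.A \mid \triangleright^{r}A \mid \triangleleft^{r}A$ with $L$ a finite set of labels and $r$ an arithmetic expression. Processes are $P ::= x\leftarrow y \mid (x\leftarrow f[\overline e]\,\overline y;P)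 \mid x.k;P \mid \mathsf{case}\,x\,(\ell\Rightarrow P_\ell)_{\ell\in L} \mid \mathsf{send}\,x\,w;P \mid y\leftarrow\mathsf{recv}\,x;P \mid \mathsf{close}\,x \mid \mathsf{wait}\,x;P \mid \mathsf{send}\,x\,\{e\};P \mid \{n\}\leftarrow\mathsf{recv}\,x;P \mid \mathsf{assert}\,x\,\{\phi\};P \mid \mathsf{assume}\,x\,\{\phi\};P \mid \mathsf{pay}\,x\,\{r\};P \mid \mathsf{get}\,x\,\{r\};P \mid \mathsf{work}\,\{r\};P \mid \mathsf{impossible}$. A signature $\Sigma$ has one definition $V[\overline n]=A$ for each type name and one definition $\overline{y:B}\vdash^{q} f[\overline n]=P_f::(x:A)$ for each process name. It is *well-formed* if no type definition has a type name as its right-hand side, and for every process definition $\overline n;\top\vdash q:\mathsf{nat}$ and $\overline n;\top;\overline{y:B}\vdash^{q}P_f::(x:A)$. Put $\mathsf{unf}(V[\overline e])=A[\overline e/\overline n]$ and $\mathsf{unf}(A)=A$ for any other type. **Type equality.** A relation $\mathcal R$ on closed types is a bisimulation if, whenever $(A,B)\in\mathcal R$, $\mathsf{unf}(A)$ and $\mathsf{unf}(B)$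 have the same outermost constructor and: for $\oplus,\&$, the same label set $L$ and $(A_\ell,B_\ell)\in\mathcal R$ for all $\ell\in L$; for $\otimes,\multimap$, the respective components are in $\mathcal R$; for $?\{\phi\}.A',\,?\{\psi\}.B'$ (likewise $!$), either $\vDash\phi$, $\vDash\psi$ and $(A',B')\in\mathcal R$, or $\vDash\lnot\phi$ and $\vDash\lnot\psi$; for $\exists,\forall$, $(A'[i/m],B'[i/n])\in\mathcal R$ for all $i\in\mathbb N$; for $\triangleright^rA',\triangleright^sB'$ (likewise $\triangleleft$), $\vDash r=s$ and $(A',B')\in\mathcal R$. $A\equiv B$ if some bisimulation contains $(A,B)$; $\mathcal V;\mathcal C\vdash A\equiv B$ if $A[\sigma]\equiv B[\sigma]$ for every assignment $\sigma:\mathcal V\to\mathbb N$ satisfying $\mathcal C$. **Process typing** $\mathcal V;\mathcal C;\Delta\vdash^q P::(x:A)$, where the linear context $\Delta$ assigns types to distinct channels other than $x$. The prefix $\mathcal V;\mathcal C$ is omitted where it does not change, premises are written left of $\Longrightarrow$, and types are equirecursive: the type of the channel a rule acts on may be replaced by its unfolding. - $q=0,\ A\equiv B\Longrightarrow y:A\vdash^q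 x\leftarrow y::(x:B)$. - For $\overline{y:B}\vdash^{p}f[\overline n]=P_f::(x:A)\in\Sigma$ and distinct $\overline y$: $\overline e:\mathsf{nat}$, $r\ge p[\overline e/\overline n]$, $B_i'\equiv B_i[\overline e/\overline n]$ for all $i$, $\Delta,x:A[\overline e/\overline n]\vdash^{r-p[\overline e/\overline n]}Q::(z:C)\Longrightarrow\Delta,\overline{y:B'}\vdash^{r}(x\leftarrow f[\overline e]\,\overline y;Q)::(z:C)$. - $\Delta\vdash^qP::(x:A_k)\Longrightarrow\Delta\vdash^q x.k;P::(x:\oplus\{\ell:A_\ell\}_{\ell\in L})$, $k\in L$; and $\Delta,x:A_\ell\vdash^qQ_\ell::(z:C)$ for all $\ell\in L\Longrightarrow\Delta,x:\oplus\{\ell:A_\ell\}_{\ell\in L}\vdash^q\mathsf{case}\,x\,(\ell\Rightarrow Q_\ell)_{\ell\in L}::(z:C)$. - $\Delta\vdash^qP_\ell::(x:A_\ell)$ for all $\ell\in L\Longrightarrow\Delta\vdash^q\mathsf{case}\,x\,(\ell\Rightarrow P_\ell)_{\ell\in L}::(x:\&\{\ell:A_\ell\}_{\ell\in L})$; and $\Delta,x:A_k\vdash^qQ::(z:C)\Longrightarrow\Delta,x:\&\{\ell:A_\ell\}_{\ell\in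 L}\vdash^q x.k;Q::(z:C)$, $k\in L$. - $A_1\equiv A_2$, $\Delta\vdash^qP::(x:B)\Longrightarrow\Delta,w:A_1\vdash^q\mathsf{send}\,x\,w;P::(x:A_2\otimes B)$; and $\Delta,y:A,x:B\vdash^qQ::(z:C)\Longrightarrow\Delta,x:A\otimes B\vdash^q y\leftarrow\mathsf{recv}\,x;Q::(z:C)$. - $\Delta,y:A\vdash^qP::(x:B)\Longrightarrow\Delta\vdash^q y\leftarrow\mathsf{recv}\,x;P::(x:A\multimap B)$; and $A_1\equiv A_2$, $\Delta,x:B\vdash^qQ::(z:C)\Longrightarrow\Delta,w:A_1,x:A_2\multimap B\vdash^q\mathsf{send}\,x\,w;Q::(z:C)$. - $q=0\Longrightarrow\cdot\vdash^q\mathsf{close}\,x::(x:\mathbf 1)$; and $\Delta\vdash^qQ::(z:C)\Longrightarrow\Delta,x:\mathbf 1\vdash^q\mathsf{wait}\,x;Q::(z:C)$. - $e:\mathsf{nat}$, $\Delta\vdash^qP::(x:A[e/n])\Longrightarrow\Delta\vdash^q\mathsf{send}\,x\,\{e\};P::(x:\exists n.A)$; and $\mathcal V,n;\mathcal C;\Delta,x:A\vdash^qQ::(z:C)\Longrightarrow\mathcal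 V;\mathcal C;\Delta,x:\exists n.A\vdash^q\{n\}\leftarrow\mathsf{recv}\,x;Q::(z:C)$. - $\mathcal V,n;\mathcal C;\Delta\vdash^qP::(x:A)\Longrightarrow\mathcal V;\mathcal C;\Delta\vdash^q\{n\}\leftarrow\mathsf{recv}\,x;P::(x:\forall n.A)$; and $e:\mathsf{nat}$, $\Delta,x:A[e/n]\vdash^qQ::(z:C)\Longrightarrow\Delta,x:\forall n.A\vdash^q\mathsf{send}\,x\,\{e\};Q::(z:C)$. - $\mathcal C\vDash\phi$, $\mathcal C\vDash\phi'$, $\Delta\vdash^qP::(x:A)\Longrightarrow\Delta\vdash^q\mathsf{assert}\,x\,\{\phi\};P::(x:\,?\{\phi'\}.A)$; and $\mathcal C\land\phi'\vDash\phi$, $\mathcal V;\mathcal C\land\phi;\Delta,x:A\vdash^qQ::(z:C)\Longrightarrow\mathcal V;\mathcal C;\Delta,x:\,?\{\phi'\}.A\vdash^q\mathsf{assume}\,x\,\{\phi\};Q::(z:C)$. - $\mathcal C\land\phi'\vDash\phi$, $\mathcal V;\mathcal C\land\phi;\Delta\vdash^qP::(x:A)\Longrightarrow\mathcal V;\mathcal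 C;\Delta\vdash^q\mathsf{assume}\,x\,\{\phi\};P::(x:\,!\{\phi'\}.A)$; and $\mathcal C\vDash\phi$, $\mathcal C\vDash\phi'$, $\Delta,x:A\vdash^qQ::(z:C)\Longrightarrow\Delta,x:\,!\{\phi'\}.A\vdash^q\mathsf{assert}\,x\,\{\phi\};Q::(z:C)$. - $r_1:\mathsf{nat}$, $q\ge r_1=r_2$, $\Delta\vdash^{q-r_1}P::(x:A)\Longrightarrow\Delta\vdash^q\mathsf{pay}\,x\,\{r_1\};P::(x:\triangleright^{r_2}A)$; and $r_1=r_2$, $\Delta,x:A\vdash^{q+r_1}Q::(z:C)\Longrightarrow\Delta,x:\triangleright^{r_2}A\vdash^q\mathsf{get}\,x\,\{r_1\};Q::(z:C)$. - $r_1=r_2$, $\Delta\vdash^{q+r_1}P::(x:A)\Longrightarrow\Delta\vdash^q\mathsf{get}\,x\,\{r_1\};P::(x:\triangleleft^{r_2}A)$; and $r_1:\mathsf{nat}$, $q\ge r_1=r_2$, $\Delta,x:A\vdash^{q-r_1}Q::(z:C)\Longrightarrow\Delta,x:\triangleleft^{r_2}A\vdash^q\mathsf{pay}\,x\,\{r_1\};Q::(z:C)$.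 - $r:\mathsf{nat}$, $q\ge r$, $\Delta\vdash^{q-r}P::(x:A)\Longrightarrow\Delta\vdash^q\mathsf{work}\,\{r\};P::(x:A)$; and $\mathcal C\vDash\bot\Longrightarrow\Delta\vdash^q\mathsf{impossible}::(x:A)$. **Configurations** are finite multisets of objects $\mathsf{proc}(c,w,P)$ and $\mathsf{msg}(c,w,M)$ (process $P$ or message $M$ provides $c$ and has performed work $w\in\mathbb N$), with index-closed $P$, $M$. Let $\pi$ stand for any of the prefixes $x.k$, $\mathsf{send}\,x\,d$, $\mathsf{send}\,x\,\{e\}$, $\mathsf{assert}\,x\,\{\phi\}$, $\mathsf{pay}\,x\,\{r\}$, written $\pi_x$. The messages providing $c$ are $(\pi_c;c\leftarrow c')$, $(\pi_d;c\leftarrow d)$ and $\mathsf{close}\,c$. The judgment $\Delta\Vdash^E\mathcal S::\Delta'$ ($E\in\mathbb N$) is generated by: $\cdot\Vdash^0\cdot::\cdot$; if $\Delta\Vdash^E\mathcal S::\Delta'$ and $\Delta'\Vdash^{E'}\mathcal S'::\Delta''$, then $\Delta\Vdash^{E+E'}(\mathcal S\,\mathcal S')::\Delta''$; if $\cdot;\top;\Delta_1\vdash^pP::(x:A)$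 with $p$ of value in $\mathbb N$, then $\Delta,\Delta_1\Vdash^{p+w}\mathsf{proc}(x,w,P)::(\Delta,x:A)$, and likewise $\Delta,\Delta_1\Vdash^{p+w}\mathsf{msg}(x,w,P)::(\Delta,x:A)$ if $P$ is a message providing $x$; and types in $\Delta$, $\Delta'$ may be replaced by equal ($\equiv$) ones. $\mathcal S$ is *well-typed with interface $\Delta_1,\Delta_2$ and potential $E$* if $\Delta_1\Vdash^E\mathcal S::\Delta_2$, $\Delta_1$ is finite, and the channels provided by the objects of $\mathcal S$ are distinct from each other and from those of $\Delta_1$. **Steps.** $\mathcal S\mapsto\mathcal S'$ rewrites some objects of $\mathcal S$ by one of the following rules, where fresh channels occur neither in $\mathcal S$ nor in the interface. - $\mathsf{msg}(d,w,M),\mathsf{proc}(c,w',c\leftarrow d)\mapsto\mathsf{msg}(c,w+w',M[c/d])$; and $\mathsf{proc}(c,w,c\leftarrow d),\mathsf{msg}(e,w',M)\mapsto\mathsf{msg}(e,w+w',M[d/c])$ if $c$ occurs in $M$. - $\mathsf{proc}(c,w,x\leftarrow f[\overline e]\,\overline d;Q)\mapsto\mathsf{proc}(a,0,P_f[a/x,\overline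 d/\overline y,\overline e/\overline n]),\mathsf{proc}(c,w,Q[a/x])$, $a$ fresh. - Sending, $c'$ fresh: $\mathsf{proc}(c,w,\pi_c;P)\mapsto\mathsf{proc}(c',w,P[c'/c]),\mathsf{msg}(c,0,\pi_c;c\leftarrow c')$; and, for $d\ne c$, $\mathsf{proc}(d,w,\pi_c;Q)\mapsto\mathsf{msg}(c',0,\pi_c;c'\leftarrow c),\mathsf{proc}(d,w,Q[c'/c])$. - Receiving: $\mathsf{msg}(c,w',\pi_c;c\leftarrow c'),\mathsf{proc}(d,w,R)\mapsto\mathsf{proc}(d,w+w',R')$ and $\mathsf{proc}(c,w,R),\mathsf{msg}(c',w',\pi_c;c'\leftarrow c)\mapsto\mathsf{proc}(c',w+w',R')$ in the following cases: $\pi_c=c.k$, $R=\mathsf{case}\,c\,(\ell\Rightarrow Q_\ell)_{\ell\in L}$ with $k\in L$, $R'=Q_k[c'/c]$; $\pi_c=\mathsf{send}\,c\,d'$, $R=(y\leftarrow\mathsf{recv}\,c;Q)$, $R'=Q[c'/c,d'/y]$; $\pi_c=\mathsf{send}\,c\,\{e\}$, $R=(\{n\}\leftarrow\mathsf{recv}\,c;Q)$,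 $R'=Q[e/n][c'/c]$; $\pi_c=\mathsf{assert}\,c\,\{\phi\}$, $R=(\mathsf{assume}\,c\,\{\psi\};Q)$, $R'=Q[c'/c]$; $\pi_c=\mathsf{pay}\,c\,\{r\}$, $R=(\mathsf{get}\,c\,\{s\};Q)$ with $r$, $s$ of equal value, $R'=Q[c'/c]$. - $\mathsf{proc}(c,w,\mathsf{close}\,c)\mapsto\mathsf{msg}(c,w,\mathsf{close}\,c)$; $\mathsf{msg}(c,w',\mathsf{close}\,c),\mathsf{proc}(d,w,\mathsf{wait}\,c;Q)\mapsto\mathsf{proc}(d,w+w',Q)$; $\mathsf{proc}(c,w,\mathsf{work}\,\{r\};P)\mapsto\mathsf{proc}(c,w+r,P)$, where $r$ has a value in $\mathbb N$. **Poised.** An object is poised if it is $\mathsf{proc}(c,w,P)$ with $P$ about to receive along $c$ (including $P=(c\leftarrow d)$), or $\mathsf{msg}(c,w,M)$ with $M$ sending along $c$. An object *waits for* a channel $d$ if it is $\mathsf{proc}(c,w,P)$ with $P$ about to receive along $d\neq c$ or $P=(c\leftarrow d)$, or $\mathsf{msg}(c,w,M)$ with $M$ sending along $d\ne c$. It *waits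 for the outside* if it waits for a channel of $\Delta_1$, or (inductively) for the channel provided by an object of $\mathcal S$ that waits for the outside. A configuration $\mathcal S$ with $\Delta_1\Vdash\mathcal S::\Delta_2$ is poised if each of its objects is poised or waits for the outside; for empty $\Delta_1$ this means that each of its objects is poised. **Theorem (Type Safety).** Let $\Sigma$ be a well-formed signature and let $\mathcal S$ be a configuration that is well-typed over $\Sigma$ with $\Delta_1\Vdash^E\mathcal S::\Delta_2$. 1. (Progress) Either $\mathcal S$ is poised, or $\mathcal S\mapsto\mathcal S'$ for some $\mathcal S'$. 2. (Preservation) If $\mathcal S\mapsto\mathcal S'$, then $\mathcal S'$ is well-typed with $\Delta_1\Vdash^E\mathcal S'::\Delta_2$ (same interface, same potential). -/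

import Mathlib

namespace SessionTypes

/-! ### Arithmetic expressions and propositions

`k` is the number of index variables in scope (de Bruijn, the most recent one is `0`). -/

/-- Arithmetic expressions `e ::= i | e + e | e - e | i × e | n`. -/
inductive Exp : ℕ → Type
  | const {k : ℕ} (i : ℕ) : Exp k
  | add {k : ℕ} (a b : Exp k) : Exp k
  | sub {k : ℕ} (a b : Exp k) : Exp k
  | mul {k : ℕ} (i : ℕ) (a : Exp k) : Exp k
  | var {k : ℕ} (n : Fin k) : Exp k

/-- Simultaneous substitution of expressions for index variables. -/
def Exp.subst {k k' : ℕ} (σ : Fin k → Exp k') : Exp k → Exp k'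
  | .const i => .const i
  | .add a b => .add (a.subst σ) (b.subst σ)
  | .sub a b => .sub (a.subst σ) (b.subst σ)
  | .mul i a => .mul i (a.subst σ)
  | .var n => σ n

/-- Values are integers, so that `e - e'` may be negative. -/
def Exp.eval {k : ℕ} (ρ : Fin k → ℤ) : Exp k → ℤ
  | .const i => (i : ℤ)
  | .add a b => a.eval ρ + b.eval ρ
  | .sub a b => a.eval ρ - b.eval ρ
  | .mul i a => (i : ℤ) * a.eval ρ
  | .var n => ρ n

/-- The value of a closed expression. -/
def Exp.val (e : Exp 0) : ℤ := e.eval Fin.elim0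

/-- Renaming into a scope with one more index variable. -/
def shift {k : ℕ} : Fin k → Exp (k + 1) := fun i => .var i.succ

/-- The substitution `σ` below a binder. -/
def liftSubst {k k' : ℕ} (σ : Fin k → Exp k') : Fin (k + 1) → Exp (k' + 1) :=
  Fin.cases (.var 0) (fun i => (σ i).subst shift)

/-- The substitution `[e/n]` for the most recent index variable `n`. -/
def single {k : ℕ} (e : Exp k) : Fin (k + 1) → Exp k := Fin.cases e .var

/-- Arithmetic propositions. -/
inductive Fml : ℕ → Type
  | eq {k : ℕ} (a b : Exp k) : Fml k
  | gt {k : ℕ} (a b : Exp k) : Fml k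
  | top {k : ℕ} : Fml k
  | bot {k : ℕ} : Fml k
  | and {k : ℕ} (φ ψ : Fml k) : Fml k
  | or {k : ℕ} (φ ψ : Fml k) : Fml k
  | not {k : ℕ} (φ : Fml k) : Fml k
  | ex {k : ℕ} (φ : Fml (k + 1)) : Fml k
  | all {k : ℕ} (φ : Fml (k + 1)) : Fml k

def Fml.subst : {k k' : ℕ} → (Fin k → Exp k') → Fml k → Fml k'
  | _, _, σ, .eq a b => .eq (a.subst σ) (b.subst σ)
  | _, _, σ, .gt a b => .gt (a.subst σ) (b.subst σ)
  | _, _, _, .top => .top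
  | _, _, _, .bot => .bot
  | _, _, σ, .and φ ψ => .and (φ.subst σ) (ψ.subst σ)
  | _, _, σ, .or φ ψ => .or (φ.subst σ) (ψ.subst σ)
  | _, _, σ, .not φ => .not (φ.subst σ)
  | _, _, σ, .ex φ => .ex (φ.subst (liftSubst σ))
  | _, _, σ, .all φ => .all (φ.subst (liftSubst σ))

/-- Truth; quantifiers range over the natural numbers. -/
def Fml.Holds : {k : ℕ} → (Fin k → ℤ) → Fml k → Prop
  | _, ρ, .eq a b => a.eval ρ = b.eval ρ
  | _, ρ, .gt a b => a.eval ρ > b.eval ρ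
  | _, _, .top => True
  | _, _, .bot => False
  | _, ρ, .and φ ψ => φ.Holds ρ ∧ ψ.Holds ρ
  | _, ρ, .or φ ψ => φ.Holds ρ ∨ ψ.Holds ρ
  | _, ρ, .not φ => ¬ φ.Holds ρ
  | _, ρ, .ex φ => ∃ n : ℕ, φ.Holds (Fin.cons (n : ℤ) ρ)
  | _, ρ, .all φ => ∀ n : ℕ, φ.Holds (Fin.cons (n : ℤ) ρ)

/-- `a ≥ b`. -/
def Fml.ge {k : ℕ} (a b : Exp k) : Fml k := .or (.gt a b) (.eq a b)

/-- Semantic entailment `𝒱 ; C ⊨ φ`, where `𝒱` has `k` variables ranging over `ℕ`. -/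
def Entails {k : ℕ} (C φ : Fml k) : Prop :=
  ∀ ρ : Fin k → ℕ, C.Holds (fun i => (ρ i : ℤ)) → φ.Holds (fun i => (ρ i : ℤ))

/-- `𝒱 ; C ⊢ e : nat`. -/
def IsNat {k : ℕ} (C : Fml k) (e : Exp k) : Prop := Entails C (.ge e (.const 0))

/-! ### Types -/

/-- Labels of internal and external choices. -/
abbrev Label := String

/-- The names declared in a signature, with their arities. -/
structure Names where
  /-- names of types -/
  TName : Type
  /-- number of index arguments of a type name -/
  tIdx : TName → ℕ
  /-- names of processes -/
  PName : Type
  /-- number of index arguments of a process name -/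
  pIdx : PName → ℕ
  /-- number of channel arguments of a process name -/
  pChan : PName → ℕ

/-- Session types with `k` free index variables. -/
inductive Ty (N : Names) : ℕ → Type
  /-- internal choice `⊕{ℓ : A_ℓ}_{ℓ ∈ L}` -/
  | plus {k : ℕ} (L : Finset Label) (A : {l // l ∈ L} → Ty N k) : Ty N k
  /-- external choice `&{ℓ : A_ℓ}_{ℓ ∈ L}` -/
  | amp {k : ℕ} (L : Finset Label) (A : {l // l ∈ L} → Ty N k) : Ty N k
  /-- `A ⊗ B` -/
  | tensor {k : ℕ} (A B : Ty N k) : Ty N k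
  /-- `A ⊸ B` -/
  | lolli {k : ℕ} (A B : Ty N k) : Ty N k
  /-- `1` -/
  | one {k : ℕ} : Ty N k
  /-- `V[e₁, …, eₙ]` -/
  | name {k : ℕ} (V : N.TName) (e : Fin (N.tIdx V) → Exp k) : Ty N k
  /-- `?{φ}. A`: the provider asserts `φ` -/
  | assert {k : ℕ} (φ : Fml k) (A : Ty N k) : Ty N k
  /-- `!{φ}. A`: the provider assumes `φ` -/
  | assume {k : ℕ} (φ : Fml k) (A : Ty N k) : Ty N k
  /-- `∃n. A` -/
  | ex {k : ℕ} (A : Ty N (k + 1)) : Ty N k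
  /-- `∀n. A` -/
  | all {k : ℕ} (A : Ty N (k + 1)) : Ty N k
  /-- `▷^r A`: the provider pays `r` -/
  | pay {k : ℕ} (r : Exp k) (A : Ty N k) : Ty N k
  /-- `◁^r A`: the provider gets `r` -/
  | get {k : ℕ} (r : Exp k) (A : Ty N k) : Ty N k

def Ty.subst {N : Names} : {k k' : ℕ} → (Fin k → Exp k') → Ty N k → Ty N k'
  | _, _, σ, .plus L A => .plus L (fun l => (A l).subst σ)
  | _, _, σ, .amp L A => .amp L (fun l => (A l).subst σ)
  | _, _, σ, .tensor A B => .tensor (A.subst σ) (B.subst σ)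
  | _, _, σ, .lolli A B => .lolli (A.subst σ) (B.subst σ)
  | _, _, _, .one => .one
  | _, _, σ, .name V e => .name V (fun i => (e i).subst σ)
  | _, _, σ, .assert φ A => .assert (φ.subst σ) (A.subst σ)
  | _, _, σ, .assume φ A => .assume (φ.subst σ) (A.subst σ)
  | _, _, σ, .ex A => .ex (A.subst (liftSubst σ))
  | _, _, σ, .all A => .all (A.subst (liftSubst σ))
  | _, _, σ, .pay r A => .pay (r.subst σ) (A.subst σ)
  | _, _, σ, .get r A => .get (r.subst σ) (A.subst σ)

/-! ### Channels and processes -/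

/-- Channels: bound channel variables (de Bruijn, `m` of them in scope, the most recent one
is `0`) and run-time channel names. -/
inductive Chan (m : ℕ) : Type
  | var (i : Fin m) : Chan m
  | name (a : ℕ) : Chan m
  deriving DecidableEq

/-- Run-time channels (`Fin 0` is empty). -/
abbrev Name := Chan 0

def Chan.wk {m : ℕ} : Chan m → Chan (m + 1)
  | .var i => .var i.succ
  | .name a => .name a

/-- Extend a renaming of channels by a value for the most recent variable. -/
def Chan.cons {m m' : ℕ} (c : Chan m') (ρ : Chan m → Chan m') : Chan (m + 1) → Chan m'
  | .var i => Fin.cases c (fun j => ρ (.var j)) i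
  | .name a => ρ (.name a)

/-- The renaming `ρ` below a binder. -/
def Chan.lift {m m' : ℕ} (ρ : Chan m → Chan m') : Chan (m + 1) → Chan (m' + 1) :=
  Chan.cons (.var 0) (fun c => (ρ c).wk)

/-- What can be sent along a channel `c`: a label (`c.k`), a channel (`send c w`), an index
(`send c {e}`), a proof of `φ` (`assert c {φ}`), or potential (`pay c {r}`). -/
inductive Payload (k m : ℕ) : Type
  | label (l : Label)
  | chan (w : Chan m)
  | idx (e : Exp k)
  | proof (φ : Fml k)
  | pot (r : Exp k)

def Payload.rename {k m m' : ℕ} (ρ : Chan m → Chan m') : Payload k m → Payload k m'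
  | .label l => .label l
  | .chan w => .chan (ρ w)
  | .idx e => .idx e
  | .proof φ => .proof φ
  | .pot r => .pot r

def Payload.subst {k k' m : ℕ} (σ : Fin k → Exp k') : Payload k m → Payload k' m
  | .label l => .label l
  | .chan w => .chan w
  | .idx e => .idx (e.subst σ)
  | .proof φ => .proof (φ.subst σ)
  | .pot r => .pot (r.subst σ)

/-- Process expressions with `k` index variables and `m` channel variables in scope. -/
inductive Proc (N : Names) : ℕ → ℕ → Type
  /-- `x ← y` -/
  | fwd {k m : ℕ} (x y : Chan m) : Proc N k m
  /-- `x ← f[e] y ; Q`, binding `x` in `Q` -/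
  | spawn {k m : ℕ} (f : N.PName) (e : Fin (N.pIdx f) → Exp k)
      (y : Fin (N.pChan f) → Chan m) (Q : Proc N k (m + 1)) : Proc N k m
  /-- `x.k ; P`, `send x w ; P`, `send x {e} ; P`, `assert x {φ} ; P` and `pay x {r} ; P` -/
  | send {k m : ℕ} (x : Chan m) (p : Payload k m) (P : Proc N k m) : Proc N k m
  /-- `case x (ℓ ⇒ Q_ℓ)_{ℓ ∈ L}` -/
  | case {k m : ℕ} (x : Chan m) (L : Finset Label) (Q : {l // l ∈ L} → Proc N k m) : Proc N k m
  /-- `y ← recv x ; Q`, binding `y` in `Q` -/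
  | recv {k m : ℕ} (x : Chan m) (Q : Proc N k (m + 1)) : Proc N k m
  /-- `close x` -/
  | close {k m : ℕ} (x : Chan m) : Proc N k m
  /-- `wait x ; Q` -/
  | wait {k m : ℕ} (x : Chan m) (Q : Proc N k m) : Proc N k m
  /-- `{n} ← recv x ; Q`, binding the index variable `n` in `Q` -/
  | recvIdx {k m : ℕ} (x : Chan m) (Q : Proc N (k + 1) m) : Proc N k m
  /-- `assume x {φ} ; Q` -/
  | assume {k m : ℕ} (x : Chan m) (φ : Fml k) (Q : Proc N k m) : Proc N k m
  /-- `get x {r} ; Q` -/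
  | get {k m : ℕ} (x : Chan m) (r : Exp k) (Q : Proc N k m) : Proc N k m
  /-- `work {r} ; P` -/
  | work {k m : ℕ} (r : Exp k) (P : Proc N k m) : Proc N k m
  /-- `impossible` -/
  | impossible {k m : ℕ} : Proc N k m

/-- Renaming of channels. -/
def Proc.rename {N : Names} : {k m m' : ℕ} → (Chan m → Chan m') → Proc N k m → Proc N k m'
  | _, _, _, ρ, .fwd x y => .fwd (ρ x) (ρ y)
  | _, _, _, ρ, .spawn f e y Q => .spawn f e (fun i => ρ (y i)) (Q.rename (Chan.lift ρ))
  | _, _, _, ρ, .send x p P => .send (ρ x) (p.rename ρ) (P.rename ρ)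
  | _, _, _, ρ, .case x L Q => .case (ρ x) L (fun l => (Q l).rename ρ)
  | _, _, _, ρ, .recv x Q => .recv (ρ x) (Q.rename (Chan.lift ρ))
  | _, _, _, ρ, .close x => .close (ρ x)
  | _, _, _, ρ, .wait x Q => .wait (ρ x) (Q.rename ρ)
  | _, _, _, ρ, .recvIdx x Q => .recvIdx (ρ x) (Q.rename ρ)
  | _, _, _, ρ, .assume x φ Q => .assume (ρ x) φ (Q.rename ρ)
  | _, _, _, ρ, .get x r Q => .get (ρ x) r (Q.rename ρ)
  | _, _, _, ρ, .work r P => .work r (P.rename ρ)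
  | _, _, _, _, .impossible => .impossible

/-- Substitution for index variables. -/
def Proc.subst {N : Names} : {k k' m : ℕ} → (Fin k → Exp k') → Proc N k m → Proc N k' m
  | _, _, _, _, .fwd x y => .fwd x y
  | _, _, _, σ, .spawn f e y Q => .spawn f (fun i => (e i).subst σ) y (Q.subst σ)
  | _, _, _, σ, .send x p P => .send x (p.subst σ) (P.subst σ)
  | _, _, _, σ, .case x L Q => .case x L (fun l => (Q l).subst σ)
  | _, _, _, σ, .recv x Q => .recv x (Q.subst σ)
  | _, _, _, _, .close x => .close x
  | _, _, _, σ, .wait x Q => .wait x (Q.subst σ)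
  | _, _, _, σ, .recvIdx x Q => .recvIdx x (Q.subst (liftSubst σ))
  | _, _, _, σ, .assume x φ Q => .assume x (φ.subst σ) (Q.subst σ)
  | _, _, _, σ, .get x r Q => .get x (r.subst σ) (Q.subst σ)
  | _, _, _, σ, .work r P => .work (r.subst σ) (P.subst σ)
  | _, _, _, _, .impossible => .impossible

/-- The channel `c` occurs free in the process. -/
def Proc.Mentions {N : Names} : {k m : ℕ} → Chan m → Proc N k m → Prop
  | _, _, c, .fwd x y => c = x ∨ c = y
  | _, _, c, .spawn _ _ y Q => (∃ i, c = y i) ∨ Q.Mentions c.wk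
  | _, _, c, .send x p P => c = x ∨ p = .chan c ∨ P.Mentions c
  | _, _, c, .case x _ Q => c = x ∨ ∃ l, (Q l).Mentions c
  | _, _, c, .recv x Q => c = x ∨ Q.Mentions c.wk
  | _, _, c, .close x => c = x
  | _, _, c, .wait x Q => c = x ∨ Q.Mentions c
  | _, _, c, .recvIdx x Q => c = x ∨ Q.Mentions c
  | _, _, c, .assume x _ Q => c = x ∨ Q.Mentions c
  | _, _, c, .get x _ Q => c = x ∨ Q.Mentions c
  | _, _, c, .work _ P => P.Mentions c
  | _, _, _, .impossible => False

/-- The renaming `[c'/c]`. -/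
def Chan.repl (c c' : Name) : Name → Name := fun a => if a = c then c' else a

/-! ### Signatures and type equality -/

/-- A signature: a definition for every type name; an interface `y : B ⊢^q f[n] :: (x : A)` and
a body for every process name. In the body of `f`, channel variable `0` is the provided channel
`x` and channel variable `i + 1` is the argument `y_i`. -/
structure Sig (N : Names) where
  tdef : (V : N.TName) → Ty N (N.tIdx V)
  parg : (f : N.PName) → Fin (N.pChan f) → Ty N (N.pIdx f)
  pres : (f : N.PName) → Ty N (N.pIdx f)
  ppot : (f : N.PName) → Exp (N.pIdx f)
  pbody : (f : N.PName) → Proc N (N.pIdx f) (N.pChan f + 1)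

section
variable {N : Names}

/-- `unfold(V[e]) = A[e/n]` if `V[n] = A` is the definition of `V`, and `unfold(A) = A` for any
other type. -/
def Sig.unfold (Sg : Sig N) {k : ℕ} : Ty N k → Ty N k
  | .name V e => (Sg.tdef V).subst e
  | A => A

/-- One layer of a type bisimulation, between unfolded closed types. -/
inductive Sim (R : Ty N 0 → Ty N 0 → Prop) : Ty N 0 → Ty N 0 → Prop
  | plus {L : Finset Label} {A B : {l // l ∈ L} → Ty N 0} :
      (∀ l, R (A l) (B l)) → Sim R (.plus L A) (.plus L B)
  | amp {L : Finset Label} {A B : {l // l ∈ L} → Ty N 0} :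
      (∀ l, R (A l) (B l)) → Sim R (.amp L A) (.amp L B)
  | tensor {A A' B B' : Ty N 0} : R A B → R A' B' → Sim R (.tensor A A') (.tensor B B')
  | lolli {A A' B B' : Ty N 0} : R A B → R A' B' → Sim R (.lolli A A') (.lolli B B')
  | one : Sim R .one .one
  | assert {φ ψ : Fml 0} {A B : Ty N 0} :
      (Entails .top φ ∧ Entails .top ψ ∧ R A B) ∨
        (Entails .top φ.not ∧ Entails .top ψ.not) →
      Sim R (.assert φ A) (.assert ψ B)
  | assume {φ ψ : Fml 0} {A B : Ty N 0} :
      (Entails .top φ ∧ Entails .top ψ ∧ R A B) ∨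
        (Entails .top φ.not ∧ Entails .top ψ.not) →
      Sim R (.assume φ A) (.assume ψ B)
  | ex {A B : Ty N 1} :
      (∀ i : ℕ, R (A.subst (single (.const i))) (B.subst (single (.const i)))) →
      Sim R (.ex A) (.ex B)
  | all {A B : Ty N 1} :
      (∀ i : ℕ, R (A.subst (single (.const i))) (B.subst (single (.const i)))) →
      Sim R (.all A) (.all B)
  | pay {r s : Exp 0} {A B : Ty N 0} :
      Entails .top (.eq r s) → R A B → Sim R (.pay r A) (.pay s B)
  | get {r s : Exp 0} {A B : Ty N 0} :
      Entails .top (.eq r s) → R A B → Sim R (.get r A) (.get s B)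

/-- Type bisimulations. -/
def Sig.Bisim (Sg : Sig N) (R : Ty N 0 → Ty N 0 → Prop) : Prop :=
  ∀ A B, R A B → Sim R (Sg.unfold A) (Sg.unfold B)

/-- Equality `A ≡ B` of closed types. -/
def Sig.Equal (Sg : Sig N) (A B : Ty N 0) : Prop := ∃ R, Sg.Bisim R ∧ R A B

/-- Equality `∀𝒱. C ⇒ A ≡ B` of open types: every ground instance that satisfies `C` is an
equality. -/
def Sig.EqualUnder (Sg : Sig N) {k : ℕ} (C : Fml k) (A B : Ty N k) : Prop :=
  ∀ ρ : Fin k → ℕ, C.Holds (fun i => (ρ i : ℤ)) →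
    Sg.Equal (A.subst (fun i => .const (ρ i))) (B.subst (fun i => .const (ρ i)))

/-! ### Typing of processes -/

/-- Linear contexts: partial maps from channels to types. -/
abbrev Ctx (N : Names) (k m : ℕ) := Chan m → Option (Ty N k)

/-- The empty context. -/
def Ctx.empty {k m : ℕ} : Ctx N k m := fun _ => none

/-- `Γ` with the type of `x` set to `A`. -/
def Ctx.set {k m : ℕ} (Γ : Ctx N k m) (x : Chan m) (A : Ty N k) : Ctx N k m :=
  Function.update Γ x (some A)

/-- `Γ` without `x`. -/
def Ctx.del {k m : ℕ} (Γ : Ctx N k m) (x : Chan m) : Ctx N k m := Function.update Γ x none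

/-- `Γ` without the channels `y i`. -/
def Ctx.delAll {k m j : ℕ} (Γ : Ctx N k m) (y : Fin j → Chan m) : Ctx N k m :=
  fun c => if ∃ i, y i = c then none else Γ c

/-- `Γ` extended by a new channel variable of type `A`. -/
def Ctx.push {k m : ℕ} (Γ : Ctx N k m) (A : Ty N k) : Ctx N k (m + 1)
  | .var i => Fin.cases (some A) (fun j => Γ (.var j)) i
  | .name a => Γ (.name a)

/-- `Γ` in a scope with a new index variable. -/
def Ctx.wkIdx {k m : ℕ} (Γ : Ctx N k m) : Ctx N (k + 1) m :=
  fun c => (Γ c).map (Ty.subst shift)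

/-- The channels declared in a context. -/
def Ctx.dom {k m : ℕ} (Γ : Ctx N k m) : Set (Chan m) := {c | Γ c ≠ none}

/-- `Typed Sg C Γ q P x A` is the judgment `𝒱 ; C ; Γ ⊢^q P :: (x : A)`. Types are
equirecursive: every rule looks at the unfolding of the type of the channel it acts on. -/
inductive Typed (Sg : Sig N) : {k m : ℕ} → Fml k → Ctx N k m → Exp k → Proc N k m →
    Chan m → Ty N k → Prop
  | id {k m : ℕ} {C : Fml k} {q : Exp k} {x y : Chan m} {A B : Ty N k} :
      Entails C (.eq q (.const 0)) → Sg.EqualUnder C A B →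
      Typed Sg C (Ctx.empty.set y A) q (.fwd x y) x B
  | spawn {k m : ℕ} {C : Fml k} {Γ : Ctx N k m} {r : Exp k} {f : N.PName}
      {e : Fin (N.pIdx f) → Exp k} {y : Fin (N.pChan f) → Chan m} {Q : Proc N k (m + 1)}
      {z : Chan m} {D : Ty N k} (B : Fin (N.pChan f) → Ty N k) :
      (∀ i, IsNat C (e i)) →
      Entails C (.ge r ((Sg.ppot f).subst e)) →
      Function.Injective y →
      (∀ i, Γ (y i) = some (B i)) →
      (∀ i, Sg.EqualUnder C (B i) ((Sg.parg f i).subst e)) →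
      Typed Sg C ((Γ.delAll y).push ((Sg.pres f).subst e)) (.sub r ((Sg.ppot f).subst e))
        Q z.wk D →
      Typed Sg C Γ r (.spawn f e y Q) z D
  | plusR {k m : ℕ} {C : Fml k} {Γ : Ctx N k m} {q : Exp k} {x : Chan m} {A : Ty N k}
      {L : Finset Label} {F : {l // l ∈ L} → Ty N k} {l : {l // l ∈ L}} {P : Proc N k m} :
      Sg.unfold A = .plus L F →
      Typed Sg C Γ q P x (F l) →
      Typed Sg C Γ q (.send x (.label l) P) x A
  | plusL {k m : ℕ} {C : Fml k} {Γ : Ctx N k m} {q : Exp k} {x z : Chan m} {A D : Ty N k}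
      {L : Finset Label} {F : {l // l ∈ L} → Ty N k} {Q : {l // l ∈ L} → Proc N k m} :
      Γ x = some A → Sg.unfold A = .plus L F →
      (∀ l, Typed Sg C (Γ.set x (F l)) q (Q l) z D) →
      Typed Sg C Γ q (.case x L Q) z D
  | ampR {k m : ℕ} {C : Fml k} {Γ : Ctx N k m} {q : Exp k} {x : Chan m} {A : Ty N k}
      {L : Finset Label} {F : {l // l ∈ L} → Ty N k} {P : {l // l ∈ L} → Proc N k m} :
      Sg.unfold A = .amp L F →
      (∀ l, Typed Sg C Γ q (P l) x (F l)) →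
      Typed Sg C Γ q (.case x L P) x A
  | ampL {k m : ℕ} {C : Fml k} {Γ : Ctx N k m} {q : Exp k} {x z : Chan m} {A D : Ty N k}
      {L : Finset Label} {F : {l // l ∈ L} → Ty N k} {l : {l // l ∈ L}} {Q : Proc N k m} :
      Γ x = some A → Sg.unfold A = .amp L F →
      Typed Sg C (Γ.set x (F l)) q Q z D →
      Typed Sg C Γ q (.send x (.label l) Q) z D
  | lolliR {k m : ℕ} {C : Fml k} {Γ : Ctx N k m} {q : Exp k} {x : Chan m} {A A₁ A₂ : Ty N k}
      {P : Proc N k (m + 1)} :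
      Sg.unfold A = .lolli A₁ A₂ →
      Typed Sg C (Γ.push A₁) q P x.wk A₂ →
      Typed Sg C Γ q (.recv x P) x A
  | lolliL {k m : ℕ} {C : Fml k} {Γ : Ctx N k m} {q : Exp k} {x w z : Chan m}
      {A A₁ A₂ B D : Ty N k} {Q : Proc N k m} :
      Γ x = some A → Sg.unfold A = .lolli A₁ A₂ →
      w ≠ x → Γ w = some B → Sg.EqualUnder C B A₁ →
      Typed Sg C ((Γ.del w).set x A₂) q Q z D →
      Typed Sg C Γ q (.send x (.chan w) Q) z D
  | tensorR {k m : ℕ} {C : Fml k} {Γ : Ctx N k m} {q : Exp k} {x w : Chan m}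
      {A A₁ A₂ B : Ty N k} {P : Proc N k m} :
      Sg.unfold A = .tensor A₁ A₂ →
      Γ w = some B → Sg.EqualUnder C B A₁ →
      Typed Sg C (Γ.del w) q P x A₂ →
      Typed Sg C Γ q (.send x (.chan w) P) x A
  | tensorL {k m : ℕ} {C : Fml k} {Γ : Ctx N k m} {q : Exp k} {x z : Chan m}
      {A A₁ A₂ D : Ty N k} {Q : Proc N k (m + 1)} :
      Γ x = some A → Sg.unfold A = .tensor A₁ A₂ →
      Typed Sg C ((Γ.set x A₂).push A₁) q Q z.wk D →
      Typed Sg C Γ q (.recv x Q) z D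
  | oneR {k m : ℕ} {C : Fml k} {q : Exp k} {x : Chan m} {A : Ty N k} :
      Sg.unfold A = .one → Entails C (.eq q (.const 0)) →
      Typed Sg C Ctx.empty q (.close x) x A
  | oneL {k m : ℕ} {C : Fml k} {Γ : Ctx N k m} {q : Exp k} {x z : Chan m} {A D : Ty N k}
      {Q : Proc N k m} :
      Γ x = some A → Sg.unfold A = .one →
      Typed Sg C (Γ.del x) q Q z D →
      Typed Sg C Γ q (.wait x Q) z D
  | exR {k m : ℕ} {C : Fml k} {Γ : Ctx N k m} {q e : Exp k} {x : Chan m} {A : Ty N k}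
      {A' : Ty N (k + 1)} {P : Proc N k m} :
      Sg.unfold A = .ex A' → IsNat C e →
      Typed Sg C Γ q P x (A'.subst (single e)) →
      Typed Sg C Γ q (.send x (.idx e) P) x A
  | exL {k m : ℕ} {C : Fml k} {Γ : Ctx N k m} {q : Exp k} {x z : Chan m} {A D : Ty N k}
      {A' : Ty N (k + 1)} {Q : Proc N (k + 1) m} :
      Γ x = some A → Sg.unfold A = .ex A' →
      Typed Sg (C.subst shift) (Γ.wkIdx.set x A') (q.subst shift) Q z (D.subst shift) →
      Typed Sg C Γ q (.recvIdx x Q) z D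
  | allR {k m : ℕ} {C : Fml k} {Γ : Ctx N k m} {q : Exp k} {x : Chan m} {A : Ty N k}
      {A' : Ty N (k + 1)} {P : Proc N (k + 1) m} :
      Sg.unfold A = .all A' →
      Typed Sg (C.subst shift) Γ.wkIdx (q.subst shift) P x A' →
      Typed Sg C Γ q (.recvIdx x P) x A
  | allL {k m : ℕ} {C : Fml k} {Γ : Ctx N k m} {q e : Exp k} {x z : Chan m} {A D : Ty N k}
      {A' : Ty N (k + 1)} {Q : Proc N k m} :
      Γ x = some A → Sg.unfold A = .all A' → IsNat C e →
      Typed Sg C (Γ.set x (A'.subst (single e))) q Q z D →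
      Typed Sg C Γ q (.send x (.idx e) Q) z D
  | assertR {k m : ℕ} {C : Fml k} {Γ : Ctx N k m} {q : Exp k} {x : Chan m} {A A' : Ty N k}
      {φ φ' : Fml k} {P : Proc N k m} :
      Sg.unfold A = .assert φ' A' → Entails C φ → Entails C φ' →
      Typed Sg C Γ q P x A' →
      Typed Sg C Γ q (.send x (.proof φ) P) x A
  | assertL {k m : ℕ} {C : Fml k} {Γ : Ctx N k m} {q : Exp k} {x z : Chan m}
      {A A' D : Ty N k} {φ φ' : Fml k} {Q : Proc N k m} :
      Γ x = some A → Sg.unfold A = .assert φ' A' → Entails (C.and φ') φ →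
      Typed Sg (C.and φ) (Γ.set x A') q Q z D →
      Typed Sg C Γ q (.assume x φ Q) z D
  | assumeR {k m : ℕ} {C : Fml k} {Γ : Ctx N k m} {q : Exp k} {x : Chan m} {A A' : Ty N k}
      {φ φ' : Fml k} {P : Proc N k m} :
      Sg.unfold A = .assume φ' A' → Entails (C.and φ') φ →
      Typed Sg (C.and φ) Γ q P x A' →
      Typed Sg C Γ q (.assume x φ P) x A
  | assumeL {k m : ℕ} {C : Fml k} {Γ : Ctx N k m} {q : Exp k} {x z : Chan m}
      {A A' D : Ty N k} {φ φ' : Fml k} {Q : Proc N k m} :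
      Γ x = some A → Sg.unfold A = .assume φ' A' → Entails C φ → Entails C φ' →
      Typed Sg C (Γ.set x A') q Q z D →
      Typed Sg C Γ q (.send x (.proof φ) Q) z D
  | payR {k m : ℕ} {C : Fml k} {Γ : Ctx N k m} {q r₁ r₂ : Exp k} {x : Chan m}
      {A A' : Ty N k} {P : Proc N k m} :
      Sg.unfold A = .pay r₂ A' → IsNat C r₁ → Entails C (.ge q r₁) → Entails C (.eq r₁ r₂) →
      Typed Sg C Γ (.sub q r₁) P x A' →
      Typed Sg C Γ q (.send x (.pot r₁) P) x A
  | payL {k m : ℕ} {C : Fml k} {Γ : Ctx N k m} {q r₁ r₂ : Exp k} {x z : Chan m}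
      {A A' D : Ty N k} {Q : Proc N k m} :
      Γ x = some A → Sg.unfold A = .pay r₂ A' → Entails C (.eq r₁ r₂) →
      Typed Sg C (Γ.set x A') (.add q r₁) Q z D →
      Typed Sg C Γ q (.get x r₁ Q) z D
  | getR {k m : ℕ} {C : Fml k} {Γ : Ctx N k m} {q r₁ r₂ : Exp k} {x : Chan m}
      {A A' : Ty N k} {P : Proc N k m} :
      Sg.unfold A = .get r₂ A' → Entails C (.eq r₁ r₂) →
      Typed Sg C Γ (.add q r₁) P x A' →
      Typed Sg C Γ q (.get x r₁ P) x A
  | getL {k m : ℕ} {C : Fml k} {Γ : Ctx N k m} {q r₁ r₂ : Exp k} {x z : Chan m}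
      {A A' D : Ty N k} {Q : Proc N k m} :
      Γ x = some A → Sg.unfold A = .get r₂ A' →
      IsNat C r₁ → Entails C (.ge q r₁) → Entails C (.eq r₁ r₂) →
      Typed Sg C (Γ.set x A') (.sub q r₁) Q z D →
      Typed Sg C Γ q (.send x (.pot r₁) Q) z D
  | work {k m : ℕ} {C : Fml k} {Γ : Ctx N k m} {q r : Exp k} {x : Chan m} {A : Ty N k}
      {P : Proc N k m} :
      IsNat C r → Entails C (.ge q r) →
      Typed Sg C Γ (.sub q r) P x A →
      Typed Sg C Γ q (.work r P) x A
  | unsat {k m : ℕ} {C : Fml k} {Γ : Ctx N k m} {q : Exp k} {x : Chan m} {A : Ty N k} :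
      Entails C .bot →
      Typed Sg C Γ q .impossible x A

/-- The context `y₁ : B₁, …, yⱼ : Bⱼ` in which the body of `f` is typed. -/
def Sig.argCtx (Sg : Sig N) (f : N.PName) : Ctx N (N.pIdx f) (N.pChan f + 1)
  | .var i => Fin.cases none (fun j => some (Sg.parg f j)) i
  | .name _ => none

/-- Well-formed signatures: type definitions are contractive, the potentials of process
definitions are natural numbers, and their bodies have the declared types. -/
structure Sig.WF (Sg : Sig N) : Prop where
  contractive : ∀ V W e, Sg.tdef V ≠ .name W e
  potential : ∀ f, IsNat .top (Sg.ppot f)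
  typed : ∀ f, Typed Sg .top (Sg.argCtx f) (Sg.ppot f) (Sg.pbody f) (.var 0) (Sg.pres f)

/-! ### Configurations -/

/-- Semantic objects `proc(c, w, P)` and `msg(c, w, M)`. -/
inductive Obj (N : Names) : Type
  | proc (c : Name) (w : ℕ) (P : Proc N 0 0) : Obj N
  | msg (c : Name) (w : ℕ) (M : Proc N 0 0) : Obj N

/-- The channel provided by an object. -/
def Obj.chan : Obj N → Name
  | .proc c _ _ => c
  | .msg c _ _ => c

/-- The channel `a` occurs in an object. -/
def Obj.Mentions (a : Name) : Obj N → Prop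
  | .proc c _ P => a = c ∨ P.Mentions a
  | .msg c _ M => a = c ∨ M.Mentions a

/-- Configurations are multisets of objects. -/
abbrev Conf (N : Names) := Multiset (Obj N)

/-- `IsMsg c M`: `M` is a message expression that provides `c`, that is, it sends one payload
along `c` with continuation channel `c'` (`c.k ; c ← c'` and the like), or along a used channel
`d` with continuation channel `c` (`d.k ; c ← d` and the like), or it is `close c`. -/
inductive IsMsg : Name → Proc N 0 0 → Prop
  | pos (c c' : Name) (p : Payload 0 0) : IsMsg c (.send c p (.fwd c c'))
  | neg (c d : Name) (p : Payload 0 0) : IsMsg c (.send d p (.fwd c d))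
  | close (c : Name) : IsMsg c (.close c)

/-- Disjointness of contexts. -/
def Ctx.Disj {k m : ℕ} (Δ Γ : Ctx N k m) : Prop := ∀ c, Δ c = none ∨ Γ c = none

/-- The union `Δ, Γ` of disjoint contexts. -/
def Ctx.join {k m : ℕ} (Δ Γ : Ctx N k m) : Ctx N k m := fun c => (Δ c).or (Γ c)

/-- Two interfaces declare the same channels, with equal types. -/
def Sig.EqualCtx (Sg : Sig N) (Δ Δ' : Ctx N 0 0) : Prop :=
  ∀ c, Option.Rel Sg.Equal (Δ c) (Δ' c)

/-- The rules for `Δ ⊩^E S :: Δ'`. The rule `conv` says that the types in an interface are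
taken up to type equality. -/
inductive ConfTyped (Sg : Sig N) : Ctx N 0 0 → ℕ → Conf N → Ctx N 0 0 → Prop
  | emp : ConfTyped Sg Ctx.empty 0 0 Ctx.empty
  | compose {Δ Δ' Δ'' : Ctx N 0 0} {E E' : ℕ} {S S' : Conf N} :
      ConfTyped Sg Δ E S Δ' → ConfTyped Sg Δ' E' S' Δ'' →
      ConfTyped Sg Δ (E + E') (S + S') Δ''
  | proc {Δ Γ : Ctx N 0 0} {p : Exp 0} {n w : ℕ} {x : Name} {P : Proc N 0 0} {A : Ty N 0} :
      Typed Sg .top Γ p P x A → p.val = (n : ℤ) →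
      Δ.Disj Γ → Δ x = none → Γ x = none →
      ConfTyped Sg (Δ.join Γ) (n + w) {Obj.proc x w P} (Δ.set x A)
  | msg {Δ Γ : Ctx N 0 0} {p : Exp 0} {n w : ℕ} {x : Name} {M : Proc N 0 0} {A : Ty N 0} :
      IsMsg x M → Typed Sg .top Γ p M x A → p.val = (n : ℤ) →
      Δ.Disj Γ → Δ x = none → Γ x = none →
      ConfTyped Sg (Δ.join Γ) (n + w) {Obj.msg x w M} (Δ.set x A)
  | conv {Δ₁ Δ₁' Δ₂ Δ₂' : Ctx N 0 0} {E : ℕ} {S : Conf N} :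
      ConfTyped Sg Δ₁ E S Δ₂ → Sg.EqualCtx Δ₁ Δ₁' → Sg.EqualCtx Δ₂ Δ₂' →
      ConfTyped Sg Δ₁' E S Δ₂'

/-- Well-typed configurations: the typing judgment together with the standing conventions that
contexts are finite and that the channels provided by the objects of a configuration are distinct
from each other and from the channels used from outside. -/
structure WellTyped (Sg : Sig N) (Δ₁ : Ctx N 0 0) (E : ℕ) (S : Conf N) (Δ₂ : Ctx N 0 0) :
    Prop where
  typed : ConfTyped Sg Δ₁ E S Δ₂
  finite : Δ₁.dom.Finite
  nodup : (S.map Obj.chan).Nodup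
  outside : ∀ o ∈ S, Δ₁ o.chan = none

/-! ### Operational semantics -/

/-- The rewriting rules; `fresh a` says that the channel `a` may be chosen as a fresh one.
The rules named `sendR` and `sendL` cover all five kinds of payload. -/
inductive Rewrite (Sg : Sig N) (fresh : Name → Prop) : List (Obj N) → List (Obj N) → Prop
  | idPos {c d : Name} {w w' : ℕ} {M : Proc N 0 0} :
      Rewrite Sg fresh [.msg d w M, .proc c w' (.fwd c d)]
        [.msg c (w + w') (M.rename (Chan.repl d c))]
  | idNeg {c d e : Name} {w w' : ℕ} {M : Proc N 0 0} :
      M.Mentions c →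
      Rewrite Sg fresh [.proc c w (.fwd c d), .msg e w' M]
        [.msg e (w + w') (M.rename (Chan.repl c d))]
  | spawn {a c : Name} {w : ℕ} {f : N.PName} {e : Fin (N.pIdx f) → Exp 0}
      {y : Fin (N.pChan f) → Name} {Q : Proc N 0 1} :
      fresh a →
      Rewrite Sg fresh [.proc c w (.spawn f e y Q)]
        [.proc a 0 (((Sg.pbody f).subst e).rename
            (Chan.cons a (fun b => match b with | .var i => y i | .name b => .name b))),
          .proc c w (Q.rename (Chan.cons a (fun b => b)))]
  /-- The provider sends: `⊕S`, `⊗S`, `∃S`, `?S`, `▷S`. -/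
  | sendR {c c' : Name} {w : ℕ} {p : Payload 0 0} {P : Proc N 0 0} :
      fresh c' →
      Rewrite Sg fresh [.proc c w (.send c p P)]
        [.proc c' w (P.rename (Chan.repl c c')), .msg c 0 (.send c p (.fwd c c'))]
  /-- The client sends: `&S`, `⊸S`, `∀S`, `!S`, `◁S`. -/
  | sendL {c c' d : Name} {w : ℕ} {p : Payload 0 0} {Q : Proc N 0 0} :
      fresh c' → d ≠ c →
      Rewrite Sg fresh [.proc d w (.send c p Q)]
        [.msg c' 0 (.send c p (.fwd c' c)), .proc d w (Q.rename (Chan.repl c c'))]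
  | plusC {c c' d : Name} {w w' : ℕ} {L : Finset Label} {l : {l // l ∈ L}}
      {Q : {l // l ∈ L} → Proc N 0 0} :
      Rewrite Sg fresh [.msg c w' (.send c (.label l) (.fwd c c')), .proc d w (.case c L Q)]
        [.proc d (w + w') ((Q l).rename (Chan.repl c c'))]
  | ampC {c c' : Name} {w w' : ℕ} {L : Finset Label} {l : {l // l ∈ L}}
      {Q : {l // l ∈ L} → Proc N 0 0} :
      Rewrite Sg fresh [.proc c w (.case c L Q), .msg c' w' (.send c (.label l) (.fwd c' c))]
        [.proc c' (w + w') ((Q l).rename (Chan.repl c c'))]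
  | oneS {c : Name} {w : ℕ} :
      Rewrite Sg fresh [.proc c w (.close c)] [.msg c w (.close c)]
  | oneC {c d : Name} {w w' : ℕ} {Q : Proc N 0 0} :
      Rewrite Sg fresh [.msg c w' (.close c), .proc d w (.wait c Q)] [.proc d (w + w') Q]
  | tensorC {c c' d e : Name} {w w' : ℕ} {Q : Proc N 0 1} :
      Rewrite Sg fresh [.msg c w' (.send c (.chan d) (.fwd c c')), .proc e w (.recv c Q)]
        [.proc e (w + w') (Q.rename (Chan.cons d (Chan.repl c c')))]
  | lolliC {c c' d : Name} {w w' : ℕ} {P : Proc N 0 1} :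
      Rewrite Sg fresh [.proc c w (.recv c P), .msg c' w' (.send c (.chan d) (.fwd c' c))]
        [.proc c' (w + w') (P.rename (Chan.cons d (Chan.repl c c')))]
  | exC {c c' d : Name} {w w' : ℕ} {e : Exp 0} {Q : Proc N 1 0} :
      Rewrite Sg fresh [.msg c w' (.send c (.idx e) (.fwd c c')), .proc d w (.recvIdx c Q)]
        [.proc d (w + w') ((Q.subst (single e)).rename (Chan.repl c c'))]
  | allC {c c' : Name} {w w' : ℕ} {e : Exp 0} {Q : Proc N 1 0} :
      Rewrite Sg fresh [.proc c w (.recvIdx c Q), .msg c' w' (.send c (.idx e) (.fwd c' c))]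
        [.proc c' (w + w') ((Q.subst (single e)).rename (Chan.repl c c'))]
  | assertC {c c' d : Name} {w w' : ℕ} {φ ψ : Fml 0} {Q : Proc N 0 0} :
      Rewrite Sg fresh [.msg c w' (.send c (.proof φ) (.fwd c c')), .proc d w (.assume c ψ Q)]
        [.proc d (w + w') (Q.rename (Chan.repl c c'))]
  | assumeC {c c' : Name} {w w' : ℕ} {φ ψ : Fml 0} {Q : Proc N 0 0} :
      Rewrite Sg fresh [.proc c w (.assume c ψ Q), .msg c' w' (.send c (.proof φ) (.fwd c' c))]
        [.proc c' (w + w') (Q.rename (Chan.repl c c'))]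
  | payC {c c' d : Name} {w w' : ℕ} {r s : Exp 0} {Q : Proc N 0 0} :
      r.val = s.val →
      Rewrite Sg fresh [.msg c w' (.send c (.pot r) (.fwd c c')), .proc d w (.get c s Q)]
        [.proc d (w + w') (Q.rename (Chan.repl c c'))]
  | getC {c c' : Name} {w w' : ℕ} {r s : Exp 0} {Q : Proc N 0 0} :
      r.val = s.val →
      Rewrite Sg fresh [.proc c w (.get c s Q), .msg c' w' (.send c (.pot r) (.fwd c' c))]
        [.proc c' (w + w') (Q.rename (Chan.repl c c'))]
  | work {c : Name} {w n : ℕ} {r : Exp 0} {P : Proc N 0 0} :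
      r.val = (n : ℤ) →
      Rewrite Sg fresh [.proc c w (.work r P)] [.proc c (w + n) P]

/-- `S ↦ S'`: some objects of `S` are rewritten by one of the rules. Fresh channels are those
that neither occur in `S` nor belong to the set `U` of channels of the interface. -/
def Step (Sg : Sig N) (U : Set Name) (S S' : Conf N) : Prop :=
  ∃ (K : Conf N) (l r : List (Obj N)),
    Rewrite Sg (fun a => a ∉ U ∧ ∀ o ∈ S, ¬ o.Mentions a) l r ∧
      S = K + (l : Conf N) ∧ S' = K + (r : Conf N)

/-! ### Poised configurations -/

/-- The process is about to receive along `c`. -/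
inductive Receives : Name → Proc N 0 0 → Prop
  | case (c : Name) (L : Finset Label) (Q : {l // l ∈ L} → Proc N 0 0) :
      Receives c (.case c L Q)
  | recv (c : Name) (Q : Proc N 0 1) : Receives c (.recv c Q)
  | wait (c : Name) (Q : Proc N 0 0) : Receives c (.wait c Q)
  | recvIdx (c : Name) (Q : Proc N 1 0) : Receives c (.recvIdx c Q)
  | assume (c : Name) (φ : Fml 0) (Q : Proc N 0 0) : Receives c (.assume c φ Q)
  | get (c : Name) (r : Exp 0) (Q : Proc N 0 0) : Receives c (.get c r Q)

/-- An object is poised if it is a process that is trying to receive along the channel `c` it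
provides (a forwarding process `c ← d` waits for messages along `c` as well as along `d`), or a
message that is sent along the channel it provides. -/
inductive Obj.Poised : Obj N → Prop
  | recv {c : Name} {w : ℕ} {P : Proc N 0 0} : Receives c P → Obj.Poised (.proc c w P)
  | fwd {c d : Name} {w : ℕ} : Obj.Poised (.proc c w (.fwd c d))
  | send {c : Name} {w : ℕ} {p : Payload 0 0} {P : Proc N 0 0} :
      Obj.Poised (.msg c w (.send c p P))
  | close {c : Name} {w : ℕ} : Obj.Poised (.msg c w (.close c))

/-- The object waits for the provider of a channel `d` that it uses: a process that is trying to
receive along `d`, a forwarding process `c ← d`, or a message that is sent along `d`. -/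
inductive Obj.WaitsFor : Obj N → Name → Prop
  | recv {c d : Name} {w : ℕ} {P : Proc N 0 0} :
      d ≠ c → Receives d P → Obj.WaitsFor (.proc c w P) d
  | fwd {c d : Name} {w : ℕ} : Obj.WaitsFor (.proc c w (.fwd c d)) d
  | send {c d : Name} {w : ℕ} {p : Payload 0 0} {P : Proc N 0 0} :
      d ≠ c → Obj.WaitsFor (.msg c w (.send d p P)) d

/-- The object waits, directly or through other objects of `S`, for the outside provider of a
channel in `Δ₁`. If `Δ₁` is empty, then no object does. -/
inductive WaitsOutside (Δ₁ : Ctx N 0 0) (S : Conf N) : Obj N → Prop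
  | direct {o : Obj N} {d : Name} : o.WaitsFor d → d ∈ Δ₁.dom → WaitsOutside Δ₁ S o
  | through {o o' : Obj N} : o.WaitsFor o'.chan → o' ∈ S → WaitsOutside Δ₁ S o' →
      WaitsOutside Δ₁ S o

/-- A configuration with outside providers `Δ₁` is poised if every object is poised or waits for
the outside. For empty `Δ₁` this says that every object is poised. -/
def Poised (Δ₁ : Ctx N 0 0) (S : Conf N) : Prop :=
  ∀ o ∈ S, o.Poised ∨ WaitsOutside Δ₁ S o

end

end SessionTypes

/-!
# Type safety of session types with arithmetic refinements

**Syntax.** Process typing is stable under substitution of natural numbers for index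
variables (`Typed.subst`), discharge of a constraint that holds (`Typed.strengthen`) and renaming of
channels that is injective on the channels in the judgment (`Typed.rename`). Type equality is an
equivalence relation, and by `Sig.WF.equal_subst` closed instances of a type are equal as soon as
the substituted expressions have the same values. Process typing is not invariant under
replacing the type of a channel by an equal one: under a constraint that does not hold, equal types
may have different outermost constructors. Hence the types in the derivation of each object are kept
as they are, and type equality is only used between the provider and the client of a channel.

**Configurations.** A derivation of configuration typing is the same as a list of the objects in
which every object uses channels provided earlier (`Chain`, `ConfTyped.exists_chain`,
`Chain.confTyped`). Since channels are linear and have one provider each, the provider of a channel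
can be moved past the other objects up to its client (`Chain.move`, `Chain.focus`), so each rewriting
rule acts on neighbours and only has to be checked locally.

**Preservation.** A local check replaces two neighbours by one object (`CutsTo`, `Chain.contract`) or
one object by two neighbours (`SplitsInto`, `Chain.expand`), with the same total of potential and
work. All five kinds of payloads are treated together: `Emits` describes what a type lets its channel
send, and `Reacts` what a receiving process does with a payload.

**Progress.** In a configuration without steps, go through the chain from left to right. Each object
turns out to wait for the outside or to be `Ready`: a sender along its own channel of positive type,
or a receiving or forwarding process along its own channel of negative type
(`ObjTyped.ready`). A client that meets a ready provider could take a step with it, unless it is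
a forwarding process on a negative type, which is then ready itself.
-/

namespace SessionTypes

/-! ### Substitution and evaluation -/

theorem Exp.eval_subst {k k' : ℕ} (a : Exp k) (σ : Fin k → Exp k') (ρ : Fin k' → ℤ) :
    (a.subst σ).eval ρ = a.eval (fun i => (σ i).eval ρ) := by
  induction a <;> simp_all [Exp.subst, Exp.eval]

theorem Exp.subst_subst {k k' k'' : ℕ} (a : Exp k) (σ : Fin k → Exp k') (τ : Fin k' → Exp k'') :
    (a.subst σ).subst τ = a.subst (fun i => (σ i).subst τ) := by
  induction a <;> simp_all [Exp.subst]

theorem Exp.subst_var {k : ℕ} (a : Exp k) : a.subst Exp.var = a := by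
  induction a <;> simp_all [Exp.subst]

theorem liftSubst_comp {k k' k'' : ℕ} (σ : Fin k → Exp k') (τ : Fin k' → Exp k'') :
    (fun i => (liftSubst σ i).subst (liftSubst τ)) = liftSubst (fun i => (σ i).subst τ) := by
  funext i
  refine Fin.cases ?_ (fun i => ?_) i <;>
    simp [liftSubst, Exp.subst, Exp.subst_subst, shift]

theorem liftSubst_var {k : ℕ} : liftSubst (Exp.var : Fin k → Exp k) = Exp.var := by
  funext i
  refine Fin.cases ?_ (fun i => ?_) i <;> simp [liftSubst, Exp.subst, shift]

theorem shift_comp_liftSubst {k k' : ℕ} (σ : Fin k → Exp k') :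
    (fun i => (shift i).subst (liftSubst σ)) = fun i => (σ i).subst shift := by
  funext i
  simp [shift, Exp.subst, liftSubst]

theorem single_comp {k k' : ℕ} (σ : Fin k → Exp k') (e : Exp k) :
    (fun i => (single e i).subst σ) =
      fun i => (liftSubst σ i).subst (single (e.subst σ)) := by
  funext i
  refine Fin.cases ?_ (fun i => ?_) i
  · simp [single, liftSubst, Exp.subst]
  · simp only [single, liftSubst, Exp.subst, Fin.cases_succ, Exp.subst_subst, shift]
    exact (Exp.subst_var _).symm

theorem shift_comp_single {k : ℕ} (e : Exp k) :
    (fun i => (shift i).subst (single e)) = Exp.var := by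
  funext i
  simp [shift, single, Exp.subst]

theorem eval_liftSubst {k k' : ℕ} (σ : Fin k → Exp k') (ρ : Fin k' → ℤ) (n : ℤ) :
    (fun i => (liftSubst σ i).eval (Fin.cons n ρ : Fin (k' + 1) → ℤ)) =
      (Fin.cons n (fun i => (σ i).eval ρ) : Fin (k + 1) → ℤ) := by
  funext i
  refine Fin.cases ?_ (fun i => ?_) i <;>
    simp [liftSubst, Exp.eval, Exp.eval_subst, shift]

theorem Fml.holds_subst {k : ℕ} (φ : Fml k) : ∀ {k' : ℕ} (σ : Fin k → Exp k') (ρ : Fin k' → ℤ),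
    (φ.subst σ).Holds ρ ↔ φ.Holds (fun i => (σ i).eval ρ) := by
  induction φ <;> intro k' σ ρ <;> simp_all [Fml.subst, Fml.Holds, Exp.eval_subst, eval_liftSubst]

theorem Fml.subst_subst {k : ℕ} (φ : Fml k) :
    ∀ {k' k'' : ℕ} (σ : Fin k → Exp k') (τ : Fin k' → Exp k''),
    (φ.subst σ).subst τ = φ.subst (fun i => (σ i).subst τ) := by
  induction φ <;> intro k' k'' σ τ <;>
    simp_all [Fml.subst, Exp.subst_subst, liftSubst_comp]

variable {N : Names}

theorem Ty.subst_subst {k : ℕ} (A : Ty N k) :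
    ∀ {k' k'' : ℕ} (σ : Fin k → Exp k') (τ : Fin k' → Exp k''),
    (A.subst σ).subst τ = A.subst (fun i => (σ i).subst τ) := by
  induction A <;> intro k' k'' σ τ <;>
    simp_all [Ty.subst, Exp.subst_subst, Fml.subst_subst, liftSubst_comp]

theorem Fml.subst_var {k : ℕ} (φ : Fml k) : φ.subst Exp.var = φ := by
  induction φ <;> simp_all [Fml.subst, Exp.subst_var, liftSubst_var]

theorem Ty.subst_var {k : ℕ} (A : Ty N k) : A.subst Exp.var = A := by
  induction A <;> simp_all [Ty.subst, Exp.subst_var, Fml.subst_var, liftSubst_var]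

theorem Ty.subst_closed (A : Ty N 0) (σ : Fin 0 → Exp 0) : A.subst σ = A := by
  rw [show σ = Exp.var from funext fun i => i.elim0, Ty.subst_var]

theorem Sig.unfold_subst (Sg : Sig N) {k k' : ℕ} (A : Ty N k) (σ : Fin k → Exp k') :
    Sg.unfold (A.subst σ) = (Sg.unfold A).subst σ := by
  cases A <;> simp [Sig.unfold, Ty.subst, Ty.subst_subst]

theorem entails_closed (φ : Fml 0) : Entails .top φ ↔ φ.Holds Fin.elim0 := by
  constructor
  · intro h
    have := h Fin.elim0 trivial
    rwa [show (fun i : Fin 0 => ((Fin.elim0 i : ℕ) : ℤ)) = Fin.elim0 from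
      funext fun i => i.elim0] at this
  · intro h ρ _
    rwa [show (fun i : Fin 0 => (ρ i : ℤ)) = Fin.elim0 from funext fun i => i.elim0]

theorem Fml.holds_ge {k : ℕ} (a b : Exp k) (ρ : Fin k → ℤ) :
    (Fml.ge a b).Holds ρ ↔ b.eval ρ ≤ a.eval ρ := by
  simp only [Fml.ge, Fml.Holds]; omega

theorem entails_ge_closed {a b : Exp 0} : Entails .top (.ge a b) ↔ b.val ≤ a.val := by
  rw [entails_closed, Fml.holds_ge]; rfl

theorem entails_eq_closed {a b : Exp 0} : Entails .top (.eq a b) ↔ a.val = b.val := by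
  rw [entails_closed]; rfl

theorem isNat_closed {a : Exp 0} : IsNat .top a ↔ 0 ≤ a.val := by
  rw [IsNat, entails_ge_closed]; rfl

/-! ### Type equality -/

theorem Sim.mono {R R' : Ty N 0 → Ty N 0 → Prop} (h : ∀ A B, R A B → R' A B) {A B : Ty N 0}
    (s : Sim R A B) : Sim R' A B := by
  cases s with
  | plus f => exact .plus fun l => h _ _ (f l)
  | amp f => exact .amp fun l => h _ _ (f l)
  | tensor a b => exact .tensor (h _ _ a) (h _ _ b)
  | lolli a b => exact .lolli (h _ _ a) (h _ _ b)
  | one => exact .one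
  | assert f => exact .assert (f.imp (fun ⟨a, b, c⟩ => ⟨a, b, h _ _ c⟩) id)
  | assume f => exact .assume (f.imp (fun ⟨a, b, c⟩ => ⟨a, b, h _ _ c⟩) id)
  | ex f => exact .ex fun i => h _ _ (f i)
  | all f => exact .all fun i => h _ _ (f i)
  | pay e a => exact .pay e (h _ _ a)
  | get e a => exact .get e (h _ _ a)

/-- Type equality is itself a bisimulation. -/
theorem Sig.Equal.sim {Sg : Sig N} {A B : Ty N 0} (h : Sg.Equal A B) :
    Sim Sg.Equal (Sg.unfold A) (Sg.unfold B) := by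
  obtain ⟨R, hR, hAB⟩ := h
  exact (hR _ _ hAB).mono fun A B h => ⟨R, hR, h⟩

theorem Sim.symm {R : Ty N 0 → Ty N 0 → Prop} {A B : Ty N 0}
    (s : Sim R A B) : Sim (fun A B => R B A) B A := by
  cases s with
  | plus f => exact .plus f
  | amp f => exact .amp f
  | tensor a b => exact .tensor a b
  | lolli a b => exact .lolli a b
  | one => exact .one
  | assert f => exact .assert (f.imp (fun ⟨a, b, c⟩ => ⟨b, a, c⟩) And.symm)
  | assume f => exact .assume (f.imp (fun ⟨a, b, c⟩ => ⟨b, a, c⟩) And.symm)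
  | ex f => exact .ex f
  | all f => exact .all f
  | pay e a => exact .pay (entails_eq_closed.2 (entails_eq_closed.1 e).symm) a
  | get e a => exact .get (entails_eq_closed.2 (entails_eq_closed.1 e).symm) a

theorem Sig.Equal.symm {Sg : Sig N} {A B : Ty N 0} (h : Sg.Equal A B) : Sg.Equal B A :=
  ⟨fun A B => Sg.Equal B A, fun _ _ h => h.sim.symm, h⟩

theorem not_entails_not {φ : Fml 0} (h : Entails .top φ) (h' : Entails .top φ.not) : False :=
  (entails_closed _).1 h' ((entails_closed _).1 h)

theorem Sim.trans {R R' : Ty N 0 → Ty N 0 → Prop} {A B C : Ty N 0}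
    (s : Sim R A B) (t : Sim R' B C) : Sim (fun A C => ∃ B, R A B ∧ R' B C) A C := by
  cases s with
  | plus f => cases t with | plus g => exact .plus fun l => ⟨_, f l, g l⟩
  | amp f => cases t with | amp g => exact .amp fun l => ⟨_, f l, g l⟩
  | tensor a b => cases t with | tensor a' b' => exact .tensor ⟨_, a, a'⟩ ⟨_, b, b'⟩
  | lolli a b => cases t with | lolli a' b' => exact .lolli ⟨_, a, a'⟩ ⟨_, b, b'⟩
  | one => cases t with | one => exact .one
  | assert f =>
    cases t with
    | assert g =>
      refine .assert ?_
      rcases f with ⟨a, b, c⟩ | ⟨a, b⟩ <;> rcases g with ⟨a', b', c'⟩ | ⟨a', b'⟩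
      · exact .inl ⟨a, b', _, c, c'⟩
      · exact (not_entails_not b a').elim
      · exact (not_entails_not a' b).elim
      · exact .inr ⟨a, b'⟩
  | assume f =>
    cases t with
    | assume g =>
      refine .assume ?_
      rcases f with ⟨a, b, c⟩ | ⟨a, b⟩ <;> rcases g with ⟨a', b', c'⟩ | ⟨a', b'⟩
      · exact .inl ⟨a, b', _, c, c'⟩
      · exact (not_entails_not b a').elim
      · exact (not_entails_not a' b).elim
      · exact .inr ⟨a, b'⟩
  | ex f => cases t with | ex g => exact .ex fun l => ⟨_, f l, g l⟩
  | all f => cases t with | all g => exact .all fun l => ⟨_, f l, g l⟩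
  | pay e a =>
    cases t with
    | pay e' a' =>
      exact .pay (entails_eq_closed.2 ((entails_eq_closed.1 e).trans (entails_eq_closed.1 e')))
        ⟨_, a, a'⟩
  | get e a =>
    cases t with
    | get e' a' =>
      exact .get (entails_eq_closed.2 ((entails_eq_closed.1 e).trans (entails_eq_closed.1 e')))
        ⟨_, a, a'⟩

theorem Sig.Equal.trans {Sg : Sig N} {A B C : Ty N 0} (h : Sg.Equal A B) (h' : Sg.Equal B C) :
    Sg.Equal A C :=
  ⟨fun A C => ∃ B, Sg.Equal A B ∧ Sg.Equal B C, fun _ _ ⟨_, h, h'⟩ => h.sim.trans h'.sim,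
    B, h, h'⟩

/-- Two closed instances of a type that is not a type name match in their outermost constructor
if the substituted expressions have the same values. -/
theorem Ty.sim_subst {R : Ty N 0 → Ty N 0 → Prop} {k : ℕ} {σ τ : Fin k → Exp 0}
    (hR : ∀ {k : ℕ} (A : Ty N k) (σ τ : Fin k → Exp 0), (∀ i, (σ i).val = (τ i).val) →
      R (A.subst σ) (A.subst τ))
    (h : ∀ i, (σ i).val = (τ i).val) (A : Ty N k) (hA : ∀ V e, A ≠ .name V e) :
    Sim R (A.subst σ) (A.subst τ) := by
  have hfun : (fun i => (σ i).eval Fin.elim0) = fun i => (τ i).eval Fin.elim0 := funext h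
  have hφ (φ : Fml k) : (Entails .top (φ.subst σ) ∧ Entails .top (φ.subst τ)) ∨
      (Entails .top (φ.subst σ).not ∧ Entails .top (φ.subst τ).not) := by
    simp only [entails_closed, Fml.Holds, Fml.holds_subst, hfun]
    tauto
  have hr (r : Exp k) : Entails .top (.eq (r.subst σ) (r.subst τ)) := by
    simp only [entails_closed, Fml.Holds, Exp.eval_subst, hfun]
  have hlift (A : Ty N (k + 1)) (i : ℕ) : R ((A.subst (liftSubst σ)).subst (single (.const i)))
      ((A.subst (liftSubst τ)).subst (single (.const i))) := by
    rw [Ty.subst_subst, Ty.subst_subst]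
    refine hR _ _ _ (Fin.cases rfl fun j => ?_)
    simp only [liftSubst, Fin.cases_succ, Exp.subst_subst, shift, Exp.subst, single]
    change (Exp.subst Exp.var _).val = (Exp.subst Exp.var _).val
    rw [Exp.subst_var, Exp.subst_var, h]
  cases A with
  | plus L F => exact .plus fun l => hR _ _ _ h
  | amp L F => exact .amp fun l => hR _ _ _ h
  | tensor A B => exact .tensor (hR _ _ _ h) (hR _ _ _ h)
  | lolli A B => exact .lolli (hR _ _ _ h) (hR _ _ _ h)
  | one => exact .one
  | name V e => exact (hA V e rfl).elim
  | assert φ A => exact .assert ((hφ φ).imp (fun ⟨a, b⟩ => ⟨a, b, hR _ _ _ h⟩) id)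
  | assume φ A => exact .assume ((hφ φ).imp (fun ⟨a, b⟩ => ⟨a, b, hR _ _ _ h⟩) id)
  | ex A => exact .ex (hlift A)
  | all A => exact .all (hlift A)
  | pay r A => exact .pay (hr r) (hR _ _ _ h)
  | get r A => exact .get (hr r) (hR _ _ _ h)

theorem Sig.WF.unfold_ne_name {Sg : Sig N} (hSg : Sg.WF) {k : ℕ} (A : Ty N k) (V : N.TName)
    (e : Fin (N.tIdx V) → Exp k) : Sg.unfold A ≠ .name V e := by
  cases A with
  | name W e' =>
    have := hSg.contractive W
    simp only [Sig.unfold]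
    generalize Sg.tdef W = T at this
    cases T with
    | name V e => exact (this V e rfl).elim
    | _ => simp [Ty.subst]
  | _ => simp [Sig.unfold]

/-- Closed instances of a type are equal if the substituted expressions have the same values. -/
theorem Sig.WF.equal_subst {Sg : Sig N} (hSg : Sg.WF) {k : ℕ} (A : Ty N k) (σ τ : Fin k → Exp 0)
    (h : ∀ i, (σ i).val = (τ i).val) : Sg.Equal (A.subst σ) (A.subst τ) := by
  -- The bisimulation relates all pairs of such instances, for all types.
  refine ⟨fun B B' => ∃ (k : ℕ) (A : Ty N k) (σ τ : Fin k → Exp 0),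
    (∀ i, (σ i).val = (τ i).val) ∧ B = A.subst σ ∧ B' = A.subst τ, ?_, k, A, σ, τ, h, rfl, rfl⟩
  rintro _ _ ⟨k, A, σ, τ, h, rfl, rfl⟩
  rw [Sig.unfold_subst, Sig.unfold_subst]
  exact Ty.sim_subst (fun A σ τ h => ⟨_, A, σ, τ, h, rfl, rfl⟩) h _ (hSg.unfold_ne_name A)

theorem Sig.WF.equal_refl {Sg : Sig N} (hSg : Sg.WF) (A : Ty N 0) : Sg.Equal A A := by
  have := hSg.equal_subst A Exp.var Exp.var fun _ => rfl
  rwa [Ty.subst_var] at this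

theorem Sig.equalUnder_closed {Sg : Sig N} {A B : Ty N 0} :
    Sg.EqualUnder .top A B ↔ Sg.Equal A B := by
  constructor
  · intro h
    have := h Fin.elim0 trivial
    rwa [Ty.subst_closed, Ty.subst_closed] at this
  · intro h ρ _
    rwa [Ty.subst_closed, Ty.subst_closed]

/-! ### Entailment under substitution -/

/-- `σ` is a substitution of natural numbers that turns the assumption `C` into a consequence
of `C'`. -/
structure Admissible {k k' : ℕ} (C : Fml k) (C' : Fml k') (σ : Fin k → Exp k') : Prop where
  nat : ∀ i, IsNat C' (σ i)
  entails : Entails C' (C.subst σ)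

/-- Evaluating an admissible substitution gives an assignment of natural numbers. -/
theorem Admissible.values {k k' : ℕ} {C : Fml k} {C' : Fml k'} {σ : Fin k → Exp k'}
    (h : Admissible C C' σ) (ρ : Fin k' → ℕ) (hρ : C'.Holds (fun i => (ρ i : ℤ))) :
    ∃ ν : Fin k → ℕ, (∀ i, (ν i : ℤ) = (σ i).eval (fun i => (ρ i : ℤ))) ∧
      C.Holds (fun i => (ν i : ℤ)) := by
  have h0 (i : Fin k) : 0 ≤ (σ i).eval (fun i => (ρ i : ℤ)) :=
    (Fml.holds_ge _ _ _).1 (h.nat i ρ hρ)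
  choose ν hν using fun i => Int.eq_ofNat_of_zero_le (h0 i)
  refine ⟨ν, fun i => (hν i).symm, ?_⟩
  have := h.entails ρ hρ
  rw [Fml.holds_subst] at this
  rwa [show (fun i => (ν i : ℤ)) = fun i => (σ i).eval (fun i => (ρ i : ℤ)) from
    funext fun i => (hν i).symm]

theorem Admissible.subst {k k' : ℕ} {C : Fml k} {C' : Fml k'} {σ : Fin k → Exp k'}
    (h : Admissible C C' σ) {φ : Fml k} (hφ : Entails C φ) : Entails C' (φ.subst σ) := by
  intro ρ hρ
  obtain ⟨ν, hν, hC⟩ := h.values ρ hρ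
  rw [Fml.holds_subst, ← show (fun i => (ν i : ℤ)) = _ from funext hν]
  exact hφ ν hC

theorem Admissible.equalUnder {Sg : Sig N} (hSg : Sg.WF) {k k' : ℕ} {C : Fml k} {C' : Fml k'}
    {σ : Fin k → Exp k'} (h : Admissible C C' σ) {A B : Ty N k} (hAB : Sg.EqualUnder C A B) :
    Sg.EqualUnder C' (A.subst σ) (B.subst σ) := by
  intro ρ hρ
  obtain ⟨ν, hν, hC⟩ := h.values ρ hρ
  have hval (i : Fin k) : ((σ i).subst (fun i => .const (ρ i))).val = (Exp.const (ν i)).val := by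
    rw [Exp.val, Exp.eval_subst]
    exact (hν i).symm
  rw [Ty.subst_subst, Ty.subst_subst]
  exact (hSg.equal_subst A _ _ hval).trans
    ((hAB ν hC).trans (hSg.equal_subst B _ _ fun i => (hval i).symm))

theorem Admissible.and {k k' : ℕ} {C φ : Fml k} {C' : Fml k'} {σ : Fin k → Exp k'}
    (h : Admissible C C' σ) : Admissible (C.and φ) (C'.and (φ.subst σ)) σ :=
  ⟨fun i ρ hρ => h.nat i ρ hρ.1, fun ρ hρ => ⟨h.entails ρ hρ.1, hρ.2⟩⟩

theorem Admissible.lift {k k' : ℕ} {C : Fml k} {C' : Fml k'} {σ : Fin k → Exp k'}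
    (h : Admissible C C' σ) :
    Admissible (C.subst shift) (C'.subst shift) (liftSubst σ) := by
  have key (ρ : Fin (k' + 1) → ℕ) (hρ : (C'.subst shift).Holds (fun i => (ρ i : ℤ))) :
      C'.Holds (fun i => ((ρ i.succ : ℕ) : ℤ)) := by
    rwa [Fml.holds_subst] at hρ
  constructor
  · intro i ρ hρ
    rw [Fml.holds_ge]
    refine Fin.cases ?_ (fun i => ?_) i
    · simp [liftSubst, Exp.eval]
    · simp only [liftSubst, Fin.cases_succ, Exp.eval_subst]
      exact (Fml.holds_ge _ _ _).1 (h.nat i _ (key ρ hρ))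
  · intro ρ hρ
    rw [Fml.subst_subst, shift_comp_liftSubst, ← Fml.subst_subst, Fml.holds_subst]
    exact h.entails _ (key ρ hρ)

/-! ### Index substitution in typing derivations -/

/-- Substitution for index variables in the types of a context. -/
def Ctx.subst {k k' m : ℕ} (σ : Fin k → Exp k') (Γ : Ctx N k m) : Ctx N k' m :=
  fun c => (Γ c).map (Ty.subst σ)

theorem Ctx.subst_empty {k k' m : ℕ} (σ : Fin k → Exp k') :
    (Ctx.empty : Ctx N k m).subst σ = Ctx.empty := rfl

theorem Ctx.subst_set {k k' m : ℕ} (σ : Fin k → Exp k') (Γ : Ctx N k m) (x : Chan m)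
    (A : Ty N k) : (Γ.set x A).subst σ = (Γ.subst σ).set x (A.subst σ) := by
  funext c
  by_cases h : c = x <;> simp [Ctx.subst, Ctx.set, Function.update, h]

theorem Ctx.subst_del {k k' m : ℕ} (σ : Fin k → Exp k') (Γ : Ctx N k m) (x : Chan m) :
    (Γ.del x).subst σ = (Γ.subst σ).del x := by
  funext c
  by_cases h : c = x <;> simp [Ctx.subst, Ctx.del, Function.update, h]

theorem Ctx.subst_delAll {k k' m j : ℕ} (σ : Fin k → Exp k') (Γ : Ctx N k m)
    (y : Fin j → Chan m) : (Γ.delAll y).subst σ = (Γ.subst σ).delAll y := by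
  funext c
  by_cases h : ∃ i, y i = c <;> simp [Ctx.subst, Ctx.delAll, h]

theorem Ctx.subst_push {k k' m : ℕ} (σ : Fin k → Exp k') (Γ : Ctx N k m) (A : Ty N k) :
    (Γ.push A).subst σ = (Γ.subst σ).push (A.subst σ) := by
  funext c
  cases c with
  | name a => rfl
  | var i => refine Fin.cases rfl (fun _ => rfl) i

theorem Ctx.subst_wkIdx {k k' m : ℕ} (σ : Fin k → Exp k') (Γ : Ctx N k m) :
    Γ.wkIdx.subst (liftSubst σ) = (Γ.subst σ).wkIdx := by
  funext c
  simp only [Ctx.subst, Ctx.wkIdx, Option.map_map]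
  congr 1
  funext A
  simp only [Function.comp, Ty.subst_subst, shift_comp_liftSubst]

theorem Ctx.subst_closed {m : ℕ} (σ : Fin 0 → Exp 0) (Γ : Ctx N 0 m) : Γ.subst σ = Γ := by
  funext c
  simp only [Ctx.subst]
  cases Γ c <;> simp [Ty.subst_closed]

theorem Ctx.wkIdx_subst_single {m : ℕ} (e : Exp 0) (Γ : Ctx N 0 m) :
    Γ.wkIdx.subst (single e) = Γ := by
  funext c
  simp only [Ctx.subst, Ctx.wkIdx]
  cases Γ c <;> simp [Ty.subst_subst, Ty.subst_closed]

theorem Ty.subst_single_subst {k k' : ℕ} (A : Ty N (k + 1)) (e : Exp k) (σ : Fin k → Exp k') :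
    (A.subst (single e)).subst σ = (A.subst (liftSubst σ)).subst (single (e.subst σ)) := by
  rw [Ty.subst_subst, Ty.subst_subst, single_comp]

theorem Ty.subst_shift_lift {k k' : ℕ} (A : Ty N k) (σ : Fin k → Exp k') :
    (A.subst shift).subst (liftSubst σ) = (A.subst σ).subst shift := by
  rw [Ty.subst_subst, Ty.subst_subst, shift_comp_liftSubst]

theorem Exp.subst_shift_lift {k k' : ℕ} (a : Exp k) (σ : Fin k → Exp k') :
    (a.subst shift).subst (liftSubst σ) = (a.subst σ).subst shift := by
  rw [Exp.subst_subst, Exp.subst_subst, shift_comp_liftSubst]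

theorem Ctx.subst_eq_some {k k' m : ℕ} {Γ : Ctx N k m} {x : Chan m} {A : Ty N k}
    (h : Γ x = some A) (σ : Fin k → Exp k') : Γ.subst σ x = some (A.subst σ) := by
  simp [Ctx.subst, h]

theorem Sig.unfold_subst_eq {Sg : Sig N} {k k' : ℕ} {A B : Ty N k} (h : Sg.unfold A = B)
    (σ : Fin k → Exp k') : Sg.unfold (A.subst σ) = B.subst σ := by
  rw [Sg.unfold_subst, h]

/-- Typing is stable under substitution of natural numbers for the index variables and under
strengthening of the constraint. -/
theorem Typed.subst {Sg : Sig N} (hSg : Sg.WF) {k m : ℕ} {C : Fml k} {Γ : Ctx N k m} {q : Exp k}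
    {P : Proc N k m} {x : Chan m} {A : Ty N k} (h : Typed Sg C Γ q P x A) :
    ∀ {k' : ℕ} {C' : Fml k'} {σ : Fin k → Exp k'}, Admissible C C' σ →
      Typed Sg C' (Γ.subst σ) (q.subst σ) (P.subst σ) x (A.subst σ) := by
  induction h with
  | id hq hAB =>
    intro k' C' σ hσ
    rw [Ctx.subst_set]
    exact .id (hσ.subst hq) (hσ.equalUnder hSg hAB)
  | @spawn k m C Γ r f e y Q z D B he hr hy hB hBB hQ ih =>
    intro k' C' σ hσ
    have hcomp (A : Ty N (N.pIdx f)) :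
      (A.subst e).subst σ = A.subst (fun i => (e i).subst σ) := Ty.subst_subst _ _ _
    have hcomp' : ((Sg.ppot f).subst e).subst σ = (Sg.ppot f).subst (fun i => (e i).subst σ) :=
      Exp.subst_subst _ _ _
    refine .spawn (fun i => (B i).subst σ) (fun i => hσ.subst (he i)) ?_ hy
      (fun i => Ctx.subst_eq_some (hB i) σ) (fun i => ?_) ?_
    · rw [← hcomp']
      exact hσ.subst hr
    · rw [← hcomp]
      exact hσ.equalUnder hSg (hBB i)
    · have := ih hσ
      rwa [Ctx.subst_push, Ctx.subst_delAll, hcomp, Exp.subst, hcomp'] at this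
  | plusR hA _ ih =>
    intro k' C' σ hσ
    exact .plusR (Sg.unfold_subst_eq hA σ) (ih hσ)
  | plusL hx hA _ ih =>
    intro k' C' σ hσ
    refine .plusL (Ctx.subst_eq_some hx σ) (Sg.unfold_subst_eq hA σ) fun l => ?_
    have := ih l hσ
    rwa [Ctx.subst_set] at this
  | ampR hA _ ih =>
    intro k' C' σ hσ
    exact .ampR (Sg.unfold_subst_eq hA σ) fun l => ih l hσ
  | @ampL _ _ _ _ _ _ _ _ _ L F l _ hx hA _ ih =>
    intro k' C' σ hσ
    have := ih hσ
    rw [Ctx.subst_set] at this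
    exact .ampL (F := fun l => (F l).subst σ) (Ctx.subst_eq_some hx σ)
      (Sg.unfold_subst_eq hA σ) this
  | lolliR hA _ ih =>
    intro k' C' σ hσ
    have := ih hσ
    rw [Ctx.subst_push] at this
    exact .lolliR (Sg.unfold_subst_eq hA σ) this
  | lolliL hx hA hwx hw hB _ ih =>
    intro k' C' σ hσ
    have := ih hσ
    rw [Ctx.subst_set, Ctx.subst_del] at this
    exact .lolliL (Ctx.subst_eq_some hx σ) (Sg.unfold_subst_eq hA σ) hwx
      (Ctx.subst_eq_some hw σ) (hσ.equalUnder hSg hB) this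
  | tensorR hA hw hB _ ih =>
    intro k' C' σ hσ
    have := ih hσ
    rw [Ctx.subst_del] at this
    exact .tensorR (Sg.unfold_subst_eq hA σ) (Ctx.subst_eq_some hw σ)
      (hσ.equalUnder hSg hB) this
  | tensorL hx hA _ ih =>
    intro k' C' σ hσ
    have := ih hσ
    rw [Ctx.subst_push, Ctx.subst_set] at this
    exact .tensorL (Ctx.subst_eq_some hx σ) (Sg.unfold_subst_eq hA σ) this
  | oneR hA hq =>
    intro k' C' σ hσ
    rw [Ctx.subst_empty]
    exact .oneR (Sg.unfold_subst_eq hA σ) (hσ.subst hq)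
  | oneL hx hA _ ih =>
    intro k' C' σ hσ
    have := ih hσ
    rw [Ctx.subst_del] at this
    exact .oneL (Ctx.subst_eq_some hx σ) (Sg.unfold_subst_eq hA σ) this
  | exR hA he _ ih =>
    intro k' C' σ hσ
    have := ih hσ
    rw [Ty.subst_single_subst] at this
    exact .exR (Sg.unfold_subst_eq hA σ) (hσ.subst he) this
  | exL hx hA _ ih =>
    intro k' C' σ hσ
    have := ih hσ.lift
    rw [Ctx.subst_set, Ctx.subst_wkIdx, Exp.subst_shift_lift, Ty.subst_shift_lift] at this
    exact .exL (Ctx.subst_eq_some hx σ) (Sg.unfold_subst_eq hA σ) this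
  | allR hA _ ih =>
    intro k' C' σ hσ
    have := ih hσ.lift
    rw [Ctx.subst_wkIdx, Exp.subst_shift_lift] at this
    exact .allR (Sg.unfold_subst_eq hA σ) this
  | allL hx hA he _ ih =>
    intro k' C' σ hσ
    have := ih hσ
    rw [Ctx.subst_set, Ty.subst_single_subst] at this
    exact .allL (Ctx.subst_eq_some hx σ) (Sg.unfold_subst_eq hA σ) (hσ.subst he) this
  | assertR hA hφ hφ' _ ih =>
    intro k' C' σ hσ
    exact .assertR (Sg.unfold_subst_eq hA σ) (hσ.subst hφ) (hσ.subst hφ') (ih hσ)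
  | assertL hx hA hφ _ ih =>
    intro k' C' σ hσ
    have := ih hσ.and
    rw [Ctx.subst_set] at this
    exact .assertL (Ctx.subst_eq_some hx σ) (Sg.unfold_subst_eq hA σ) (hσ.and.subst hφ) this
  | assumeR hA hφ _ ih =>
    intro k' C' σ hσ
    exact .assumeR (Sg.unfold_subst_eq hA σ) (hσ.and.subst hφ) (ih hσ.and)
  | assumeL hx hA hφ hφ' _ ih =>
    intro k' C' σ hσ
    have := ih hσ
    rw [Ctx.subst_set] at this
    exact .assumeL (Ctx.subst_eq_some hx σ) (Sg.unfold_subst_eq hA σ) (hσ.subst hφ)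
      (hσ.subst hφ') this
  | payR hA hr hq he _ ih =>
    intro k' C' σ hσ
    exact .payR (Sg.unfold_subst_eq hA σ) (hσ.subst hr) (hσ.subst hq) (hσ.subst he) (ih hσ)
  | payL hx hA he _ ih =>
    intro k' C' σ hσ
    have := ih hσ
    rw [Ctx.subst_set] at this
    exact .payL (Ctx.subst_eq_some hx σ) (Sg.unfold_subst_eq hA σ) (hσ.subst he) this
  | getR hA he _ ih =>
    intro k' C' σ hσ
    exact .getR (Sg.unfold_subst_eq hA σ) (hσ.subst he) (ih hσ)
  | getL hx hA hr hq he _ ih =>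
    intro k' C' σ hσ
    have := ih hσ
    rw [Ctx.subst_set] at this
    exact .getL (Ctx.subst_eq_some hx σ) (Sg.unfold_subst_eq hA σ) (hσ.subst hr)
      (hσ.subst hq) (hσ.subst he) this
  | work hr hq _ ih =>
    intro k' C' σ hσ
    exact .work (hσ.subst hr) (hσ.subst hq) (ih hσ)
  | unsat hC =>
    intro k' C' σ hσ
    exact .unsat (hσ.subst hC)

theorem Proc.subst_var {k m : ℕ} (P : Proc N k m) : P.subst Exp.var = P := by
  induction P with
  | send x p P ih => cases p <;> simp [Proc.subst, Payload.subst, Exp.subst_var, Fml.subst_var, ih]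
  | _ => simp_all [Proc.subst, Exp.subst_var, Fml.subst_var, liftSubst_var]

/-- A constraint without free index variables can be discharged once it is known to hold. -/
theorem Typed.strengthen {Sg : Sig N} (hSg : Sg.WF) {m : ℕ} {C : Fml 0} {Γ : Ctx N 0 m}
    {q : Exp 0} {P : Proc N 0 m} {x : Chan m} {A : Ty N 0} (h : Typed Sg C Γ q P x A)
    (hC : Entails .top C) : Typed Sg .top Γ q P x A := by
  have hσ : Admissible C .top (Exp.var : Fin 0 → Exp 0) :=
    ⟨fun i => i.elim0, by rwa [Fml.subst_var]⟩
  have := h.subst hSg hσ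
  rwa [Ctx.subst_closed, Exp.subst_var, Proc.subst_var, Ty.subst_var] at this

/-! ### Renaming of channels in typing derivations -/

/-- `ρ` carries the context `Γ` to `Γ'`, and is injective on the channels of `Γ` and `z`. -/
structure Carries {k m m' : ℕ} (ρ : Chan m → Chan m') (z : Chan m) (Γ : Ctx N k m)
    (Γ' : Ctx N k m') : Prop where
  map : ∀ {c A}, Γ c = some A → Γ' (ρ c) = some A
  surj : ∀ {c'}, Γ' c' ≠ none → ∃ c, Γ c ≠ none ∧ ρ c = c'
  inj : ∀ {c d}, Γ c ≠ none → Γ d ≠ none → ρ c = ρ d → c = d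
  ne : ∀ {c}, Γ c ≠ none → ρ c ≠ ρ z

theorem Ctx.set_apply {k m : ℕ} (Γ : Ctx N k m) (x : Chan m) (A : Ty N k) (c : Chan m) :
    Γ.set x A c = if c = x then some A else Γ c := by
  simp [Ctx.set, Function.update_apply]

theorem Ctx.del_apply {k m : ℕ} (Γ : Ctx N k m) (x : Chan m) (c : Chan m) :
    Γ.del x c = if c = x then none else Γ c := by
  simp [Ctx.del, Function.update_apply]

section
variable {k m m' : ℕ} {ρ : Chan m → Chan m'} {z : Chan m} {Γ : Ctx N k m} {Γ' : Ctx N k m'}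

theorem Carries.set (h : Carries ρ z Γ Γ') {x : Chan m} {A : Ty N k} (hx : Γ x = some A)
    (B : Ty N k) : Carries ρ z (Γ.set x B) (Γ'.set (ρ x) B) := by
  have hdom (c : Chan m) : Γ.set x B c ≠ none → Γ c ≠ none := by
    rw [Ctx.set_apply]
    split_ifs with hc <;> simp [*]
  have hx' : Γ x ≠ none := by simp [hx]
  refine ⟨fun {c} A' hA => ?_, fun {c'} hc => ?_,
    fun hc hd => h.inj (hdom _ hc) (hdom _ hd), fun hc => h.ne (hdom _ hc)⟩
  · rw [Ctx.set_apply] at hA ⊢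
    split_ifs at hA with hc
    · rw [hc, if_pos rfl, hA]
    · rw [if_neg fun he => hc (h.inj (by simp [hA]) hx' he), h.map hA]
  · rw [Ctx.set_apply] at hc
    split_ifs at hc with hcx
    · exact ⟨x, by simp [Ctx.set_apply], hcx.symm⟩
    · obtain ⟨d, hd, rfl⟩ := h.surj hc
      refine ⟨d, ?_, rfl⟩
      rw [Ctx.set_apply]
      split_ifs <;> simp [hd]

theorem Carries.del (h : Carries ρ z Γ Γ') {x : Chan m} {A : Ty N k} (hx : Γ x = some A) :
    Carries ρ z (Γ.del x) (Γ'.del (ρ x)) := by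
  have hdom (c : Chan m) : Γ.del x c ≠ none → Γ c ≠ none := by
    rw [Ctx.del_apply]
    split_ifs with hc <;> simp
  have hx' : Γ x ≠ none := by simp [hx]
  refine ⟨fun {c} A' hA => ?_, fun {c'} hc => ?_,
    fun hc hd => h.inj (hdom _ hc) (hdom _ hd), fun hc => h.ne (hdom _ hc)⟩
  · rw [Ctx.del_apply] at hA ⊢
    split_ifs at hA with hc
    rw [if_neg fun he => hc (h.inj (by simp [hA]) hx' he), h.map hA]
  · rw [Ctx.del_apply] at hc
    split_ifs at hc with hcx
    · exact (hc rfl).elim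
    · obtain ⟨d, hd, rfl⟩ := h.surj hc
      refine ⟨d, ?_, rfl⟩
      rw [Ctx.del_apply, if_neg (fun he => hcx (by rw [he]))]
      exact hd

theorem Carries.delAll (h : Carries ρ z Γ Γ') {j : ℕ} {y : Fin j → Chan m} {B : Fin j → Ty N k}
    (hy : ∀ i, Γ (y i) = some (B i)) :
    Carries ρ z (Γ.delAll y) (Γ'.delAll fun i => ρ (y i)) := by
  have hdom (c : Chan m) : Γ.delAll y c ≠ none → Γ c ≠ none := by
    rw [Ctx.delAll]
    split_ifs with hc <;> simp
  have hy' (i : Fin j) : Γ (y i) ≠ none := by simp [hy i]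
  refine ⟨fun {c} A' hA => ?_, fun {c'} hc => ?_,
    fun hc hd => h.inj (hdom _ hc) (hdom _ hd), fun hc => h.ne (hdom _ hc)⟩
  · rw [Ctx.delAll] at hA ⊢
    split_ifs at hA with hc
    rw [if_neg, h.map hA]
    rintro ⟨i, hi⟩
    exact hc ⟨i, h.inj (hy' i) (by simp [hA]) hi⟩
  · rw [Ctx.delAll] at hc
    split_ifs at hc with hcx
    · exact (hc rfl).elim
    · obtain ⟨d, hd, rfl⟩ := h.surj hc
      refine ⟨d, ?_, rfl⟩
      rw [Ctx.delAll, if_neg]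
      · exact hd
      · rintro ⟨i, rfl⟩
        exact hcx ⟨i, rfl⟩

theorem Chan.wk_injective {m : ℕ} : Function.Injective (Chan.wk : Chan m → Chan (m + 1)) := by
  intro c d h
  cases c <;> cases d <;> simp_all [Chan.wk]

theorem Chan.lift_wk (ρ : Chan m → Chan m') (c : Chan m) :
    Chan.lift ρ c.wk = (ρ c).wk := by
  cases c <;> simp [Chan.wk, Chan.lift, Chan.cons]

theorem Chan.cons_wk (ρ : Chan m → Chan m') (d : Chan m') (c : Chan m) :
    Chan.cons d ρ c.wk = ρ c := by
  cases c <;> simp [Chan.wk, Chan.cons]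

theorem Ctx.push_wk (Γ : Ctx N k m) (A : Ty N k) (c : Chan m) : Γ.push A c.wk = Γ c := by
  cases c <;> simp [Chan.wk, Ctx.push]

theorem Ctx.push_zero (Γ : Ctx N k m) (A : Ty N k) : Γ.push A (.var 0) = some A := rfl

/-- A channel in scope of a binder is the bound channel or comes from outside the binder. -/
theorem Chan.eq_zero_or_wk (c : Chan (m + 1)) : c = .var 0 ∨ ∃ d : Chan m, c = d.wk := by
  cases c with
  | name a => exact .inr ⟨.name a, rfl⟩
  | var i => exact Fin.cases (.inl rfl) (fun j => .inr ⟨.var j, rfl⟩) i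

theorem Chan.wk_ne_zero (c : Chan m) : c.wk ≠ .var 0 := by
  cases c <;> simp [Chan.wk, Fin.succ_ne_zero]

theorem Carries.push (h : Carries ρ z Γ Γ') (A : Ty N k) :
    Carries (Chan.lift ρ) z.wk (Γ.push A) (Γ'.push A) := by
  have h0 : Chan.lift ρ (.var 0) = .var 0 := rfl
  refine ⟨fun {c} B hB => ?_, fun {c'} hc => ?_, fun {c d} hc hd he => ?_, fun {c} hc => ?_⟩
  · obtain rfl | ⟨c, rfl⟩ := c.eq_zero_or_wk
    · exact hB
    · rw [Chan.lift_wk, Ctx.push_wk]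
      rw [Ctx.push_wk] at hB
      exact h.map hB
  · obtain rfl | ⟨c, rfl⟩ := c'.eq_zero_or_wk
    · exact ⟨.var 0, by simp [Ctx.push_zero], rfl⟩
    · rw [Ctx.push_wk] at hc
      obtain ⟨d, hd, rfl⟩ := h.surj hc
      exact ⟨d.wk, by rwa [Ctx.push_wk], Chan.lift_wk _ _⟩
  · obtain rfl | ⟨c, rfl⟩ := c.eq_zero_or_wk <;> obtain rfl | ⟨d, rfl⟩ := d.eq_zero_or_wk
    · rfl
    · rw [h0, Chan.lift_wk] at he
      exact (Chan.wk_ne_zero _ he.symm).elim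
    · rw [h0, Chan.lift_wk] at he
      exact (Chan.wk_ne_zero _ he).elim
    · rw [Ctx.push_wk] at hc hd
      rw [Chan.lift_wk, Chan.lift_wk] at he
      rw [h.inj hc hd (Chan.wk_injective he)]
  · rw [Chan.lift_wk]
    obtain rfl | ⟨c, rfl⟩ := c.eq_zero_or_wk
    · exact fun he => Chan.wk_ne_zero _ (h0.symm.trans he).symm
    · rw [Ctx.push_wk] at hc
      rw [Chan.lift_wk]
      exact fun he => h.ne hc (Chan.wk_injective he)

theorem Carries.wkIdx (h : Carries ρ z Γ Γ') : Carries ρ z Γ.wkIdx Γ'.wkIdx := by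
  have hdom (c : Chan m) : Γ.wkIdx c ≠ none → Γ c ≠ none := by simp [Ctx.wkIdx]
  refine ⟨fun {c} A hA => ?_, fun {c'} hc => ?_,
    fun hc hd => h.inj (hdom _ hc) (hdom _ hd), fun hc => h.ne (hdom _ hc)⟩
  · simp only [Ctx.wkIdx, Option.map_eq_some_iff] at hA ⊢
    obtain ⟨B, hB, rfl⟩ := hA
    exact ⟨B, h.map hB, rfl⟩
  · obtain ⟨c, hc', rfl⟩ := h.surj (c' := c') (by simpa [Ctx.wkIdx] using hc)
    exact ⟨c, by simpa [Ctx.wkIdx] using hc', rfl⟩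

theorem Carries.eq_empty (h : Carries ρ z (Ctx.empty : Ctx N k m) Γ') : Γ' = Ctx.empty := by
  funext c
  by_contra hc
  obtain ⟨d, hd, -⟩ := h.surj hc
  exact hd rfl

theorem Carries.eq_single {y : Chan m} {A : Ty N k}
    (h : Carries ρ z (Ctx.empty.set y A) Γ') : Γ' = Ctx.empty.set (ρ y) A := by
  funext c
  rw [Ctx.set_apply]
  split_ifs with hc
  · rw [hc]
    exact h.map (by simp [Ctx.set_apply])
  · by_contra hc'
    obtain ⟨d, hd, rfl⟩ := h.surj hc'
    rw [Ctx.set_apply] at hd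
    split_ifs at hd with hdy
    · exact hc (by rw [hdy])
    · exact hd rfl

end

/-- Typing is stable under renamings of channels that are injective on the channels in the
judgment. -/
theorem Typed.rename {Sg : Sig N} {k m : ℕ} {C : Fml k} {Γ : Ctx N k m} {q : Exp k}
    {P : Proc N k m} {x : Chan m} {A : Ty N k} (h : Typed Sg C Γ q P x A) :
    ∀ {m' : ℕ} {ρ : Chan m → Chan m'} {Γ' : Ctx N k m'}, Carries ρ x Γ Γ' →
      Typed Sg C Γ' q (P.rename ρ) (ρ x) A := by
  induction h with
  | id hq hAB =>
    intro m' ρ Γ' hρ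
    rw [hρ.eq_single]
    exact .id hq hAB
  | spawn B he hr hy hB hBB _ ih =>
    intro m' ρ Γ' hρ
    refine .spawn B he hr (fun i j hij => hy (hρ.inj ?_ ?_ hij)) (fun i => hρ.map (hB i)) hBB ?_
    · simp [hB]
    · simp [hB]
    · have := ih ((hρ.delAll hB).push _)
      rwa [Chan.lift_wk] at this
  | plusR hA _ ih => exact fun hρ => .plusR hA (ih hρ)
  | plusL hx hA _ ih => exact fun hρ => .plusL (hρ.map hx) hA fun l => ih l (hρ.set hx _)
  | ampR hA _ ih => exact fun hρ => .ampR hA fun l => ih l hρ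
  | ampL hx hA _ ih => exact fun hρ => .ampL (hρ.map hx) hA (ih (hρ.set hx _))
  | lolliR hA _ ih =>
    intro m' ρ Γ' hρ
    have := ih (hρ.push _)
    rw [Chan.lift_wk] at this
    exact .lolliR hA this
  | lolliL hx hA hwx hw hB _ ih =>
    intro m' ρ Γ' hρ
    have hx' := (Ctx.del_apply _ _ _).trans ((if_neg hwx.symm).trans hx)
    exact .lolliL (hρ.map hx) hA (fun he => hwx (hρ.inj (by simp [hw]) (by simp [hx]) he))
      (hρ.map hw) hB (ih ((hρ.del hw).set hx' _))
  | tensorR hA hw hB _ ih => exact fun hρ => .tensorR hA (hρ.map hw) hB (ih (hρ.del hw))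
  | tensorL hx hA _ ih =>
    intro m' ρ Γ' hρ
    have := ih ((hρ.set hx _).push _)
    rw [Chan.lift_wk] at this
    exact .tensorL (hρ.map hx) hA this
  | oneR hA hq =>
    intro m' ρ Γ' hρ
    rw [hρ.eq_empty]
    exact .oneR hA hq
  | oneL hx hA _ ih => exact fun hρ => .oneL (hρ.map hx) hA (ih (hρ.del hx))
  | exR hA he _ ih => exact fun hρ => .exR hA he (ih hρ)
  | exL hx hA _ ih =>
    exact fun hρ => .exL (hρ.map hx) hA (ih (hρ.wkIdx.set (by rw [Ctx.wkIdx, hx]; rfl) _))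
  | allR hA _ ih => exact fun hρ => .allR hA (ih hρ.wkIdx)
  | allL hx hA he _ ih => exact fun hρ => .allL (hρ.map hx) hA he (ih (hρ.set hx _))
  | assertR hA hφ hφ' _ ih => exact fun hρ => .assertR hA hφ hφ' (ih hρ)
  | assertL hx hA hφ _ ih => exact fun hρ => .assertL (hρ.map hx) hA hφ (ih (hρ.set hx _))
  | assumeR hA hφ _ ih => exact fun hρ => .assumeR hA hφ (ih hρ)
  | assumeL hx hA hφ hφ' _ ih =>
    exact fun hρ => .assumeL (hρ.map hx) hA hφ hφ' (ih (hρ.set hx _))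
  | payR hA hr hq he _ ih => exact fun hρ => .payR hA hr hq he (ih hρ)
  | payL hx hA he _ ih => exact fun hρ => .payL (hρ.map hx) hA he (ih (hρ.set hx _))
  | getR hA he _ ih => exact fun hρ => .getR hA he (ih hρ)
  | getL hx hA hr hq he _ ih =>
    exact fun hρ => .getL (hρ.map hx) hA hr hq he (ih (hρ.set hx _))
  | work hr hq _ ih => exact fun hρ => .work hr hq (ih hρ)
  | unsat hC => exact fun _ => .unsat hC

/-! ### Configurations as chains of objects -/

theorem Sig.WF.equalCtx_refl {Sg : Sig N} (hSg : Sg.WF) (Δ : Ctx N 0 0) : Sg.EqualCtx Δ Δ := by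
  intro c
  cases Δ c with
  | none => exact .none
  | some A => exact .some (hSg.equal_refl A)

theorem Sig.EqualCtx.symm {Sg : Sig N} {Δ Δ' : Ctx N 0 0} (h : Sg.EqualCtx Δ Δ') :
    Sg.EqualCtx Δ' Δ := by
  intro c
  have := h c
  generalize Δ c = a, Δ' c = b at this
  cases this with
  | none => exact .none
  | some h => exact .some h.symm

theorem optionRel_trans {Sg : Sig N} {a b c : Option (Ty N 0)} (h : Option.Rel Sg.Equal a b)
    (h' : Option.Rel Sg.Equal b c) : Option.Rel Sg.Equal a c := by
  cases h with
  | none => exact h'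
  | some h => cases h' with | some h' => exact .some (h.trans h')

theorem Sig.EqualCtx.trans {Sg : Sig N} {Δ Δ' Δ'' : Ctx N 0 0} (h : Sg.EqualCtx Δ Δ')
    (h' : Sg.EqualCtx Δ' Δ'') : Sg.EqualCtx Δ Δ'' :=
  fun c => optionRel_trans (h c) (h' c)

/-- `ObjTyped Sg o Γ n A`: the object `o` uses exactly the channels of `Γ`, has potential and
performed work `n` in total, and provides a channel of type `A` that is not in `Γ`. -/
inductive ObjTyped (Sg : Sig N) : Obj N → Ctx N 0 0 → ℕ → Ty N 0 → Prop
  | proc {Γ : Ctx N 0 0} {p : Exp 0} {n n' w : ℕ} {x : Name} {P : Proc N 0 0} {A : Ty N 0} :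
      Typed Sg .top Γ p P x A → p.val = (n : ℤ) → Γ x = none → n' = n + w →
      ObjTyped Sg (.proc x w P) Γ n' A
  | msg {Γ : Ctx N 0 0} {p : Exp 0} {n n' w : ℕ} {x : Name} {M : Proc N 0 0} {A : Ty N 0} :
      IsMsg x M → Typed Sg .top Γ p M x A → p.val = (n : ℤ) → Γ x = none → n' = n + w →
      ObjTyped Sg (.msg x w M) Γ n' A

theorem ObjTyped.chan_eq_none {Sg : Sig N} {o : Obj N} {Γ : Ctx N 0 0} {n : ℕ} {A : Ty N 0}
    (h : ObjTyped Sg o Γ n A) : Γ o.chan = none := by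
  cases h <;> assumption

/-- The channels of `Γ` are available in `Δ`, with equal types. -/
def Sig.Supplies (Sg : Sig N) (Δ Γ : Ctx N 0 0) : Prop :=
  ∀ c A, Γ c = some A → ∃ B, Δ c = some B ∧ Sg.Equal B A

/-- The context that is left of `Δ` when an object has consumed the channels of `Γ` and provides
`x : A`. -/
def Ctx.after (Δ Γ : Ctx N 0 0) (x : Name) (A : Ty N 0) : Ctx N 0 0 :=
  fun c => if c = x then some A else if (Γ c).isSome then none else Δ c

/-- `Chain Sg Δ E L Δ'` is configuration typing for the objects of `L` in this order: every
object uses channels that are available in `Δ` or provided by an earlier object and not used by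
another earlier one. -/
inductive Chain (Sg : Sig N) : Ctx N 0 0 → ℕ → List (Obj N) → Ctx N 0 0 → Prop
  | nil {Δ Δ' : Ctx N 0 0} : Sg.EqualCtx Δ Δ' → Chain Sg Δ 0 [] Δ'
  | cons {Δ Γ Δ' : Ctx N 0 0} {n E E' : ℕ} {o : Obj N} {L : List (Obj N)} {A : Ty N 0} :
      ObjTyped Sg o Γ n A → Sg.Supplies Δ Γ → Δ o.chan = none →
      Chain Sg (Δ.after Γ o.chan A) E L Δ' → E' = n + E → Chain Sg Δ E' (o :: L) Δ'

theorem Ctx.after_self (Δ Γ : Ctx N 0 0) (x : Name) (A : Ty N 0) :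
    Δ.after Γ x A x = some A := by
  simp [Ctx.after]

theorem Ctx.after_eq_none {Δ Γ : Ctx N 0 0} {x c : Name} {A : Ty N 0} (h : Δ c = none)
    (hc : x ≠ c) : Δ.after Γ x A c = none := by
  simp [Ctx.after, hc.symm, h]

theorem Sig.EqualCtx.after {Sg : Sig N} {Δ Δ' : Ctx N 0 0} (h : Sg.EqualCtx Δ Δ')
    (Γ : Ctx N 0 0) (x : Name) {A B : Ty N 0} (hAB : Sg.Equal A B) :
    Sg.EqualCtx (Δ.after Γ x A) (Δ'.after Γ x B) := by
  intro c
  simp only [Ctx.after]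
  split_ifs
  · exact .some hAB
  · exact .none
  · exact h c

theorem Sig.EqualCtx.eq_none {Sg : Sig N} {Δ Δ' : Ctx N 0 0} (h : Sg.EqualCtx Δ Δ') {c : Name}
    (hc : Δ c = none) : Δ' c = none := by
  have := h c
  rw [hc] at this
  generalize Δ' c = a at this
  cases this
  rfl

theorem Sig.EqualCtx.eq_some {Sg : Sig N} {Δ Δ' : Ctx N 0 0} (h : Sg.EqualCtx Δ Δ') {c : Name}
    {A : Ty N 0} (hc : Δ c = some A) : ∃ B, Δ' c = some B ∧ Sg.Equal A B := by
  have := h c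
  rw [hc] at this
  generalize Δ' c = a at this
  cases this with
  | some h => exact ⟨_, rfl, h⟩

theorem Sig.Supplies.congr {Sg : Sig N} {Δ Δ' Γ : Ctx N 0 0} (h : Sg.Supplies Δ Γ)
    (hΔ : Sg.EqualCtx Δ Δ') : Sg.Supplies Δ' Γ := by
  intro c A hA
  obtain ⟨B, hB, hBA⟩ := h c A hA
  obtain ⟨B', hB', hBB⟩ := hΔ.eq_some hB
  exact ⟨B', hB', hBB.symm.trans hBA⟩

theorem Chain.congr_left {Sg : Sig N} (hSg : Sg.WF) {Δ Δ' : Ctx N 0 0} {E : ℕ} {L : List (Obj N)}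
    (h : Chain Sg Δ E L Δ') : ∀ {Δ₁ : Ctx N 0 0}, Sg.EqualCtx Δ Δ₁ → Chain Sg Δ₁ E L Δ' := by
  induction h with
  | nil he => exact fun h₁ => .nil (h₁.symm.trans he)
  | cons ho hs hn _ hE ih =>
    exact fun h₁ => .cons ho (hs.congr h₁) (h₁.eq_none hn)
      (ih (h₁.after _ _ (hSg.equal_refl _))) hE

theorem Chain.congr_right {Sg : Sig N} {Δ Δ' Δ₁ : Ctx N 0 0} {E : ℕ} {L : List (Obj N)}
    (h : Chain Sg Δ E L Δ') (h₁ : Sg.EqualCtx Δ' Δ₁) : Chain Sg Δ E L Δ₁ := by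
  induction h with
  | nil he => exact .nil (he.trans h₁)
  | cons ho hs hn _ hE ih => exact .cons ho hs hn (ih h₁) hE

theorem Chain.append {Sg : Sig N} (hSg : Sg.WF) {Δ Δ' Δ'' : Ctx N 0 0} {E E' : ℕ}
    {L L' : List (Obj N)} (h : Chain Sg Δ E L Δ') (h' : Chain Sg Δ' E' L' Δ'') :
    Chain Sg Δ (E + E') (L ++ L') Δ'' := by
  induction h with
  | nil he =>
    rw [zero_add]
    exact h'.congr_left hSg he.symm
  | cons ho hs hn _ hE ih => exact .cons ho hs hn (ih h') (by rw [hE, add_assoc])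

/-- An object on its own. -/
theorem ObjTyped.chain {Sg : Sig N} (hSg : Sg.WF) {o : Obj N} {Δ Γ : Ctx N 0 0} {n : ℕ}
    {A : Ty N 0} (ho : ObjTyped Sg o Γ n A) (hd : Δ.Disj Γ) (hΔ : Δ o.chan = none) :
    Chain Sg (Δ.join Γ) n [o] (Δ.set o.chan A) := by
  have hjoin (c : Name) (A : Ty N 0) (h : Γ c = some A) : Δ.join Γ c = some A := by
    rcases hd c with h' | h'
    · simp [Ctx.join, h', h]
    · simp [h'] at h
  refine .cons ho (fun c B hB => ⟨B, hjoin c B hB, hSg.equal_refl _⟩) ?_ (.nil ?_) (add_zero n).symm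
  · simp [Ctx.join, hΔ, ho.chan_eq_none]
  · rw [show (Δ.join Γ).after Γ o.chan A = Δ.set o.chan A from ?_]
    · exact hSg.equalCtx_refl _
    · funext c
      rw [Ctx.set_apply]
      simp only [Ctx.after]
      split_ifs with h₁ h₂
      · rfl
      · rcases hd c with h' | h'
        · exact h'.symm
        · simp [h'] at h₂
      · simp only [Option.not_isSome_iff_eq_none] at h₂
        simp [Ctx.join, h₂]

theorem ConfTyped.exists_chain {Sg : Sig N} (hSg : Sg.WF) {Δ Δ' : Ctx N 0 0} {E : ℕ} {S : Conf N}
    (h : ConfTyped Sg Δ E S Δ') : ∃ L : List (Obj N), (L : Conf N) = S ∧ Chain Sg Δ E L Δ' := by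
  induction h with
  | emp => exact ⟨[], rfl, .nil (hSg.equalCtx_refl _)⟩
  | compose _ _ ih ih' =>
    obtain ⟨L, rfl, h⟩ := ih
    obtain ⟨L', rfl, h'⟩ := ih'
    exact ⟨L ++ L', by simp, h.append hSg h'⟩
  | proc hP hp hd hΔ hΓ => exact ⟨[_], rfl, (ObjTyped.proc hP hp hΓ rfl).chain hSg hd hΔ⟩
  | msg hm hP hp hd hΔ hΓ => exact ⟨[_], rfl, (ObjTyped.msg hm hP hp hΓ rfl).chain hSg hd hΔ⟩
  | conv _ h₁ h₂ ih =>
    obtain ⟨L, rfl, h⟩ := ih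
    exact ⟨L, rfl, (h.congr_left hSg h₁).congr_right h₂⟩

theorem ObjTyped.confTyped {Sg : Sig N} (hSg : Sg.WF) {o : Obj N} {Δ Γ : Ctx N 0 0} {n : ℕ}
    {A : Ty N 0} (ho : ObjTyped Sg o Γ n A) (hs : Sg.Supplies Δ Γ) (hΔ : Δ o.chan = none) :
    ConfTyped Sg Δ n {o} (Δ.after Γ o.chan A) := by
  set Δf : Ctx N 0 0 := fun c => if (Γ c).isSome then none else Δ c with hΔf
  have hd : Δf.Disj Γ := by
    intro c
    by_cases h : (Γ c).isSome
    · simp [hΔf, h]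
    · exact .inr (by simpa using h)
  have hf : Δf o.chan = none := by simp [hΔf, hΔ]
  have h₁ : Sg.EqualCtx (Δf.join Γ) Δ := by
    intro c
    cases hc : Γ c with
    | none =>
      simp only [Ctx.join, hΔf, hc, Option.or_none]
      exact hSg.equalCtx_refl Δ c
    | some B =>
      obtain ⟨B', hB', h⟩ := hs c B hc
      simp only [Ctx.join, hΔf, hc, hB']
      exact .some h.symm
  have h₂ : Δf.set o.chan A = Δ.after Γ o.chan A := by
    funext c
    rw [Ctx.set_apply]
    rfl
  rw [← h₂]
  refine ConfTyped.conv ?_ h₁ (hSg.equalCtx_refl _)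
  cases ho with
  | proc hP hp hΓ hn => exact hn ▸ .proc hP hp hd hf hΓ
  | msg hm hP hp hΓ hn => exact hn ▸ .msg hm hP hp hd hf hΓ

/-- A chain is a derivation of configuration typing. The empty chain is excluded because the
empty configuration is only typed with empty interfaces. -/
theorem Chain.confTyped {Sg : Sig N} (hSg : Sg.WF) {Δ Δ' : Ctx N 0 0} {E : ℕ} {L : List (Obj N)}
    (h : Chain Sg Δ E L Δ') (hL : L ≠ []) : ConfTyped Sg Δ E L Δ' := by
  induction h with
  | nil => exact (hL rfl).elim
  | @cons Δ Γ Δ' n E E' o L A ho hs hn h hE ih =>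
    have h₁ := ho.confTyped hSg hs hn
    cases L with
    | nil =>
      cases h with
      | nil he =>
        rw [hE]
        exact h₁.conv (hSg.equalCtx_refl _) he
    | cons o' L =>
      rw [hE, ← Multiset.cons_coe, ← Multiset.singleton_add]
      exact h₁.compose (ih (by simp))

/-! ### Rearranging chains -/

/-- Replacing the last part of a chain. -/
theorem Chain.replace {Sg : Sig N} {Δ' : Ctx N 0 0} {L₁ L L' : List (Obj N)} :
    ∀ {Δ : Ctx N 0 0} {E : ℕ}, Chain Sg Δ E (L₁ ++ L) Δ' →
    (∀ (Δm : Ctx N 0 0) (E : ℕ), (∀ c, Δ c = none → (∀ o ∈ L₁, o.chan ≠ c) → Δm c = none) →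
      Chain Sg Δm E L Δ' → Chain Sg Δm E L' Δ') → Chain Sg Δ E (L₁ ++ L') Δ' := by
  induction L₁ with
  | nil => exact fun h hrep => hrep _ _ (fun c hc _ => hc) h
  | cons o L₁ ih =>
    intro Δ E h hrep
    cases h with
    | cons ho hs hn h hE =>
      refine .cons ho hs hn (ih h fun Δm E hm hL => hrep Δm E (fun c hc hc' => ?_) hL) hE
      exact hm c (Ctx.after_eq_none hc (hc' o (by simp))) fun o' ho' => hc' o' (by simp [ho'])

/-- A channel that is neither in the initial context nor provided earlier is not used. -/
theorem Chain.exists_not_used {Sg : Sig N} {Δ' : Ctx N 0 0} {L₁ L₂ : List (Obj N)} {o : Obj N}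
    {x : Name} : ∀ {Δ : Ctx N 0 0} {E : ℕ}, Chain Sg Δ E (L₁ ++ o :: L₂) Δ' → Δ x = none →
    (∀ o' ∈ L₁, o'.chan ≠ x) → ∃ Γ n A, ObjTyped Sg o Γ n A ∧ Γ x = none := by
  induction L₁ with
  | nil =>
    intro Δ E h hx _
    cases h with
    | @cons _ Γ _ _ _ _ _ _ _ ho hs hn h hE =>
      refine ⟨_, _, _, ho, ?_⟩
      by_contra hc
      obtain ⟨A, hA⟩ := Option.ne_none_iff_exists'.1 hc
      obtain ⟨B, hB, -⟩ := hs x A hA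
      simp [hx] at hB
  | cons o' L₁ ih =>
    intro Δ E h hx hL
    cases h with
    | cons ho hs hn h hE =>
      exact ih h (Ctx.after_eq_none hx (hL _ (by simp))) fun o'' ho'' => hL _ (by simp [ho''])

theorem Ctx.after_comm {Δ Γ Γ' : Ctx N 0 0} {x x' : Name} {A A' : Ty N 0} (hx : x ≠ x')
    (h : Γ x' = none) (h' : Γ' x = none) :
    (Δ.after Γ x A).after Γ' x' A' = (Δ.after Γ' x' A').after Γ x A := by
  funext c
  simp only [Ctx.after]
  split_ifs <;> simp_all

theorem Sig.Supplies.eq_none {Sg : Sig N} {Δ Γ : Ctx N 0 0} (h : Sg.Supplies Δ Γ) {c : Name}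
    (hc : Δ c = none) : Γ c = none := by
  by_contra hn
  obtain ⟨A, hA⟩ := Option.ne_none_iff_exists'.1 hn
  obtain ⟨B, hB, -⟩ := h c A hA
  simp [hc] at hB

theorem Chain.cons_inv {Sg : Sig N} {Δ Δ' : Ctx N 0 0} {E' : ℕ} {o : Obj N} {L : List (Obj N)}
    (h : Chain Sg Δ E' (o :: L) Δ') : ∃ Γ n A E, ObjTyped Sg o Γ n A ∧ Sg.Supplies Δ Γ ∧
      Δ o.chan = none ∧ Chain Sg (Δ.after Γ o.chan A) E L Δ' ∧ E' = n + E := by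
  cases h with
  | cons ho hs hn h hE => exact ⟨_, _, _, _, ho, hs, hn, h, hE⟩

/-- The provider of a channel can be moved next to the object that uses it, because the objects
in between do not use that channel. -/
theorem Chain.move {Sg : Sig N} {Δ' : Ctx N 0 0} {o₁ o₂ : Obj N} {L₁ L₂ : List (Obj N)}
    (huse : ∀ Γ n A, ObjTyped Sg o₂ Γ n A → Γ o₁.chan ≠ none) :
    ∀ {Δ : Ctx N 0 0} {E : ℕ}, Chain Sg Δ E (o₁ :: (L₁ ++ o₂ :: L₂)) Δ' →
    (∀ o ∈ L₁, Δ o.chan = none) → ((o₁ :: L₁).map Obj.chan).Nodup →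
    Chain Sg Δ E (L₁ ++ o₁ :: o₂ :: L₂) Δ' := by
  induction L₁ with
  | nil => exact fun h _ _ => h
  | cons o₃ L₁ ih =>
    intro Δ E h hΔ hnd
    replace h := h.cons_inv
    obtain ⟨Γ₁, n₁, A₁, E₁, ho₁, hs₁, hn₁, h, rfl⟩ := h
    replace h := h.cons_inv
    obtain ⟨Γ₃, n₃, A₃, E₃, ho₃, hs₃, hn₃, h, rfl⟩ := h
    simp only [List.map_cons, List.nodup_cons, List.mem_cons, List.mem_map, not_or, not_exists,
      not_and] at hnd
    obtain ⟨⟨h₁₃, hnd₁⟩, hnd₃, hnd⟩ := hnd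
    by_cases hu : Γ₃ o₁.chan = none
    · have hΔ₃ := hΔ o₃ (by simp)
      have hs₃' : Sg.Supplies Δ Γ₃ := by
        intro c A hA
        obtain ⟨B, hB, hBA⟩ := hs₃ c A hA
        simp only [Ctx.after] at hB
        split_ifs at hB with hc hc'
        · simp [hc, hu] at hA
        · exact ⟨B, hB, hBA⟩
      have hs₁' : Sg.Supplies (Δ.after Γ₃ o₃.chan A₃) Γ₁ := by
        intro c A hA
        obtain ⟨B, hB, hBA⟩ := hs₁ c A hA
        refine ⟨B, ?_, hBA⟩
        have hc : c ≠ o₃.chan := fun he => by simp [he, hΔ₃] at hB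
        have hc₁ : c ≠ o₁.chan := fun he => by simp [he, hn₁] at hB
        have h₃ : Γ₃ c = none := hs₃.eq_none (by simp [Ctx.after, hc₁, hA])
        simp [Ctx.after, hc, h₃, hB]
      rw [Ctx.after_comm h₁₃ (hs₁.eq_none hΔ₃) hu] at h
      refine .cons ho₃ hs₃' hΔ₃ (ih (.cons ho₁ hs₁' (Ctx.after_eq_none hn₁ (Ne.symm h₁₃)) h rfl)
        (fun o ho => Ctx.after_eq_none (hΔ o (by simp [ho])) fun he => hnd₃ o ho he.symm) ?_)
        (add_left_comm _ _ _)
      simp only [List.map_cons, List.nodup_cons, List.mem_map, not_exists, not_and]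
      exact ⟨fun o ho => hnd₁ o ho, hnd⟩
    -- If `o₃` consumed the channel of `o₁`, it would not be left for `o₂`.
    · obtain ⟨A, hA⟩ := Option.ne_none_iff_exists'.1 hu
      obtain ⟨Γ, n, A, ho, hx⟩ := h.exists_not_used (x := o₁.chan)
        (by simp [Ctx.after, h₁₃, hA]) (fun o ho => hnd₁ o ho)
      exact (huse Γ n A ho hx).elim

/-- A configuration that contains an object and the provider of a channel used by it has a chain
in which the two objects are neighbours. -/
theorem Chain.focus {Sg : Sig N} {Δ Δ' : Ctx N 0 0} {E : ℕ} {L : List (Obj N)}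
    (h : Chain Sg Δ E L Δ') {K : Conf N} {o₁ o₂ : Obj N} (hL : (L : Conf N) = K + ([o₁, o₂] : List _))
    (hΔ : ∀ o ∈ L, Δ o.chan = none) (hnd : (L.map Obj.chan).Nodup)
    (huse : ∀ Γ n A, ObjTyped Sg o₂ Γ n A → Γ o₁.chan ≠ none) :
    ∃ L₁ L₂, Chain Sg Δ E (L₁ ++ o₁ :: o₂ :: L₂) Δ' ∧ ((L₁ ++ L₂ : List _) : Conf N) = K := by
  have h₁ : o₁ ∈ L := by
    rw [← Multiset.mem_coe, hL]; simp
  obtain ⟨s, t, rfl⟩ := List.append_of_mem h₁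
  have hst : ((s ++ t : List _) : Conf N) = K + {o₂} := by
    have h : o₁ ::ₘ ((s ++ t : List _) : Conf N) = o₁ ::ₘ (K + {o₂}) := by
      rw [Multiset.cons_coe, ← Multiset.coe_eq_coe.2 List.perm_middle, hL, ← Multiset.cons_coe,
        ← Multiset.cons_coe, Multiset.add_cons]
      rfl
    exact (Multiset.cons_inj_right _).1 h
  have h₂ : o₂ ∈ s ++ t := by
    rw [← Multiset.mem_coe, hst]; simp
  have hfin (L₁ L₂ : List (Obj N)) (h : List.Perm (L₁ ++ o₂ :: L₂) (s ++ t)) :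
      ((L₁ ++ L₂ : List _) : Conf N) = K := by
    have h' : o₂ ::ₘ ((L₁ ++ L₂ : List _) : Conf N) = o₂ ::ₘ K := by
      rw [Multiset.cons_coe, ← Multiset.coe_eq_coe.2 List.perm_middle, Multiset.coe_eq_coe.2 h, hst,
        add_comm, Multiset.singleton_add]
    exact (Multiset.cons_inj_right _).1 h'
  have hnd' := hnd
  simp only [List.map_append, List.map_cons, List.nodup_append, List.nodup_cons] at hnd'
  rcases List.mem_append.1 h₂ with h₂ | h₂
  -- The user cannot precede the provider.
  · obtain ⟨s₁, s₂, rfl⟩ := List.append_of_mem h₂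
    rw [List.append_assoc] at h
    obtain ⟨Γ, n, A, ho, hx⟩ := h.exists_not_used (x := o₁.chan) (hΔ o₁ h₁)
      (fun o ho he => hnd'.2.2 o.chan (by simpa using .inl ⟨o, ho, rfl⟩) o₁.chan (by simp) he)
    exact (huse Γ n A ho hx).elim
  · obtain ⟨t₁, t₂, rfl⟩ := List.append_of_mem h₂
    refine ⟨s ++ t₁, t₂, ?_, hfin _ _ (by rw [List.append_assoc])⟩
    rw [List.append_assoc]
    refine h.replace fun Δm E hm h => h.move huse (fun o ho => hm _ (hΔ o (by simp [ho])) ?_) ?_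
    · exact fun o' ho' => hnd'.2.2 _ (List.mem_map_of_mem ho') _ (by simpa using .inr (.inl ⟨o, ho, rfl⟩))
    · have h := hnd'.2.1
      simp only [List.map_append, List.nodup_append, List.mem_append, not_or] at h
      simp only [List.map_cons, List.nodup_cons]
      exact ⟨h.1.1, h.2.1⟩

/-! ### Cuts -/

/-- `Γ` is what an object with context `Γ₂` uses together with the provider of `c : A` with
context `Γ₁`. -/
structure Cut (Sg : Sig N) (Γ₁ : Ctx N 0 0) (c : Name) (A : Ty N 0) (Γ₂ Γ : Ctx N 0 0) :
    Prop where
  disj : ∀ a, Γ₁ a = none ∨ Γ₂ a = none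
  link : ∃ B, Γ₂ c = some B ∧ Sg.Equal A B
  left : Γ₁ c = none
  out : Γ c = none
  rest : ∀ a, a ≠ c → Option.Rel Sg.Equal ((Γ₁ a).or (Γ₂ a)) (Γ a)

/-- Two neighbours, the first of which provides a channel to the second, are replaced by one
object. -/
theorem Chain.contract {Sg : Sig N} (hSg : Sg.WF) {Δ Δ' : Ctx N 0 0} {E : ℕ} {o₁ o₂ o : Obj N}
    {L : List (Obj N)} (h : Chain Sg Δ E (o₁ :: o₂ :: L) Δ') (hΔ : Δ o₂.chan = none)
    (ho : o.chan = o₂.chan)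
    (hcut : ∀ Γ₁ n₁ A₁ Γ₂ n₂ A₂, ObjTyped Sg o₁ Γ₁ n₁ A₁ → ObjTyped Sg o₂ Γ₂ n₂ A₂ →
      (∀ a, Γ₁ a = none ∨ Γ₂ a = none) → (∀ B, Γ₂ o₁.chan = some B → Sg.Equal A₁ B) →
      Γ₁ o₂.chan = none →
      ∃ Γ A, ObjTyped Sg o Γ (n₁ + n₂) A ∧ Sg.Equal A₂ A ∧ Cut Sg Γ₁ o₁.chan A₁ Γ₂ Γ) :
    Chain Sg Δ E (o :: L) Δ' := by
  replace h := h.cons_inv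
  obtain ⟨Γ₁, n₁, A₁, E₁, ho₁, hs₁, hn₁, h, rfl⟩ := h
  replace h := h.cons_inv
  obtain ⟨Γ₂, n₂, A₂, E₂, ho₂, hs₂, hn₂, h, rfl⟩ := h
  have hdisj (a : Name) : Γ₁ a = none ∨ Γ₂ a = none := by
    by_cases ha : Γ₁ a = none
    · exact .inl ha
    · obtain ⟨A, hA⟩ := Option.ne_none_iff_exists'.1 ha
      refine .inr (hs₂.eq_none ?_)
      have : a ≠ o₁.chan := fun he => ha (he ▸ ho₁.chan_eq_none)
      simp [Ctx.after, this, hA]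
  have hlink (B : Ty N 0) (hB : Γ₂ o₁.chan = some B) : Sg.Equal A₁ B := by
    obtain ⟨B', hB', hBB⟩ := hs₂ _ _ hB
    rw [Ctx.after_self] at hB'
    cases hB'
    exact hBB
  obtain ⟨Γ, A, hoΓ, hA, hc⟩ := hcut Γ₁ n₁ A₁ Γ₂ n₂ A₂ ho₁ ho₂ hdisj hlink (hs₁.eq_none hΔ)
  have hΔ₂ (a : Name) (B : Ty N 0) (hB : Γ₂ a = some B) (ha : a ≠ o₁.chan) :
      ∃ B', Δ a = some B' ∧ Sg.Equal B' B := by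
    obtain ⟨B', hB', hBB⟩ := hs₂ a B hB
    simp only [Ctx.after, if_neg ha] at hB'
    split_ifs at hB' with hc'
    exact ⟨B', hB', hBB⟩
  refine .cons hoΓ ?_ (ho ▸ hΔ) (h.congr_left hSg ?_) (add_assoc _ _ _).symm
  · intro a B hB
    have ha : a ≠ o₁.chan := fun he => by simp [he, hc.out] at hB
    have := hc.rest a ha
    rw [hB] at this
    cases h₁ : Γ₁ a with
    | none =>
      cases h₂ : Γ₂ a with
      | none => simp only [h₁, h₂, Option.or_none] at this; cases this
      | some B₂ =>
        simp only [h₁, h₂, Option.none_or] at this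
        cases this with
        | some hBB =>
          obtain ⟨B', hB', hBB'⟩ := hΔ₂ a B₂ h₂ ha
          exact ⟨B', hB', hBB'.trans hBB⟩
    | some B₁ =>
      simp only [h₁, Option.some_or] at this
      cases this with
      | some hBB =>
        obtain ⟨B', hB', hBB'⟩ := hs₁ a B₁ h₁
        exact ⟨B', hB', hBB'.trans hBB⟩
  · intro a
    rw [ho]
    simp only [Ctx.after]
    by_cases ha₂ : a = o₂.chan
    · rw [if_pos ha₂, if_pos ha₂]
      exact .some hA
    rw [if_neg ha₂, if_neg ha₂]
    by_cases ha : a = o₁.chan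
    · obtain ⟨B, hB, -⟩ := hc.link
      subst ha
      rw [hB, hc.out, hn₁]
      exact .none
    rw [if_neg ha]
    have := hc.rest a ha
    cases h₁ : Γ₁ a <;> cases h₂ : Γ₂ a <;> simp only [h₁, h₂, Option.or] at this <;>
      generalize Γ a = b at this <;> cases this <;>
      first | exact .none | exact hSg.equalCtx_refl Δ a

/-- An object is replaced by two, the first of which provides a fresh channel to the second. -/
theorem Chain.expand {Sg : Sig N} (hSg : Sg.WF) {Δ Δ' : Ctx N 0 0} {E : ℕ} {o₁ o₂ o : Obj N}
    {L : List (Obj N)} (h : Chain Sg Δ E (o :: L) Δ') (hΔ : Δ o₁.chan = none)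
    (hne : o₁.chan ≠ o₂.chan) (ho : o₂.chan = o.chan)
    (hcut : ∀ Γ n A, ObjTyped Sg o Γ n A → Γ o₁.chan = none →
      ∃ Γ₁ n₁ A₁ Γ₂ n₂, ObjTyped Sg o₁ Γ₁ n₁ A₁ ∧ ObjTyped Sg o₂ Γ₂ n₂ A ∧ n = n₁ + n₂ ∧
        Cut Sg Γ₁ o₁.chan A₁ Γ₂ Γ) :
    Chain Sg Δ E (o₁ :: o₂ :: L) Δ' := by
  replace h := h.cons_inv
  obtain ⟨Γ, n, A, E', hoΓ, hs, hn, h, rfl⟩ := h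
  obtain ⟨Γ₁, n₁, A₁, Γ₂, n₂, ho₁, ho₂, rfl, hc⟩ := hcut Γ n A hoΓ (hs.eq_none hΔ)
  have hsup (a : Name) (B : Ty N 0) (ha : a ≠ o₁.chan) (h : (Γ₁ a).or (Γ₂ a) = some B) :
      ∃ B', Δ a = some B' ∧ Sg.Equal B' B := by
    have := hc.rest a ha
    rw [h] at this
    generalize hb : Γ a = b at this
    cases this with
    | some hBB =>
      obtain ⟨B', hB', hBB'⟩ := hs _ _ hb
      exact ⟨B', hB', hBB'.trans hBB.symm⟩
  refine .cons ho₁ (fun a B hB => ?_) hΔ (.cons ho₂ (fun a B hB => ?_) ?_ ?_ rfl) (add_assoc _ _ _)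
  · exact hsup a B (fun he => by simp [he, hc.left] at hB) (by simp [hB])
  · by_cases ha : a = o₁.chan
    · obtain ⟨B', hB', hAB⟩ := hc.link
      subst ha
      rw [hB] at hB'
      cases hB'
      exact ⟨A₁, Ctx.after_self _ _ _ _, hAB⟩
    · have h₁ : Γ₁ a = none := (hc.disj a).resolve_right (by simp [hB])
      obtain ⟨B', hB', hBB⟩ := hsup a B ha (by simp [h₁, hB])
      exact ⟨B', by simp [Ctx.after, ha, h₁, hB'], hBB⟩
  · exact Ctx.after_eq_none (ho ▸ hn) hne
  · refine h.congr_left hSg fun a => ?_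
    rw [ho]
    simp only [Ctx.after]
    by_cases ha₂ : a = o.chan
    · rw [if_pos ha₂, if_pos ha₂]
      exact .some (hSg.equal_refl _)
    rw [if_neg ha₂, if_neg ha₂]
    by_cases ha : a = o₁.chan
    · obtain ⟨B, hB, -⟩ := hc.link
      subst ha
      rw [hB, hc.out, hΔ]
      exact .none
    rw [if_neg ha]
    have := hc.rest a ha
    cases h₁ : Γ₁ a <;> cases h₂ : Γ₂ a <;> simp only [h₁, h₂, Option.or] at this <;>
      generalize Γ a = b at this <;> cases this <;>
      first | exact .none | exact hSg.equalCtx_refl Δ a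

/-- An object is replaced by another one that uses and provides the same channels. -/
theorem Chain.modify {Sg : Sig N} {Δ Δ' : Ctx N 0 0} {E : ℕ} {o o' : Obj N}
    {L : List (Obj N)} (h : Chain Sg Δ E (o :: L) Δ') (ho : o'.chan = o.chan)
    (hoo : ∀ Γ n A, ObjTyped Sg o Γ n A → ObjTyped Sg o' Γ n A) :
    Chain Sg Δ E (o' :: L) Δ' := by
  replace h := h.cons_inv
  obtain ⟨Γ, n, A, E', hoΓ, hs, hn, h, rfl⟩ := h
  exact .cons (hoo _ _ _ hoΓ) hs (ho ▸ hn) (ho ▸ h) rfl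

/-! ### Sending -/

/-- `Emits Sg pos U p W m A`: a channel of unfolded type `U` continues with type `A` after the
payload `p` has been sent along it, by the provider if `pos` and by the client otherwise. The
payload hands over the channels of `W` and the potential `m`. -/
inductive Emits (Sg : Sig N) : Bool → Ty N 0 → Payload 0 0 → Ctx N 0 0 → ℕ → Ty N 0 → Prop
  | plus {L : Finset Label} {F : {l // l ∈ L} → Ty N 0} (l : Label) (hl : l ∈ L) :
      Emits Sg true (.plus L F) (.label l) Ctx.empty 0 (F ⟨l, hl⟩)
  | amp {L : Finset Label} {F : {l // l ∈ L} → Ty N 0} (l : Label) (hl : l ∈ L) :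
      Emits Sg false (.amp L F) (.label l) Ctx.empty 0 (F ⟨l, hl⟩)
  | tensor {A₁ A₂ B : Ty N 0} {w : Name} : Sg.Equal B A₁ →
      Emits Sg true (.tensor A₁ A₂) (.chan w) (Ctx.empty.set w B) 0 A₂
  | lolli {A₁ A₂ B : Ty N 0} {w : Name} : Sg.Equal B A₁ →
      Emits Sg false (.lolli A₁ A₂) (.chan w) (Ctx.empty.set w B) 0 A₂
  | ex {A : Ty N 1} {e : Exp 0} : 0 ≤ e.val →
      Emits Sg true (.ex A) (.idx e) Ctx.empty 0 (A.subst (single e))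
  | all {A : Ty N 1} {e : Exp 0} : 0 ≤ e.val →
      Emits Sg false (.all A) (.idx e) Ctx.empty 0 (A.subst (single e))
  | assert {A : Ty N 0} {φ φ' : Fml 0} : Entails .top φ → Entails .top φ' →
      Emits Sg true (.assert φ' A) (.proof φ) Ctx.empty 0 A
  | assume {A : Ty N 0} {φ φ' : Fml 0} : Entails .top φ → Entails .top φ' →
      Emits Sg false (.assume φ' A) (.proof φ) Ctx.empty 0 A
  | pay {A : Ty N 0} {r₁ r₂ : Exp 0} {m : ℕ} : r₁.val = (m : ℤ) → r₂.val = (m : ℤ) →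
      Emits Sg true (.pay r₂ A) (.pot r₁) Ctx.empty m A
  | get {A : Ty N 0} {r₁ r₂ : Exp 0} {m : ℕ} : r₁.val = (m : ℤ) → r₂.val = (m : ℤ) →
      Emits Sg false (.get r₂ A) (.pot r₁) Ctx.empty m A

/-- `Γ` without the channels of `W`. -/
def Ctx.minus (Γ W : Ctx N 0 0) : Ctx N 0 0 := fun a => if (W a).isSome then none else Γ a

theorem Ctx.minus_empty (Γ : Ctx N 0 0) : Γ.minus Ctx.empty = Γ := by
  funext a
  simp [Ctx.minus, Ctx.empty]

theorem Ctx.minus_single (Γ : Ctx N 0 0) (w : Name) (B : Ty N 0) :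
    Γ.minus (Ctx.empty.set w B) = Γ.del w := by
  funext a
  rw [Ctx.del_apply, Ctx.minus, Ctx.set_apply]
  split_ifs <;> simp_all [Ctx.empty]

/-- The declarations of `W` are among those of `Γ`. -/
def Ctx.Sub (W Γ : Ctx N 0 0) : Prop := ∀ a B, W a = some B → Γ a = some B

theorem Ctx.empty_sub (Γ : Ctx N 0 0) : Ctx.empty.Sub Γ := fun _ _ h => by cases h

theorem Ctx.single_sub {Γ : Ctx N 0 0} {w : Name} {B : Ty N 0} (h : Γ w = some B) :
    (Ctx.empty.set w B).Sub Γ := by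
  intro a A hA
  rw [Ctx.set_apply] at hA
  split_ifs at hA with ha
  · rw [ha, h, hA]
  · cases hA

theorem val_sub (a b : Exp 0) : (Exp.sub a b).val = a.val - b.val := rfl

theorem val_add (a b : Exp 0) : (Exp.add a b).val = a.val + b.val := rfl

theorem val_const (n : ℕ) : (Exp.const n : Exp 0).val = (n : ℤ) := rfl

/-- A provider that sends hands over the channels of `W` and the potential `m` with the payload. -/
theorem Typed.send_right_inv {Sg : Sig N} {Γ : Ctx N 0 0} {p : Exp 0} {c : Name}
    {u : Payload 0 0} {P : Proc N 0 0} {A : Ty N 0} (h : Typed Sg .top Γ p (.send c u P) c A)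
    (hc : Γ c = none) (hp : 0 ≤ p.val) :
    ∃ W m A' p', Emits Sg true (Sg.unfold A) u W m A' ∧ W.Sub Γ ∧
      Typed Sg .top (Γ.minus W) p' P c A' ∧ p.val = p'.val + m ∧ 0 ≤ p'.val := by
  cases h with
  | @plusR _ _ _ _ _ _ _ L F l _ hA hP =>
    rw [hA]
    exact ⟨_, _, _, p, .plus l.1 l.2, Ctx.empty_sub _, by rwa [Ctx.minus_empty], by simp, hp⟩
  | tensorR hA hw hB hP =>
    rw [hA]
    exact ⟨_, _, _, p, .tensor (Sig.equalUnder_closed.1 hB), Ctx.single_sub hw,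
      by rwa [Ctx.minus_single], by simp, hp⟩
  | exR hA he hP =>
    rw [hA]
    exact ⟨_, _, _, p, .ex (isNat_closed.1 he), Ctx.empty_sub _, by rwa [Ctx.minus_empty],
      by simp, hp⟩
  | assertR hA hφ hφ' hP =>
    rw [hA]
    exact ⟨_, _, _, p, .assert hφ hφ', Ctx.empty_sub _, by rwa [Ctx.minus_empty], by simp, hp⟩
  | payR hA hr hq he hP =>
    rw [hA]
    obtain ⟨m, hm⟩ := Int.eq_ofNat_of_zero_le (isNat_closed.1 hr)
    have hq := entails_ge_closed.1 hq
    refine ⟨_, m, _, _, .pay hm ((entails_eq_closed.1 he).symm.trans hm), Ctx.empty_sub _,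
      by rwa [Ctx.minus_empty], ?_, ?_⟩ <;> rw [val_sub] <;> omega
  | ampL hx | lolliL hx | allL hx | assumeL hx | getL hx => simp [hc] at hx

/-- A client that sends hands over the channels of `W` and the potential `m` with the payload. -/
theorem Typed.send_left_inv {Sg : Sig N} {Γ : Ctx N 0 0} {p : Exp 0} {c d : Name}
    {u : Payload 0 0} {P : Proc N 0 0} {D : Ty N 0} (h : Typed Sg .top Γ p (.send c u P) d D)
    (hd : d ≠ c) (hp : 0 ≤ p.val) :
    ∃ A W m A' p', Γ c = some A ∧ Emits Sg false (Sg.unfold A) u W m A' ∧ W.Sub Γ ∧ W c = none ∧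
      Typed Sg .top ((Γ.minus W).set c A') p' P d D ∧ p.val = p'.val + m ∧ 0 ≤ p'.val := by
  cases h with
  | plusR | tensorR | exR | assertR | payR => exact (hd rfl).elim
  | @ampL _ _ _ _ _ _ _ A _ L F l _ hx hA hP =>
    refine ⟨A, Ctx.empty, 0, F l, p, hx, ?_, Ctx.empty_sub _, rfl, ?_, by simp, hp⟩
    · rw [hA]
      exact .amp l.1 l.2
    · rwa [Ctx.minus_empty]
  | @lolliL _ _ _ _ _ _ w _ A A₁ A₂ B _ _ hx hA hwx hw hB hP =>
    refine ⟨A, Ctx.empty.set w B, 0, A₂, p, hx, ?_, Ctx.single_sub hw, ?_, ?_, by simp, hp⟩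
    · rw [hA]
      exact .lolli (Sig.equalUnder_closed.1 hB)
    · rw [Ctx.set_apply, if_neg hwx.symm]; rfl
    · rwa [Ctx.minus_single]
  | @allL _ _ _ _ _ e _ _ A _ A' _ hx hA he hP =>
    refine ⟨A, Ctx.empty, 0, A'.subst (single e), p, hx, ?_, Ctx.empty_sub _, rfl, ?_, by simp, hp⟩
    · rw [hA]
      exact .all (isNat_closed.1 he)
    · rwa [Ctx.minus_empty]
  | @assumeL _ _ _ _ _ _ _ A A' _ _ _ _ hx hA hφ hφ' hP =>
    refine ⟨A, Ctx.empty, 0, A', p, hx, ?_, Ctx.empty_sub _, rfl, ?_, by simp, hp⟩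
    · rw [hA]
      exact .assume hφ hφ'
    · rwa [Ctx.minus_empty]
  | @getL _ _ _ _ _ r₁ r₂ _ _ A A' _ _ hx hA hr hq he hP =>
    obtain ⟨m, hm⟩ := Int.eq_ofNat_of_zero_le (isNat_closed.1 hr)
    have hq := entails_ge_closed.1 hq
    refine ⟨A, Ctx.empty, m, A', .sub p r₁, hx, ?_, Ctx.empty_sub _, rfl, ?_, ?_, ?_⟩
    · rw [hA]
      exact .get hm ((entails_eq_closed.1 he).symm.trans hm)
    · rwa [Ctx.minus_empty]
    · rw [val_sub]; omega
    · rw [val_sub]; omega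

theorem Typed.fwd_inv {Sg : Sig N} {Γ : Ctx N 0 0} {p : Exp 0} {x y z : Name} {D : Ty N 0}
    (h : Typed Sg .top Γ p (.fwd x y) z D) :
    z = x ∧ ∃ A, Γ = Ctx.empty.set y A ∧ p.val = 0 ∧ Sg.Equal A D := by
  cases h with
  | id hq hA => exact ⟨rfl, _, rfl, entails_eq_closed.1 hq, Sig.equalUnder_closed.1 hA⟩

theorem Typed.fwd {Sg : Sig N} (hSg : Sg.WF) {p : Exp 0} (hp : p.val = 0) (x y : Name)
    (A : Ty N 0) : Typed Sg .top (Ctx.empty.set y A) p (.fwd x y) x A :=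
  .id (entails_eq_closed.2 hp) (Sig.equalUnder_closed.2 (hSg.equal_refl A))

theorem Ctx.set_set {k m : ℕ} (Γ : Ctx N k m) (x : Chan m) (A B : Ty N k) :
    (Γ.set x A).set x B = Γ.set x B := by
  simp [Ctx.set]

theorem Ctx.set_del_single {x w : Name} (h : x ≠ w) (A B : Ty N 0) :
    ((Ctx.empty.set w B).set x A : Ctx N 0 0).del w = Ctx.empty.set x A := by
  funext a
  simp only [Ctx.del_apply, Ctx.set_apply]
  split_ifs <;> simp_all [Ctx.empty]

/-- The message of a provider that sends. -/
theorem Emits.typed_right {Sg : Sig N} (hSg : Sg.WF) {A A' : Ty N 0} {u : Payload 0 0}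
    {W : Ctx N 0 0} {m : ℕ} (h : Emits Sg true (Sg.unfold A) u W m A') (c : Name) {c' : Name}
    (hc' : W c' = none) : ∃ p : Exp 0, p.val = m ∧
      Typed Sg .top (W.set c' A') p (.send c u (.fwd c c')) c A := by
  generalize hU : Sg.unfold A = U at h
  have h0 : (Exp.const 0 : Exp 0).val = 0 := rfl
  cases h with
  | plus l hl => exact ⟨.const 0, rfl, .plusR (l := ⟨l, hl⟩) hU (.fwd hSg h0 _ _ _)⟩
  | @tensor A₁ A₂ B w hB =>
    have hw : c' ≠ w := fun he => by simp [Ctx.set_apply, he] at hc'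
    refine ⟨.const 0, rfl, .tensorR (B := B) hU ?_ (Sig.equalUnder_closed.2 hB) ?_⟩
    · simp [Ctx.set_apply, hw.symm]
    · rw [Ctx.set_del_single hw]
      exact .fwd hSg h0 _ _ _
  | ex he => exact ⟨.const 0, rfl, .exR hU (isNat_closed.2 he) (.fwd hSg h0 _ _ _)⟩
  | assert hφ hφ' => exact ⟨.const 0, rfl, .assertR hU hφ hφ' (.fwd hSg h0 _ _ _)⟩
  | @pay _ r₁ r₂ _ hr₁ hr₂ =>
    refine ⟨r₁, hr₁, .payR hU (isNat_closed.2 (by omega)) (entails_ge_closed.2 le_rfl)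
      (entails_eq_closed.2 (hr₁.trans hr₂.symm)) (.fwd hSg ?_ _ _ _)⟩
    rw [val_sub, sub_self]

/-- The message of a client that sends. -/
theorem Emits.typed_left {Sg : Sig N} (hSg : Sg.WF) {A A' : Ty N 0} {u : Payload 0 0}
    {W : Ctx N 0 0} {m : ℕ} (h : Emits Sg false (Sg.unfold A) u W m A') {c : Name} (c' : Name)
    (hc : W c = none) : ∃ p : Exp 0, p.val = m ∧
      Typed Sg .top (W.set c A) p (.send c u (.fwd c' c)) c' A' := by
  generalize hU : Sg.unfold A = U at h
  have h0 : (Exp.const 0 : Exp 0).val = 0 := rfl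
  have hx : W.set c A c = some A := by simp [Ctx.set_apply]
  cases h with
  | amp l hl =>
    refine ⟨.const 0, rfl, .ampL (l := ⟨l, hl⟩) hx hU ?_⟩
    rw [Ctx.set_set]
    exact .fwd hSg h0 _ _ _
  | @lolli A₁ A₂ B w hB =>
    have hw : c ≠ w := fun he => by simp [Ctx.set_apply, he] at hc
    refine ⟨.const 0, rfl, .lolliL (B := B) hx hU hw.symm ?_ (Sig.equalUnder_closed.2 hB) ?_⟩
    · simp [Ctx.set_apply, hw.symm]
    · rw [Ctx.set_del_single hw, Ctx.set_set]
      exact .fwd hSg h0 _ _ _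
  | all he =>
    refine ⟨.const 0, rfl, .allL hx hU (isNat_closed.2 he) ?_⟩
    rw [Ctx.set_set]
    exact .fwd hSg h0 _ _ _
  | assume hφ hφ' =>
    refine ⟨.const 0, rfl, .assumeL hx hU hφ hφ' ?_⟩
    rw [Ctx.set_set]
    exact .fwd hSg h0 _ _ _
  | @get _ r₁ r₂ _ hr₁ hr₂ =>
    refine ⟨r₁, hr₁, .getL hx hU (isNat_closed.2 (by omega)) (entails_ge_closed.2 le_rfl)
      (entails_eq_closed.2 (hr₁.trans hr₂.symm)) ?_⟩
    rw [Ctx.set_set]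
    refine .fwd hSg ?_ _ _ _
    rw [val_sub, sub_self]

/-- The context of a message of a provider consists of the channels that it hands over and of
its continuation channel. -/
theorem Typed.message_right_inv {Sg : Sig N} {Γ : Ctx N 0 0} {p : Exp 0} {c c' : Name}
    {u : Payload 0 0} {A : Ty N 0} (h : Typed Sg .top Γ p (.send c u (.fwd c c')) c A)
    (hc : Γ c = none) (hp : 0 ≤ p.val) :
    ∃ W m A' B, Emits Sg true (Sg.unfold A) u W m A' ∧ Γ = W.set c' B ∧ W c' = none ∧
      Sg.Equal B A' ∧ p.val = m := by
  obtain ⟨W, m, A', p', hE, hW, hP, hpp, -⟩ := h.send_right_inv hc hp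
  obtain ⟨-, B, hΓ, hp', hB⟩ := hP.fwd_inv
  have hc' : W c' = none := by
    have := congrFun hΓ c'
    simp only [Ctx.minus, Ctx.set_apply, if_true] at this
    split_ifs at this with h'
    simpa using h'
  refine ⟨W, m, A', B, hE, ?_, hc', hB, by omega⟩
  funext a
  have := congrFun hΓ a
  rw [Ctx.set_apply] at this ⊢
  simp only [Ctx.minus] at this
  cases hWa : W a with
  | none => simpa [hWa, Ctx.empty] using this
  | some T => rw [hW a T hWa, if_neg (fun he => by simp [he, hc'] at hWa)]

/-- The context of a message of a client consists of the channels that it hands over and of the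
channel along which it is sent. -/
theorem Typed.message_left_inv {Sg : Sig N} {Γ : Ctx N 0 0} {p : Exp 0} {c c' : Name}
    {u : Payload 0 0} {D : Ty N 0} (h : Typed Sg .top Γ p (.send c u (.fwd c' c)) c' D)
    (hc : c' ≠ c) (hp : 0 ≤ p.val) :
    ∃ W m A' A, Emits Sg false (Sg.unfold A) u W m A' ∧ Γ = W.set c A ∧ W c = none ∧
      Sg.Equal A' D ∧ p.val = m := by
  obtain ⟨A, W, m, A', p', hx, hE, hW, hWc, hP, hpp, -⟩ := h.send_left_inv hc hp
  obtain ⟨-, B, hΓ, hp', hB⟩ := hP.fwd_inv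
  have hBA : A' = B := by
    have := congrFun hΓ c
    simpa [Ctx.set_apply] using this
  refine ⟨W, m, A', A, hE, ?_, hWc, hBA ▸ hB, by omega⟩
  funext a
  have := congrFun hΓ a
  simp only [Ctx.set_apply, Ctx.minus] at this ⊢
  split_ifs at this ⊢ with h₁ h₂
  · rw [h₁, hx]
  · obtain ⟨T, hT⟩ := Option.isSome_iff_exists.1 h₂
    rw [hW a T hT, hT]
  · rw [this]
    simp [Ctx.empty, Option.not_isSome_iff_eq_none.1 h₂]

/-! ### Receiving -/

/-- `Reacts c c' R u R'`: the process `R` receives the payload `u` and the continuation channel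
`c'` along `c` and becomes `R'`. -/
inductive Reacts (c c' : Name) : Proc N 0 0 → Payload 0 0 → Proc N 0 0 → Prop
  | case {L : Finset Label} {Q : {l // l ∈ L} → Proc N 0 0} (l : Label) (hl : l ∈ L) :
      Reacts c c' (.case c L Q) (.label l) ((Q ⟨l, hl⟩).rename (Chan.repl c c'))
  | recv {Q : Proc N 0 1} {d : Name} :
      Reacts c c' (.recv c Q) (.chan d) (Q.rename (Chan.cons d (Chan.repl c c')))
  | recvIdx {Q : Proc N 1 0} {e : Exp 0} :
      Reacts c c' (.recvIdx c Q) (.idx e) ((Q.subst (single e)).rename (Chan.repl c c'))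
  | assume {Q : Proc N 0 0} {φ ψ : Fml 0} :
      Reacts c c' (.assume c ψ Q) (.proof φ) (Q.rename (Chan.repl c c'))
  | get {Q : Proc N 0 0} {r s : Exp 0} : r.val = s.val →
      Reacts c c' (.get c s Q) (.pot r) (Q.rename (Chan.repl c c'))

/-- A client of `c` switches to the channel `c'`. -/
theorem carries_repl_left {Γ : Ctx N 0 0} {c c' d : Name} {A : Ty N 0} (hc' : Γ c' = none)
    (hc'd : c' ≠ d) (hcd : c ≠ d) (hd : Γ d = none) :
    Carries (Chan.repl c c') d (Γ.set c A) ((Γ.del c).set c' A) := by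
  have hne (a : Name) (ha : Γ.set c A a ≠ none) (hac : a ≠ c) : a ≠ c' ∧ a ≠ d := by
    rw [Ctx.set_apply, if_neg hac] at ha
    exact ⟨fun he => ha (he ▸ hc'), fun he => ha (he ▸ hd)⟩
  refine ⟨fun {a} B hB => ?_, fun {a} ha => ?_, fun {a b} ha hb he => ?_, fun {a} ha => ?_⟩
  · by_cases hac : a = c
    · simpa [Chan.repl, Ctx.set_apply, hac] using hB
    · have := hne a (by simp [hB]) hac
      simpa [Chan.repl, Ctx.set_apply, Ctx.del_apply, hac, this.1] using hB
  · by_cases hac : a = c'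
    · exact ⟨c, by simp [Ctx.set_apply], by simp [Chan.repl, hac]⟩
    · rw [Ctx.set_apply, if_neg hac, Ctx.del_apply] at ha
      split_ifs at ha with hac'
      · exact (ha rfl).elim
      · exact ⟨a, by simp [Ctx.set_apply, hac', ha], by simp [Chan.repl, hac']⟩
  · simp only [Chan.repl] at he
    split_ifs at he with h₁ h₂ h₂
    · rw [h₁, h₂]
    · exact ((hne b hb h₂).1 he.symm).elim
    · exact ((hne a ha h₁).1 he).elim
    · exact he
  · simp only [Chan.repl, if_neg hcd.symm]
    split_ifs with h₁
    · exact hc'd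
    · exact (hne a ha h₁).2

/-- The provider of `c` provides `c'` instead. -/
theorem carries_repl_right {Γ : Ctx N 0 0} {c c' : Name} (hc : Γ c = none) (hc' : Γ c' = none) :
    Carries (Chan.repl c c') c Γ Γ := by
  have hne (a : Name) (ha : Γ a ≠ none) : a ≠ c ∧ a ≠ c' :=
    ⟨fun he => ha (he ▸ hc), fun he => ha (he ▸ hc')⟩
  have hid (a : Name) (ha : Γ a ≠ none) : Chan.repl c c' a = a := by
    simp [Chan.repl, (hne a ha).1]
  refine ⟨fun {a} B hB => ?_, fun {a} ha => ⟨a, ha, hid a ha⟩, fun {a b} ha hb he => ?_,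
    fun {a} ha => ?_⟩
  · rwa [hid a (by simp [hB])]
  · rwa [hid a ha, hid b hb] at he
  · rw [hid a ha]
    simpa [Chan.repl] using (hne a ha).2

theorem repl_self (c c' : Name) : Chan.repl c c' c = c' := by simp [Chan.repl]

theorem repl_ne {c d : Name} (c' : Name) (h : c ≠ d) : Chan.repl c c' d = d := by
  simp [Chan.repl, h.symm]

/-- A bound channel variable is instantiated by a channel that is not in use. -/
theorem Carries.instantiate {k m m' : ℕ} {ρ : Chan m → Chan m'} {z : Chan m} {Γ : Ctx N k m}
    {Γ' : Ctx N k m'} (h : Carries ρ z Γ Γ') {d : Chan m'} (hd : Γ' d = none) (hdz : d ≠ ρ z)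
    (A : Ty N k) : Carries (Chan.cons d ρ) z.wk (Γ.push A) (Γ'.set d A) := by
  have h0 : Chan.cons d ρ (.var 0) = d := rfl
  have hne {c : Chan m} (hc : Γ c ≠ none) : ρ c ≠ d := by
    obtain ⟨B, hB⟩ := Option.ne_none_iff_exists'.1 hc
    intro he
    have := h.map hB
    simp [he, hd] at this
  refine ⟨fun {c} B hB => ?_, fun {c'} hc => ?_, fun {c e} hc he hce => ?_, fun {c} hc => ?_⟩
  · obtain rfl | ⟨c, rfl⟩ := c.eq_zero_or_wk
    · rw [h0, Ctx.set_apply, if_pos rfl]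
      exact hB
    · rw [Ctx.push_wk] at hB
      rw [Chan.cons_wk, Ctx.set_apply, if_neg (hne (by simp [hB]))]
      exact h.map hB
  · by_cases hcd : c' = d
    · exact ⟨.var 0, by simp [Ctx.push_zero], by rw [h0, hcd]⟩
    · rw [Ctx.set_apply, if_neg hcd] at hc
      obtain ⟨e, he, rfl⟩ := h.surj hc
      exact ⟨e.wk, by rwa [Ctx.push_wk], Chan.cons_wk _ _ _⟩
  · obtain rfl | ⟨c, rfl⟩ := c.eq_zero_or_wk <;> obtain rfl | ⟨e, rfl⟩ := e.eq_zero_or_wk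
    · rfl
    · rw [Ctx.push_wk] at he
      rw [h0, Chan.cons_wk] at hce
      exact (hne he hce.symm).elim
    · rw [Ctx.push_wk] at hc
      rw [h0, Chan.cons_wk] at hce
      exact (hne hc hce).elim
    · rw [Ctx.push_wk] at hc he
      rw [Chan.cons_wk, Chan.cons_wk] at hce
      rw [h.inj hc he hce]
  · rw [Chan.cons_wk]
    obtain rfl | ⟨c, rfl⟩ := c.eq_zero_or_wk
    · exact hdz
    · rw [Ctx.push_wk] at hc
      rw [Chan.cons_wk]
      exact h.ne hc

theorem Ctx.join_empty (Γ : Ctx N 0 0) : Γ.join Ctx.empty = Γ := by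
  funext a
  simp [Ctx.join, Ctx.empty]

theorem Ctx.join_single {Γ : Ctx N 0 0} {w : Name} (h : Γ w = none) (A : Ty N 0) :
    Γ.join (Ctx.empty.set w A) = Γ.set w A := by
  funext a
  rw [Ctx.set_apply, Ctx.join, Ctx.set_apply]
  split_ifs with ha
  · rw [ha, h]; rfl
  · simp [Ctx.empty]

theorem equalCtx_single {Sg : Sig N} {A B : Ty N 0} (h : Sg.Equal A B) (w : Name) :
    Sg.EqualCtx (Ctx.empty.set w A) (Ctx.empty.set w B) := by
  intro a
  simp only [Ctx.set_apply]
  split_ifs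
  · exact .some h
  · exact .none

theorem equalCtx_empty {Sg : Sig N} : Sg.EqualCtx Ctx.empty Ctx.empty := fun _ => .none

/-- Equal quantified types have equal instances, also by expressions that are not numerals. -/
theorem Sig.WF.equal_instance {Sg : Sig N} (hSg : Sg.WF) {A B : Ty N 1} {e : Exp 0}
    (he : 0 ≤ e.val)
    (h : ∀ i : ℕ, Sg.Equal (A.subst (single (.const i))) (B.subst (single (.const i)))) :
    Sg.Equal (A.subst (single e)) (B.subst (single e)) := by
  obtain ⟨n, hn⟩ := Int.eq_ofNat_of_zero_le he
  have key (A : Ty N 1) : Sg.Equal (A.subst (single e)) (A.subst (single (.const n))) := by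
    refine hSg.equal_subst A _ _ (Fin.cases ?_ fun i => i.elim0)
    simpa [single, val_const] using hn
  exact (key A).trans ((h n).trans (key B).symm)

/-- The substitution of a natural number in the premise of a rule that binds an index. -/
theorem Typed.subst_single {Sg : Sig N} (hSg : Sg.WF) {Γ : Ctx N 1 0} {q : Exp 0} {P : Proc N 1 0}
    {x : Name} {A : Ty N 1} (h : Typed Sg (Fml.top.subst shift) Γ (q.subst shift) P x A) {e : Exp 0}
    (he : 0 ≤ e.val) :
    Typed Sg .top (Γ.subst (single e)) q (P.subst (single e)) x (A.subst (single e)) := by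
  have hσ : Admissible (Fml.top.subst shift) .top (single e) :=
    ⟨Fin.cases (isNat_closed.2 he) fun i => i.elim0, fun _ _ => trivial⟩
  have := h.subst hSg hσ
  rwa [Exp.subst_subst, shift_comp_single, Exp.subst_var] at this

/-- A client that receives a payload continues with what the payload hands over. -/
theorem Reacts.typed_left {Sg : Sig N} (hSg : Sg.WF) {c c' d : Name} {R R' : Proc N 0 0}
    {u : Payload 0 0} (h : Reacts c c' R u R') {Γ : Ctx N 0 0} {p : Exp 0} {A D U A' : Ty N 0}
    (hR : Typed Sg .top Γ p R d D) (hcd : c ≠ d) (hx : Γ c = some A) {W : Ctx N 0 0} {m : ℕ}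
    (hE : Emits Sg true U u W m A') (hU : Sim Sg.Equal U (Sg.unfold A))
    (hW : ∀ a, W a = none ∨ Γ a = none) (hc' : Γ c' = none) (hWc' : W c' = none) (hc'd : c' ≠ d)
    (hΓd : Γ d = none) (hWd : W d = none) :
    ∃ A'' W' p', Sg.Equal A' A'' ∧ Sg.EqualCtx W W' ∧
      Typed Sg .top (((Γ.del c).set c' A'').join W') p' R' d D ∧ p'.val = p.val + m := by
  have hρ (B : Ty N 0) : Carries (Chan.repl c c') d (Γ.set c B) ((Γ.del c).set c' B) :=
    carries_repl_left hc' hc'd hcd hΓd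
  have hd : Chan.repl c c' d = d := repl_ne c' hcd
  cases h with
  | case l hl =>
    cases hR with
    | ampR => exact (hcd rfl).elim
    | plusL hx' hA hQ =>
      cases hx.symm.trans hx'
      rw [hA] at hU
      cases hU with
      | plus hF =>
        cases hE
        refine ⟨_, Ctx.empty, p, hF _, equalCtx_empty, ?_, by simp⟩
        have := (hQ ⟨l, hl⟩).rename (hρ _)
        rwa [hd, ← Ctx.join_empty ((Γ.del c).set c' _)] at this
  | @recv Q w =>
    cases hR with
    | lolliR => exact (hcd rfl).elim
    | @tensorL _ _ _ _ _ _ _ _ A₁ A₂ _ _ hx' hA hQ =>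
      cases hx.symm.trans hx'
      rw [hA] at hU
      cases hU with
      | tensor h₁ h₂ =>
        cases hE with
        | @tensor _ _ B _ hB =>
          have hwc' : w ≠ c' := fun he => by simp [Ctx.set_apply, he] at hWc'
          have hwd : w ≠ d := fun he => by simp [Ctx.set_apply, he] at hWd
          have hΓw : Γ w = none := (hW w).resolve_left (by simp [Ctx.set_apply])
          have hw : (Γ.del c).set c' A₂ w = none := by
            simp [Ctx.set_apply, Ctx.del_apply, hwc', hΓw]
          refine ⟨_, Ctx.empty.set w A₁, p, h₂, equalCtx_single (hB.trans h₁) w, ?_, by simp⟩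
          have := hQ.rename ((hρ A₂).instantiate hw (hd.symm ▸ hwd) A₁)
          rwa [Chan.cons_wk, hd, ← Ctx.join_single hw] at this
  | @recvIdx Q e =>
    cases hR with
    | allR => exact (hcd rfl).elim
    | exL hx' hA hQ =>
      cases hx.symm.trans hx'
      rw [hA] at hU
      cases hU with
      | ex hF =>
        cases hE with
        | ex he =>
          refine ⟨_, Ctx.empty, p, hSg.equal_instance he hF, equalCtx_empty, ?_, by simp⟩
          have := hQ.subst_single hSg he
          rw [Ctx.subst_set, Ctx.wkIdx_subst_single, Ty.subst_subst, Ty.subst_closed] at this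
          have := this.rename (hρ _)
          rwa [hd, ← Ctx.join_empty ((Γ.del c).set c' _)] at this
  | @assume Q φ ψ =>
    cases hR with
    | assumeR => exact (hcd rfl).elim
    | assertL hx' hA hφ hQ =>
      cases hx.symm.trans hx'
      rw [hA] at hU
      cases hU with
      | assert hF =>
        cases hE with
        | assert h₁ h₂ =>
          -- The sender has shown the proposition of its own type, so both propositions hold.
          obtain ⟨-, h₃, h₄⟩ := hF.resolve_right fun h => not_entails_not h₂ h.1
          refine ⟨_, Ctx.empty, p, h₄, equalCtx_empty, ?_, by simp⟩
          have := (hQ.strengthen hSg fun ρ hρ =>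
            ⟨trivial, hφ ρ ⟨trivial, h₃ ρ hρ⟩⟩).rename (hρ _)
          rwa [hd, ← Ctx.join_empty ((Γ.del c).set c' _)] at this
  | @get Q r s hrs =>
    cases hR with
    | getR => exact (hcd rfl).elim
    | payL hx' hA he hQ =>
      cases hx.symm.trans hx'
      rw [hA] at hU
      cases hU with
      | pay h₁ h₂ =>
        cases hE with
        | pay h₃ h₄ =>
          refine ⟨_, Ctx.empty, .add p s, h₂, equalCtx_empty, ?_, ?_⟩
          · have := hQ.rename (hρ _)
            rw [hd, ← Ctx.join_empty ((Γ.del c).set c' _)] at this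
            exact this
          · rw [val_add]; omega

/-- A provider that receives a payload continues with what the payload hands over. -/
theorem Reacts.typed_right {Sg : Sig N} (hSg : Sg.WF) {c c' : Name} {R R' : Proc N 0 0}
    {u : Payload 0 0} (h : Reacts c c' R u R') {Γ : Ctx N 0 0} {p : Exp 0} {A U A' : Ty N 0}
    (hR : Typed Sg .top Γ p R c A) (hc : Γ c = none) {W : Ctx N 0 0} {m : ℕ}
    (hE : Emits Sg false U u W m A') (hU : Sim Sg.Equal U (Sg.unfold A))
    (hW : ∀ a, W a = none ∨ Γ a = none) (hc' : Γ c' = none) (hWc' : W c' = none) :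
    ∃ A'' W' p', Sg.Equal A' A'' ∧ Sg.EqualCtx W W' ∧
      Typed Sg .top (Γ.join W') p' R' c' A'' ∧ p'.val = p.val + m := by
  have hρ : Carries (Chan.repl c c') c Γ Γ := carries_repl_right hc hc'
  have hd : Chan.repl c c' c = c' := repl_self c c'
  cases h with
  | case l hl =>
    cases hR with
    | plusL hx => simp [hc] at hx
    | ampR hA hQ =>
      rw [hA] at hU
      cases hU with
      | amp hF =>
        cases hE
        refine ⟨_, Ctx.empty, p, hF _, equalCtx_empty, ?_, by simp⟩
        have := (hQ ⟨l, hl⟩).rename hρ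
        rwa [hd, ← Ctx.join_empty Γ] at this
  | @recv Q w =>
    cases hR with
    | tensorL hx => simp [hc] at hx
    | @lolliR _ _ _ _ _ _ _ A₁ A₂ _ hA hQ =>
      rw [hA] at hU
      cases hU with
      | lolli h₁ h₂ =>
        cases hE with
        | @lolli _ _ B _ hB =>
          have hwc' : w ≠ c' := fun he => by simp [Ctx.set_apply, he] at hWc'
          have hΓw : Γ w = none := (hW w).resolve_left (by simp [Ctx.set_apply])
          refine ⟨_, Ctx.empty.set w A₁, p, h₂, equalCtx_single (hB.trans h₁) w, ?_, by simp⟩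
          have := hQ.rename (hρ.instantiate hΓw (hd.symm ▸ hwc') A₁)
          rwa [Chan.cons_wk, hd, ← Ctx.join_single hΓw] at this
  | @recvIdx Q e =>
    cases hR with
    | exL hx => simp [hc] at hx
    | allR hA hQ =>
      rw [hA] at hU
      cases hU with
      | all hF =>
        cases hE with
        | all he =>
          refine ⟨_, Ctx.empty, p, hSg.equal_instance he hF, equalCtx_empty, ?_, by simp⟩
          have := hQ.subst_single hSg he
          rw [Ctx.wkIdx_subst_single] at this
          have := this.rename hρ
          rwa [hd, ← Ctx.join_empty Γ] at this
  | @assume Q φ ψ =>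
    cases hR with
    | assertL hx => simp [hc] at hx
    | assumeR hA hφ hQ =>
      rw [hA] at hU
      cases hU with
      | assume hF =>
        cases hE with
        | assume h₁ h₂ =>
          -- The sender has shown the proposition of its own type, so both propositions hold.
          obtain ⟨-, h₃, h₄⟩ := hF.resolve_right fun h => not_entails_not h₂ h.1
          refine ⟨_, Ctx.empty, p, h₄, equalCtx_empty, ?_, by simp⟩
          have := (hQ.strengthen hSg fun ρ hρ =>
            ⟨trivial, hφ ρ ⟨trivial, h₃ ρ hρ⟩⟩).rename hρ
          rwa [hd, ← Ctx.join_empty Γ] at this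
  | @get Q r s hrs =>
    cases hR with
    | payL hx => simp [hc] at hx
    | getR hA he hQ =>
      rw [hA] at hU
      cases hU with
      | get h₁ h₂ =>
        cases hE with
        | get h₃ h₄ =>
          refine ⟨_, Ctx.empty, .add p s, h₂, equalCtx_empty, ?_, ?_⟩
          · have := hQ.rename hρ
            rw [hd, ← Ctx.join_empty Γ] at this
            exact this
          · rw [val_add]; omega

/-! ### Cutting two objects into one -/

/-- Whenever `o₁` provides a channel to `o₂`, the object `o` can take the place of both. -/
def CutsTo (Sg : Sig N) (o₁ o₂ o : Obj N) : Prop :=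
  o.chan = o₂.chan ∧ (∀ Γ n A, ObjTyped Sg o₂ Γ n A → Γ o₁.chan ≠ none) ∧
    ∀ Γ₁ n₁ A₁ Γ₂ n₂ A₂, ObjTyped Sg o₁ Γ₁ n₁ A₁ → ObjTyped Sg o₂ Γ₂ n₂ A₂ →
      (∀ a, Γ₁ a = none ∨ Γ₂ a = none) → (∀ B, Γ₂ o₁.chan = some B → Sg.Equal A₁ B) →
      Γ₁ o₂.chan = none →
      ∃ Γ A, ObjTyped Sg o Γ (n₁ + n₂) A ∧ Sg.Equal A₂ A ∧ Cut Sg Γ₁ o₁.chan A₁ Γ₂ Γ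

theorem Ctx.set_eq_none {Γ : Ctx N 0 0} {x a : Name} {A : Ty N 0} :
    Γ.set x A a = none ↔ a ≠ x ∧ Γ a = none := by
  rw [Ctx.set_apply]
  split_ifs with h <;> simp [h]

theorem Ctx.join_eq_none {Γ W : Ctx N 0 0} {a : Name} :
    Γ.join W a = none ↔ Γ a = none ∧ W a = none := by
  simp [Ctx.join, Option.or_eq_none_iff]

theorem Ctx.del_eq_none {Γ : Ctx N 0 0} {x a : Name} (h : Γ a = none) : Γ.del x a = none := by
  rw [Ctx.del_apply, h, ite_self]

theorem Sig.WF.rel_refl {Sg : Sig N} (hSg : Sg.WF) (a : Option (Ty N 0)) :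
    Option.Rel Sg.Equal a a := by
  cases a with
  | none => exact .none
  | some A => exact .some (hSg.equal_refl A)

theorem Reacts.uses {Sg : Sig N} {c c' d : Name} {R R' : Proc N 0 0} {u : Payload 0 0}
    (h : Reacts c c' R u R') {Γ : Ctx N 0 0} {p : Exp 0} {D : Ty N 0}
    (hR : Typed Sg .top Γ p R d D) (hcd : c ≠ d) : Γ c ≠ none := by
  cases h <;> cases hR <;> first | exact (hcd rfl).elim | simp [*]

/-- A client receives from its provider. -/
theorem cutsTo_left {Sg : Sig N} (hSg : Sg.WF) {c c' d : Name} {R R' : Proc N 0 0}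
    {u : Payload 0 0} (h : Reacts c c' R u R') (hcd : c ≠ d) (w w' : ℕ) :
    CutsTo Sg (.msg c w' (.send c u (.fwd c c'))) (.proc d w R) (.proc d (w + w') R') := by
  have huse (Γ : Ctx N 0 0) (n : ℕ) (A : Ty N 0) (ho : ObjTyped Sg (.proc d w R) Γ n A) :
      Γ c ≠ none := by
    cases ho with
    | proc hR => exact h.uses hR hcd
  refine ⟨rfl, huse, ?_⟩
  intro Γ₁ n₁ A₁ Γ₂ n₂ A₂ ho₁ ho₂ hd hl hd₁
  obtain ⟨A₀, hA₀⟩ := Option.ne_none_iff_exists'.1 (huse _ _ _ ho₂)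
  have hAA := hl _ hA₀
  cases ho₁ with
  | msg hM hP hp hc hn₁ =>
  cases ho₂ with
  | proc hR hp₂ hd₂ hn₂ =>
  obtain ⟨W, m, A', B, hE, rfl, hWc', hB, hpm⟩ := hP.message_right_inv hc (by omega)
  obtain ⟨hcc', hWc⟩ := Ctx.set_eq_none.1 hc
  obtain ⟨hdc', hWd⟩ := Ctx.set_eq_none.1 hd₁
  have hW (a : Name) : W a = none ∨ Γ₂ a = none := (hd a).imp_left fun h => (Ctx.set_eq_none.1 h).2
  have hc' : Γ₂ c' = none := (hd c').resolve_left (by simp [Ctx.set_apply])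
  obtain ⟨A'', W', p', hA'', hWW, hR', hp'⟩ := h.typed_left hSg hR hcd hA₀ hE hAA.sim hW hc' hWc'
    (Ne.symm hdc') hd₂ hWd
  refine ⟨_, _, .proc hR' (n := (n₁ - w') + (n₂ - w)) (by omega) ?_ (by omega),
    hSg.equal_refl _, hd, ⟨A₀, hA₀, hAA⟩, hc, ?_, ?_⟩
  · exact Ctx.join_eq_none.2 ⟨Ctx.set_eq_none.2 ⟨hdc', Ctx.del_eq_none hd₂⟩, hWW.eq_none hWd⟩
  · exact Ctx.join_eq_none.2 ⟨Ctx.set_eq_none.2 ⟨hcc', by simp [Ctx.del_apply, Obj.chan]⟩,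
      hWW.eq_none hWc⟩
  · intro a ha
    change a ≠ c at ha
    rw [Ctx.join, Ctx.set_apply, Ctx.set_apply, Ctx.del_apply, if_neg ha]
    split_ifs with hac'
    · exact .some (hB.trans hA'')
    · rcases hW a with h | h
      · rw [h, hWW.eq_none h, Option.or_none, Option.none_or]
        exact hSg.rel_refl _
      · rw [h, Option.none_or, Option.or_none]
        exact hWW a

/-- A provider receives from its client. -/
theorem cutsTo_right {Sg : Sig N} (hSg : Sg.WF) {c c' : Name} {R R' : Proc N 0 0}
    {u : Payload 0 0} (h : Reacts c c' R u R') (hcc' : c ≠ c') (w w' : ℕ) :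
    CutsTo Sg (.proc c w R) (.msg c' w' (.send c u (.fwd c' c))) (.proc c' (w + w') R') := by
  refine ⟨rfl, ?_, ?_⟩
  · intro Γ n A ho
    cases ho with
    | msg hM hP hp hc hn =>
      obtain ⟨W, m, A', A₀, hE, rfl, -⟩ := hP.message_left_inv hcc'.symm (by omega)
      simp [Obj.chan, Ctx.set_apply]
  intro Γ₁ n₁ A₁ Γ₂ n₂ A₂ ho₁ ho₂ hd hl hc₁
  cases ho₁ with
  | proc hR hp₁ hc hn₁ =>
  cases ho₂ with
  | msg hM hP hp₂ hc₂ hn₂ =>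
  obtain ⟨W, m, A', A₀, hE, rfl, hWc, hA', hpm⟩ := hP.message_left_inv hcc'.symm (by omega)
  obtain ⟨-, hWc'⟩ := Ctx.set_eq_none.1 hc₂
  have hA₀ : W.set c A₀ c = some A₀ := by simp [Ctx.set_apply]
  have hW (a : Name) : W a = none ∨ Γ₁ a = none :=
    (hd a).symm.imp_left fun h => (Ctx.set_eq_none.1 h).2
  obtain ⟨A'', W', p', hA'', hWW, hR', hp'⟩ := h.typed_right hSg hR hc hE (hl _ hA₀).symm.sim hW
    hc₁ hWc'
  refine ⟨_, _, .proc hR' (n := (n₁ - w) + (n₂ - w')) (by omega) ?_ (by omega),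
    hA'.symm.trans hA'', hd, ⟨A₀, hA₀, hl _ hA₀⟩, hc, ?_, ?_⟩
  · exact Ctx.join_eq_none.2 ⟨hc₁, hWW.eq_none hWc'⟩
  · exact Ctx.join_eq_none.2 ⟨hc, hWW.eq_none hWc⟩
  · intro a ha
    change a ≠ c at ha
    rw [Ctx.join, Ctx.set_apply, if_neg ha]
    rcases hW a with h | h
    · rw [h, hWW.eq_none h]
      exact hSg.rel_refl _
    · rw [h, Option.none_or, Option.none_or]
      exact hWW a

/-- A client waits for its provider to close. -/
theorem cutsTo_close {Sg : Sig N} (hSg : Sg.WF) {c d : Name} (Q : Proc N 0 0)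
    (w w' : ℕ) :
    CutsTo Sg (.msg c w' (.close c)) (.proc d w (.wait c Q)) (.proc d (w + w') Q) := by
  refine ⟨rfl, ?_, ?_⟩
  · intro Γ n A ho
    cases ho with
    | proc hR => cases hR with | oneL hx => simp [Obj.chan, hx]
  intro Γ₁ n₁ A₁ Γ₂ n₂ A₂ ho₁ ho₂ hd hl hd₁
  cases ho₁ with
  | msg hM hP hp₁ hc hn₁ =>
  cases ho₂ with
  | proc hR hp₂ hd₂ hn₂ =>
  cases hP with
  | oneR hA hq =>
  have hq := entails_eq_closed.1 hq
  rw [val_const] at hq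
  cases hR with
  | oneL hx hA hQ =>
  refine ⟨_, _, .proc hQ (n := n₂ - w) (by omega) (Ctx.del_eq_none hd₂) (by omega),
    hSg.equal_refl _, hd, ⟨_, hx, hl _ hx⟩, hc, ?_, ?_⟩
  · simp [Obj.chan, Ctx.del_apply]
  · intro a ha
    change a ≠ c at ha
    rw [Ctx.del_apply, if_neg ha]
    exact hSg.rel_refl _

theorem IsMsg.rename {c : Name} {M : Proc N 0 0} (h : IsMsg c M) (ρ : Name → Name) :
    IsMsg (ρ c) (M.rename ρ) := by
  cases h with
  | pos => exact .pos _ _ _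
  | neg => exact .neg _ _ _
  | close => exact .close _

/-- A forwarding process passes on a message of its provider. -/
theorem cutsTo_fwd_pos {Sg : Sig N} (hSg : Sg.WF) {c d : Name} (M : Proc N 0 0) (w w' : ℕ) :
    CutsTo Sg (.msg d w M) (.proc c w' (.fwd c d))
      (.msg c (w + w') (M.rename (Chan.repl d c))) := by
  refine ⟨rfl, ?_, ?_⟩
  · intro Γ n A ho
    cases ho with
    | proc hR =>
      obtain ⟨-, B, rfl, -⟩ := hR.fwd_inv
      simp [Obj.chan, Ctx.set_apply]
  intro Γ₁ n₁ A₁ Γ₂ n₂ A₂ ho₁ ho₂ hd hl hc₁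
  cases ho₁ with
  | msg hM hP hp₁ hd₁ hn₁ =>
  cases ho₂ with
  | proc hR hp₂ hc₂ hn₂ =>
  obtain ⟨-, B, rfl, hp₀, hB⟩ := hR.fwd_inv
  have hB' : Ctx.empty.set d B d = some B := by simp [Ctx.set_apply]
  have hAB := hl _ hB'
  have hM' := hM.rename (Chan.repl d c)
  have hP' := hP.rename (carries_repl_right hd₁ hc₁)
  rw [repl_self] at hM' hP'
  change Γ₁ c = none at hc₁
  refine ⟨_, _, .msg hM' hP' (n := n₁ - w) (by omega) hc₁ (by omega),
    hB.symm.trans hAB.symm, hd, ⟨B, hB', hAB⟩, hd₁, hd₁, ?_⟩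
  intro a ha
  change a ≠ d at ha
  rw [Ctx.set_apply, if_neg ha, Ctx.empty, Option.or_none]
  exact hSg.rel_refl _

/-- The free channels of a process are those of its context and the one it provides. -/
theorem Typed.mentions {Sg : Sig N} {k m : ℕ} {C : Fml k} {Γ : Ctx N k m} {q : Exp k}
    {P : Proc N k m} {x : Chan m} {A : Ty N k} (h : Typed Sg C Γ q P x A) :
    ∀ {c : Chan m}, P.Mentions c → Γ c ≠ none ∨ c = x := by
  have hset {k m : ℕ} {Γ : Ctx N k m} {x c : Chan m} {A B : Ty N k} (hx : Γ x = some A)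
      (hc : Γ.set x B c ≠ none) : Γ c ≠ none := by
    rw [Ctx.set_apply] at hc
    split_ifs at hc with h
    · simp [h, hx]
    · exact hc
  have hdel {k m : ℕ} {Γ : Ctx N k m} {x c : Chan m} (hc : Γ.del x c ≠ none) : Γ c ≠ none := by
    rw [Ctx.del_apply] at hc
    split_ifs at hc with h
    · exact (hc rfl).elim
    · exact hc
  have hwk {k m : ℕ} {Γ : Ctx N k m} {c : Chan m} (hc : Γ.wkIdx c ≠ none) : Γ c ≠ none := by
    simpa [Ctx.wkIdx] using hc
  induction h with
  | id =>
    rintro c (rfl | rfl)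
    · exact .inr rfl
    · simp [Ctx.set_apply]
  | spawn B he hr hy hB hBB hQ ih =>
    rintro c (⟨i, rfl⟩ | hc)
    · simp [hB]
    · refine (ih hc).imp (fun h => ?_) fun h => Chan.wk_injective h
      rw [Ctx.push_wk, Ctx.delAll] at h
      split_ifs at h
      · exact (h rfl).elim
      · exact h
  | plusR _ _ ih | exR _ _ _ ih | assertR _ _ _ _ ih | payR _ _ _ _ _ ih =>
    rintro c (rfl | hc | hc)
    · exact .inr rfl
    · cases hc
    · exact ih hc
  | plusL hx _ _ ih =>
    rintro c (rfl | ⟨l, hc⟩)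
    · simp [hx]
    · exact (ih l hc).imp_left (hset hx)
  | ampR _ _ ih =>
    rintro c (rfl | ⟨l, hc⟩)
    · exact .inr rfl
    · exact ih l hc
  | ampL hx _ _ ih | allL hx _ _ _ ih | assumeL hx _ _ _ _ ih | getL hx _ _ _ _ _ ih =>
    rintro c (rfl | hc | hc)
    · simp [hx]
    · cases hc
    · exact (ih hc).imp_left (hset hx)
  | lolliR _ _ ih =>
    rintro c (rfl | hc)
    · exact .inr rfl
    · exact (ih hc).imp (fun h => by rwa [Ctx.push_wk] at h) fun h => Chan.wk_injective h
  | lolliL hx _ hwx hw _ _ ih =>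
    rintro c (rfl | hc | hc)
    · simp [hx]
    · cases hc
      simp [hw]
    · refine (ih hc).imp_left fun h => ?_
      rw [Ctx.set_apply] at h
      split_ifs at h with he
      · simp [he, hx]
      · exact hdel h
  | tensorR _ hw _ _ ih =>
    rintro c (rfl | hc | hc)
    · exact .inr rfl
    · cases hc
      simp [hw]
    · exact (ih hc).imp_left hdel
  | tensorL hx _ _ ih =>
    rintro c (rfl | hc)
    · simp [hx]
    · refine (ih hc).imp (fun h => ?_) fun h => Chan.wk_injective h
      rw [Ctx.push_wk] at h
      exact hset hx h
  | oneR => exact fun hc => .inr hc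
  | oneL hx _ _ ih =>
    rintro c (rfl | hc)
    · simp [hx]
    · exact (ih hc).imp_left hdel
  | exL hx _ _ ih =>
    rintro c (rfl | hc)
    · simp [hx]
    · exact (ih hc).imp_left fun h =>
        hwk (hset (A := _) (by rw [Ctx.wkIdx, hx]; rfl) h)
  | allR _ _ ih =>
    rintro c (rfl | hc)
    · exact .inr rfl
    · exact (ih hc).imp_left hwk
  | assertL hx _ _ _ ih | payL hx _ _ _ ih =>
    rintro c (rfl | hc)
    · simp [hx]
    · exact (ih hc).imp_left (hset hx)
  | assumeR _ _ _ ih | getR _ _ _ ih =>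
    rintro c (rfl | hc)
    · exact .inr rfl
    · exact ih hc
  | work _ _ _ ih => exact ih
  | unsat => exact fun hc => hc.elim

/-- A forwarding process passes on a message of its client; the client uses the forwarded channel
because it mentions it. -/
theorem cutsTo_fwd_neg {Sg : Sig N} (hSg : Sg.WF) {c d e : Name} {M : Proc N 0 0}
    (hMc : M.Mentions c) (hce : c ≠ e) (w w' : ℕ) :
    CutsTo Sg (.proc c w (.fwd c d)) (.msg e w' M)
      (.msg e (w + w') (M.rename (Chan.repl c d))) := by
  have huse (Γ : Ctx N 0 0) (n : ℕ) (A : Ty N 0) (ho : ObjTyped Sg (.msg e w' M) Γ n A) :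
      Γ c ≠ none := by
    cases ho with
    | msg _ hP => exact (hP.mentions hMc).resolve_right hce
  refine ⟨rfl, huse, ?_⟩
  intro Γ₁ n₁ A₁ Γ₂ n₂ A₂ ho₁ ho₂ hd hl he₁
  obtain ⟨A₀, hA₀⟩ := Option.ne_none_iff_exists'.1 (huse _ _ _ ho₂)
  have hAA := hl _ hA₀
  cases ho₁ with
  | proc hR hp₁ hc₁ hn₁ =>
  cases ho₂ with
  | msg hM hP hp₂ he₂ hn₂ =>
  obtain ⟨-, B, rfl, hp₀, hB⟩ := hR.fwd_inv
  have hde : d ≠ e := Ne.symm (Ctx.set_eq_none.1 he₁).1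
  have hcd : c ≠ d := (Ctx.set_eq_none.1 hc₁).1
  have hd₂ : Γ₂ d = none := (hd d).resolve_left (by simp [Ctx.set_apply])
  have hΓ₂ : Γ₂.set c A₀ = Γ₂ := by
    funext a
    rw [Ctx.set_apply]
    split_ifs with h
    · rw [h, hA₀]
    · rfl
  have hM' := hM.rename (Chan.repl c d)
  have hP' := (hΓ₂.symm ▸ hP : Typed Sg .top (Γ₂.set c A₀) _ _ _ _).rename
    (carries_repl_left hd₂ hde hce he₂)
  rw [repl_ne _ hce] at hM' hP'
  refine ⟨_, _, .msg hM' hP' (n := n₂ - w') (by omega)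
    (Ctx.set_eq_none.2 ⟨hde.symm, Ctx.del_eq_none he₂⟩) (by omega),
    hSg.equal_refl _, hd, ⟨A₀, hA₀, hAA⟩, hc₁, Ctx.set_eq_none.2 ⟨hcd, ?_⟩, ?_⟩
  · simp [Obj.chan, Ctx.del_apply]
  · intro a ha
    change a ≠ c at ha
    rw [Ctx.set_apply, Ctx.set_apply, Ctx.del_apply, if_neg ha]
    split_ifs
    · exact .some (hB.trans hAA)
    · exact hSg.rel_refl _

/-! ### Splitting an object into two -/

/-- Whenever the channel of `o₁` is fresh, the objects `o₁` and `o₂`, the first of which provides a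
channel to the second, can take the place of `o`. -/
def SplitsInto (Sg : Sig N) (o o₁ o₂ : Obj N) : Prop :=
  o₂.chan = o.chan ∧ ∀ Γ n A, ObjTyped Sg o Γ n A → Γ o₁.chan = none →
    ∃ Γ₁ n₁ A₁ Γ₂ n₂, ObjTyped Sg o₁ Γ₁ n₁ A₁ ∧ ObjTyped Sg o₂ Γ₂ n₂ A ∧ n = n₁ + n₂ ∧
      Cut Sg Γ₁ o₁.chan A₁ Γ₂ Γ

theorem Ctx.Sub.eq_none {W Γ : Ctx N 0 0} (h : W.Sub Γ) {a : Name} (ha : Γ a = none) :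
    W a = none := by
  by_contra hW
  obtain ⟨B, hB⟩ := Option.ne_none_iff_exists'.1 hW
  simp [h a B hB] at ha

theorem Ctx.minus_eq_none {Γ W : Ctx N 0 0} {a : Name} (ha : Γ a = none) :
    Γ.minus W a = none := by
  rw [Ctx.minus, ha, ite_self]

theorem Ctx.minus_disj (Γ W : Ctx N 0 0) (a : Name) : Γ.minus W a = none ∨ W a = none := by
  rw [Ctx.minus]
  split_ifs with h
  · exact .inl rfl
  · exact .inr (by simpa using h)

theorem Ctx.minus_or {Γ W : Ctx N 0 0} (h : W.Sub Γ) (a : Name) :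
    (Γ.minus W a).or (W a) = Γ a := by
  rw [Ctx.minus]
  cases hW : W a with
  | none => simp
  | some B => simp [h a B hW]

/-- A provider sends. -/
theorem splitsInto_send_right {Sg : Sig N} (hSg : Sg.WF) {c c' : Name} (hcc' : c' ≠ c)
    (u : Payload 0 0) (P : Proc N 0 0) (w : ℕ) :
    SplitsInto Sg (.proc c w (.send c u P)) (.proc c' w (P.rename (Chan.repl c c')))
      (.msg c 0 (.send c u (.fwd c c'))) := by
  refine ⟨rfl, fun Γ n A ho hc' => ?_⟩
  change Γ c' = none at hc'
  cases ho with
  | proc hP hp hc hn =>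
  obtain ⟨W, m, A', p', hE, hW, hP', hpp, hp'⟩ := hP.send_right_inv hc (by omega)
  obtain ⟨n', hn'⟩ := Int.eq_ofNat_of_zero_le hp'
  obtain ⟨p₂, hp₂, hM⟩ := hE.typed_right hSg c (hW.eq_none hc')
  have hP'' := hP'.rename (carries_repl_right (Ctx.minus_eq_none hc) (Ctx.minus_eq_none hc'))
  rw [repl_self] at hP''
  refine ⟨_, _, _, _, _, .proc hP'' hn' (Ctx.minus_eq_none hc') rfl,
    .msg (.pos _ _ _) hM hp₂ (Ctx.set_eq_none.2 ⟨hcc'.symm, hW.eq_none hc⟩) rfl, by omega, ?_⟩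
  refine ⟨fun a => ?_, ⟨A', by simp [Ctx.set_apply, Obj.chan], hSg.equal_refl _⟩,
    Ctx.minus_eq_none hc', hc', fun a ha => ?_⟩
  · by_cases hac' : a = c'
    · exact .inl (hac' ▸ Ctx.minus_eq_none hc')
    · exact (Ctx.minus_disj Γ W a).imp_right fun h => Ctx.set_eq_none.2 ⟨hac', h⟩
  · change a ≠ c' at ha
    rw [Ctx.set_apply, if_neg ha, Ctx.minus_or hW]
    exact hSg.rel_refl _

/-- A client sends. -/
theorem splitsInto_send_left {Sg : Sig N} (hSg : Sg.WF) {c c' d : Name} (hdc : d ≠ c)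
    (hc'd : c' ≠ d) (u : Payload 0 0) (Q : Proc N 0 0) (w : ℕ) :
    SplitsInto Sg (.proc d w (.send c u Q)) (.msg c' 0 (.send c u (.fwd c' c)))
      (.proc d w (Q.rename (Chan.repl c c'))) := by
  refine ⟨rfl, fun Γ n A ho hc' => ?_⟩
  change Γ c' = none at hc'
  cases ho with
  | proc hP hp hd hn =>
  obtain ⟨A₀, W, m, A', p', hx, hE, hW, hWc, hQ, hpp, hp'⟩ := hP.send_left_inv hdc (by omega)
  obtain ⟨n', hn'⟩ := Int.eq_ofNat_of_zero_le hp'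
  obtain ⟨p₁, hp₁, hM⟩ := hE.typed_left hSg c' hWc
  have hQ' := hQ.rename (carries_repl_left (Ctx.minus_eq_none hc') hc'd hdc.symm
    (Ctx.minus_eq_none hd))
  rw [repl_ne _ hdc.symm] at hQ'
  have hc'c : c' ≠ c := fun he => by simp [he, hx] at hc'
  refine ⟨_, _, _, _, _, .msg (.neg _ _ _) hM hp₁ (Ctx.set_eq_none.2 ⟨hc'c, hW.eq_none hc'⟩) rfl,
    .proc hQ' hn' (Ctx.set_eq_none.2
      ⟨hc'd.symm, Ctx.del_eq_none (Ctx.minus_eq_none hd)⟩) rfl, by omega, ?_⟩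
  refine ⟨fun a => ?_, ⟨A', by simp [Ctx.set_apply, Obj.chan], hSg.equal_refl _⟩,
    Ctx.set_eq_none.2 ⟨hc'c, hW.eq_none hc'⟩, hc', fun a ha => ?_⟩
  · by_cases hac' : a = c'
    · exact .inl (hac' ▸ Ctx.set_eq_none.2 ⟨hc'c, hW.eq_none hc'⟩)
    · by_cases hac : a = c
      · exact .inr (Ctx.set_eq_none.2 ⟨hac', by rw [Ctx.del_apply, if_pos hac]⟩)
      · exact (Ctx.minus_disj Γ W a).symm.imp (fun h => Ctx.set_eq_none.2 ⟨hac, h⟩)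
          fun h => Ctx.set_eq_none.2 ⟨hac', Ctx.del_eq_none h⟩
  · change a ≠ c' at ha
    rw [Ctx.set_apply, Ctx.set_apply, if_neg ha, Ctx.del_apply]
    split_ifs with hac
    · rw [hac, hx]
      exact .some (hSg.equal_refl _)
    · rw [← Ctx.minus_or hW a]
      rcases Ctx.minus_disj Γ W a with h | h <;> rw [h] <;>
        simp only [Option.or_none, Option.none_or] <;> exact hSg.rel_refl _

/-- The renaming of the body of a process definition at a call. -/
theorem carries_body {n : ℕ} {Γ : Ctx N 0 (n + 1)} {y : Fin n → Name} {a : Name}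
    {B : Fin n → Ty N 0} (hΓ : ∀ i, Γ (.var (Fin.succ i)) = some (B i)) (h0 : Γ (.var 0) = none)
    (hname : ∀ b, Γ (.name b) = none) (hy : Function.Injective y) (ha : ∀ i, y i ≠ a)
    {Γ' : Ctx N 0 0} (hΓ' : ∀ i, Γ' (y i) = some (B i)) (hΓ'' : ∀ b, (∀ i, y i ≠ b) → Γ' b = none) :
    Carries (Chan.cons a (fun b => match b with | .var i => y i | .name b => .name b)) (.var 0)
      Γ Γ' := by
  have hdom (c : Chan (n + 1)) (hc : Γ c ≠ none) : ∃ i : Fin n, c = .var i.succ := by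
    cases c with
    | name b => exact (hc (hname b)).elim
    | var i =>
      obtain rfl | ⟨j, rfl⟩ := Fin.eq_zero_or_eq_succ i
      · exact (hc h0).elim
      · exact ⟨j, rfl⟩
  refine ⟨fun {c} A hA => ?_, fun {b} hb => ?_, fun {c d} hc hd he => ?_, fun {c} hc => ?_⟩
  · obtain ⟨i, rfl⟩ := hdom c (by simp [hA])
    rw [hΓ] at hA
    exact (hΓ' i).trans hA
  · by_contra hn
    refine hb (hΓ'' b fun i hi => hn ⟨.var i.succ, by simp [hΓ], hi⟩)
  · obtain ⟨i, rfl⟩ := hdom c hc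
    obtain ⟨j, rfl⟩ := hdom d hd
    rw [hy (show y i = y j from he)]
  · obtain ⟨i, rfl⟩ := hdom c hc
    exact ha i

/-- A process calls another one. -/
theorem splitsInto_spawn {Sg : Sig N} (hSg : Sg.WF) {a c : Name} (hac : a ≠ c) (w : ℕ)
    (f : N.PName) (e : Fin (N.pIdx f) → Exp 0) (y : Fin (N.pChan f) → Name) (Q : Proc N 0 1) :
    SplitsInto Sg (.proc c w (.spawn f e y Q))
      (.proc a 0 (((Sg.pbody f).subst e).rename
        (Chan.cons a (fun b => match b with | .var i => y i | .name b => .name b))))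
      (.proc c w (Q.rename (Chan.cons a (fun b => b)))) := by
  classical
  refine ⟨rfl, fun Γ n A ho ha => ?_⟩
  change Γ a = none at ha
  cases ho with
  | proc hP hp hc hn =>
  cases hP with
  | spawn B he hr hy hB hBB hQ =>
  have hσ : Admissible .top .top e := ⟨he, fun _ _ => trivial⟩
  have hr := entails_ge_closed.1 hr
  have hpot := isNat_closed.1 (hσ.subst (hSg.potential f) : IsNat .top ((Sg.ppot f).subst e))
  obtain ⟨n₁, hn₁⟩ := Int.eq_ofNat_of_zero_le hpot
  have hya (i : Fin (N.pChan f)) : y i ≠ a := fun h => by simpa [h, ha] using hB i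
  have hyc (i : Fin (N.pChan f)) : y i ≠ c := fun h => by simpa [h, hc] using hB i
  set Γ₁ : Ctx N 0 0 := fun b => if h : ∃ i, y i = b then some ((Sg.parg f h.choose).subst e)
    else none with hΓ₁
  have hΓ₁y (i : Fin (N.pChan f)) : Γ₁ (y i) = some ((Sg.parg f i).subst e) := by
    have h : ∃ j, y j = y i := ⟨i, rfl⟩
    rw [hΓ₁]
    simp only [dif_pos h]
    rw [hy h.choose_spec]
  have hΓ₁n (b : Name) (h : ∀ i, y i ≠ b) : Γ₁ b = none := by
    rw [hΓ₁]
    exact dif_neg fun ⟨i, hi⟩ => h i hi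
  have hbody := ((hSg.typed f).subst hSg hσ).rename
    (carries_body (B := fun i => (Sg.parg f i).subst e) (fun i => rfl) rfl (fun b => rfl) hy hya
      hΓ₁y hΓ₁n)
  have hdel {b : Name} (h : Γ b = none) : Γ.delAll y b = none := by
    rw [Ctx.delAll, h, ite_self]
  have hid : Carries (fun b : Name => b) c (Γ.delAll y) (Γ.delAll y) :=
    ⟨id, fun {b} hb => ⟨b, hb, rfl⟩, fun _ _ => id, fun hb h => hb (h ▸ hdel hc)⟩
  have hQ' := hQ.rename (hid.instantiate (hdel ha) hac _)
  rw [Chan.cons_wk] at hQ'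
  obtain ⟨n₂, hn₂⟩ := Int.eq_ofNat_of_zero_le
    (a := (Exp.sub _ ((Sg.ppot f).subst e)).val) (by rw [val_sub]; exact sub_nonneg.2 hr)
  refine ⟨Γ₁, n₁, _, _, n₂ + w, .proc hbody hn₁ (hΓ₁n a hya) rfl,
    .proc hQ' hn₂ (Ctx.set_eq_none.2 ⟨hac.symm, hdel hc⟩) rfl, ?_, ?_⟩
  · rw [val_sub] at hn₂
    omega
  refine ⟨fun b => ?_, ⟨_, by simp [Ctx.set_apply, Obj.chan], hSg.equal_refl _⟩, hΓ₁n a hya, ha,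
    fun b hb => ?_⟩
  · by_cases hb : ∃ i, y i = b
    · obtain ⟨i, rfl⟩ := hb
      refine .inr (Ctx.set_eq_none.2 ⟨hya i, ?_⟩)
      rw [Ctx.delAll, if_pos ⟨i, rfl⟩]
    · exact .inl (hΓ₁n b fun i hi => hb ⟨i, hi⟩)
  · change b ≠ a at hb
    rw [Ctx.set_apply, if_neg hb, Ctx.delAll]
    split_ifs with h
    · obtain ⟨i, rfl⟩ := h
      rw [hΓ₁y, hB]
      exact .some (Sig.equalUnder_closed.1 (hBB i)).symm
    · rw [hΓ₁n b fun i hi => h ⟨i, hi⟩]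
      exact hSg.rel_refl _

/-! ### Preservation -/

theorem WellTyped.exists_chain {Sg : Sig N} (hSg : Sg.WF) {Δ₁ Δ₂ : Ctx N 0 0} {E : ℕ} {S : Conf N}
    (h : WellTyped Sg Δ₁ E S Δ₂) : ∃ L : List (Obj N), (L : Conf N) = S ∧ Chain Sg Δ₁ E L Δ₂ ∧
      (∀ o ∈ L, Δ₁ o.chan = none) ∧ (L.map Obj.chan).Nodup := by
  obtain ⟨L, rfl, hL⟩ := h.typed.exists_chain hSg
  exact ⟨L, rfl, hL, fun o ho => h.outside o ho, by simpa using h.nodup⟩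

theorem WellTyped.chan_ne {Sg : Sig N} {Δ₁ Δ₂ : Ctx N 0 0} {E : ℕ} {K : Conf N} {o₁ o₂ : Obj N}
    (h : WellTyped Sg Δ₁ E (K + ([o₁, o₂] : List _)) Δ₂) : o₁.chan ≠ o₂.chan := by
  have := h.nodup
  rw [Multiset.map_add] at this
  have := (Multiset.nodup_add.1 this).2.1
  simp only [Multiset.map_coe, Multiset.coe_nodup] at this
  simpa using this

theorem exists_eq_append_of_coe {α : Type*} {L : List α} {K : Multiset α} {a : α}
    (h : (L : Multiset α) = K + ([a] : List α)) :
    ∃ L₁ L₂, L = L₁ ++ a :: L₂ ∧ ((L₁ ++ L₂ : List α) : Multiset α) = K := by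
  have ha : a ∈ L := by
    rw [← Multiset.mem_coe, h]; simp
  obtain ⟨L₁, L₂, rfl⟩ := List.append_of_mem ha
  refine ⟨L₁, L₂, rfl, ?_⟩
  have : a ::ₘ ((L₁ ++ L₂ : List α) : Multiset α) = a ::ₘ K := by
    rw [Multiset.cons_coe, ← Multiset.coe_eq_coe.2 List.perm_middle, h, Multiset.coe_singleton,
      add_comm, Multiset.singleton_add]
  exact (Multiset.cons_inj_right a).1 this

theorem coe_append_append {α : Type*} (L₁ l L₂ : List α) :
    ((L₁ ++ (l ++ L₂) : List α) : Multiset α) =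
      ((L₁ ++ L₂ : List α) : Multiset α) + (l : Multiset α) := by
  simp only [← Multiset.coe_add]
  rw [add_assoc, add_comm (L₂ : Multiset α)]

theorem WellTyped.cut {Sg : Sig N} (hSg : Sg.WF) {Δ₁ Δ₂ : Ctx N 0 0} {E : ℕ} {K : Conf N}
    {o₁ o₂ o : Obj N} (h : WellTyped Sg Δ₁ E (K + ([o₁, o₂] : List _)) Δ₂)
    (hc : CutsTo Sg o₁ o₂ o) : WellTyped Sg Δ₁ E (K + ([o] : List _)) Δ₂ := by
  obtain ⟨hchan, huse, hcut⟩ := hc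
  obtain ⟨L, hL, hch, hout, hnd⟩ := h.exists_chain hSg
  obtain ⟨L₁, L₂, hch, hK⟩ := hch.focus hL hout hnd huse
  have hS : ((L₁ ++ ([o₁, o₂] ++ L₂) : List _) : Conf N) = K + ([o₁, o₂] : List _) := by
    rw [coe_append_append, hK]
  have hne (o' : Obj N) (ho' : o' ∈ L₁) : o'.chan ≠ o₂.chan := by
    have hn := h.nodup
    rw [← hS, Multiset.map_coe, Multiset.coe_nodup, List.map_append, List.nodup_append] at hn
    exact hn.2.2 _ (List.mem_map_of_mem ho') _ (by simp)
  have h₂ : o₂ ∈ K + ([o₁, o₂] : List _) := by simp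
  have hch' := hch.replace (L' := o :: L₂) fun Δm E hm hmc =>
    hmc.contract hSg (hm _ (h.outside o₂ h₂) hne) hchan hcut
  refine ⟨?_, h.finite, ?_, ?_⟩
  · have := hch'.confTyped hSg (by simp)
    rwa [show o :: L₂ = [o] ++ L₂ from rfl, coe_append_append, hK] at this
  · refine Multiset.nodup_of_le ?_ h.nodup
    rw [Multiset.map_add, Multiset.map_add]
    refine add_le_add_right ?_ _
    simp [hchan]
  · intro o' ho'
    rcases Multiset.mem_add.1 ho' with ho' | ho'
    · exact h.outside o' (Multiset.mem_add.2 (.inl ho'))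
    · obtain rfl : o' = o := by simpa using ho'
      rw [hchan]
      exact h.outside o₂ h₂

theorem WellTyped.split {Sg : Sig N} (hSg : Sg.WF) {Δ₁ Δ₂ : Ctx N 0 0} {E : ℕ} {K : Conf N}
    {o₁ o₂ o : Obj N} (h : WellTyped Sg Δ₁ E (K + ([o] : List _)) Δ₂)
    (hc : SplitsInto Sg o o₁ o₂) (hfresh : Δ₁ o₁.chan = none)
    (hfresh' : ∀ o' ∈ K + ([o] : List _), o'.chan ≠ o₁.chan) :
    WellTyped Sg Δ₁ E (K + ([o₁, o₂] : List _)) Δ₂ := by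
  obtain ⟨hchan, hcut⟩ := hc
  obtain ⟨L, hL, hch, hout, hnd⟩ := h.exists_chain hSg
  obtain ⟨L₁, L₂, rfl, hK⟩ := exists_eq_append_of_coe hL
  have ho : o ∈ K + ([o] : List _) := by simp
  have hch' := hch.replace (L' := o₁ :: o₂ :: L₂) fun Δm E hm hmc =>
    hmc.expand hSg (hm _ hfresh fun o' ho' => hfresh' o' (by
      rw [← hL, Multiset.mem_coe]
      exact List.mem_append_left _ ho')) (hchan ▸ (hfresh' o ho).symm) hchan hcut
  refine ⟨?_, h.finite, ?_, ?_⟩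
  · have := hch'.confTyped hSg (by simp)
    rwa [show o₁ :: o₂ :: L₂ = [o₁, o₂] ++ L₂ from rfl, coe_append_append, hK] at this
  · rw [show K + (([o₁, o₂] : List _) : Conf N) = o₁ ::ₘ (K + {o₂}) by
      rw [← Multiset.cons_coe, Multiset.add_cons]; rfl, Multiset.map_cons, Multiset.nodup_cons]
    have hmap : (K + {o₂}).map Obj.chan = (K + ([o] : List _)).map Obj.chan := by
      simp [hchan]
    rw [hmap]
    refine ⟨fun hm => ?_, h.nodup⟩
    obtain ⟨o', ho', he⟩ := Multiset.mem_map.1 hm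
    exact hfresh' o' ho' he
  · intro o' ho'
    rcases Multiset.mem_add.1 ho' with ho' | ho'
    · exact h.outside o' (Multiset.mem_add.2 (.inl ho'))
    · obtain rfl | rfl : o' = o₁ ∨ o' = o₂ := by simpa using ho'
      · exact hfresh
      · rw [hchan]
        exact h.outside o ho

theorem WellTyped.modify {Sg : Sig N} (hSg : Sg.WF) {Δ₁ Δ₂ : Ctx N 0 0} {E : ℕ} {K : Conf N}
    {o o' : Obj N} (h : WellTyped Sg Δ₁ E (K + ([o] : List _)) Δ₂) (hchan : o'.chan = o.chan)
    (hoo : ∀ Γ n A, ObjTyped Sg o Γ n A → ObjTyped Sg o' Γ n A) :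
    WellTyped Sg Δ₁ E (K + ([o'] : List _)) Δ₂ := by
  obtain ⟨L, hL, hch, hout, hnd⟩ := h.exists_chain hSg
  obtain ⟨L₁, L₂, rfl, hK⟩ := exists_eq_append_of_coe hL
  have hch' := hch.replace (L' := o' :: L₂) fun Δm E hm hmc => hmc.modify hchan hoo
  refine ⟨?_, h.finite, ?_, ?_⟩
  · have := hch'.confTyped hSg (by simp)
    rwa [show o' :: L₂ = [o'] ++ L₂ from rfl, coe_append_append, hK] at this
  · have hn := h.nodup
    rwa [show (K + ([o] : List _)).map Obj.chan = (K + ([o'] : List _)).map Obj.chan by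
      simp [hchan]] at hn
  · intro a ha
    rcases Multiset.mem_add.1 ha with ha | ha
    · exact h.outside a (Multiset.mem_add.2 (.inl ha))
    · obtain rfl : a = o' := by simpa using ha
      rw [hchan]
      exact h.outside o (by simp)

theorem mem_add_single (K : Conf N) (o : Obj N) : o ∈ K + ([o] : List _) := by simp

/-- Every rewriting rule preserves typing. -/
theorem WellTyped.rewrite {Sg : Sig N} (hSg : Sg.WF) {Δ₁ Δ₂ : Ctx N 0 0} {E : ℕ} {K : Conf N}
    {fresh : Name → Prop} {l r : List (Obj N)} (hr : Rewrite Sg fresh l r)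
    (h : WellTyped Sg Δ₁ E (K + l) Δ₂)
    (hfresh : ∀ a, fresh a → Δ₁ a = none ∧ ∀ o ∈ K + l, o.chan ≠ a) :
    WellTyped Sg Δ₁ E (K + r) Δ₂ := by
  cases hr with
  | idPos => exact h.cut hSg (cutsTo_fwd_pos hSg _ _ _)
  | idNeg hM => exact h.cut hSg (cutsTo_fwd_neg hSg hM h.chan_ne _ _)
  | @spawn a c w f e y Q ha =>
    exact h.split hSg (splitsInto_spawn hSg ((hfresh a ha).2 _ (mem_add_single _ _)).symm _ _ _ _ _)
      (hfresh a ha).1 (hfresh a ha).2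
  | @sendR c c' w u P ha =>
    exact h.split hSg (splitsInto_send_right hSg
      ((hfresh c' ha).2 _ (mem_add_single _ _)).symm _ _ _) (hfresh c' ha).1 (hfresh c' ha).2
  | @sendL c c' d w u Q ha hd =>
    exact h.split hSg (splitsInto_send_left hSg hd
      ((hfresh c' ha).2 _ (mem_add_single _ _)).symm _ _ _) (hfresh c' ha).1 (hfresh c' ha).2
  | @plusC _ _ _ _ _ _ l => exact h.cut hSg (cutsTo_left hSg (.case l.1 l.2) h.chan_ne _ _)
  | @ampC _ _ _ _ _ l => exact h.cut hSg (cutsTo_right hSg (.case l.1 l.2) h.chan_ne _ _)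
  | @oneS c w =>
    refine h.modify hSg rfl fun Γ n A ho => ?_
    cases ho with
    | proc hP hp hc hn => exact .msg (.close c) hP hp hc hn
  | oneC => exact h.cut hSg (cutsTo_close hSg _ _ _)
  | tensorC => exact h.cut hSg (cutsTo_left hSg .recv h.chan_ne _ _)
  | lolliC => exact h.cut hSg (cutsTo_right hSg .recv h.chan_ne _ _)
  | exC => exact h.cut hSg (cutsTo_left hSg .recvIdx h.chan_ne _ _)
  | allC => exact h.cut hSg (cutsTo_right hSg .recvIdx h.chan_ne _ _)
  | assertC => exact h.cut hSg (cutsTo_left hSg .assume h.chan_ne _ _)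
  | assumeC => exact h.cut hSg (cutsTo_right hSg .assume h.chan_ne _ _)
  | payC hrs => exact h.cut hSg (cutsTo_left hSg (.get hrs) h.chan_ne _ _)
  | getC hrs => exact h.cut hSg (cutsTo_right hSg (.get hrs) h.chan_ne _ _)
  | @work c w m r P hm =>
    refine h.modify hSg rfl fun Γ n A ho => ?_
    cases ho with
    | proc hP hp hc hn =>
      cases hP with
      | work hr hq hP =>
        have hq := entails_ge_closed.1 hq
        exact .proc hP (n := n - w - m) (by rw [val_sub]; omega) hc (by omega)

theorem WellTyped.step {Sg : Sig N} (hSg : Sg.WF) {Δ₁ Δ₂ : Ctx N 0 0} {E : ℕ} {S S' : Conf N}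
    (h : WellTyped Sg Δ₁ E S Δ₂) (hS : Step Sg (Δ₁.dom ∪ Δ₂.dom) S S') :
    WellTyped Sg Δ₁ E S' Δ₂ := by
  obtain ⟨K, l, r, hr, rfl, rfl⟩ := hS
  refine h.rewrite hSg hr fun a ha => ⟨?_, fun o ho he => ha.2 o ho ?_⟩
  · by_contra hn
    exact ha.1 (.inl hn)
  · subst he
    cases o <;> exact .inl rfl

/-! ### Fresh channels -/

theorem Chan.finite_name_eq {m : ℕ} (x : Chan m) : {a : ℕ | Chan.name a = x}.Finite :=
  Set.Subsingleton.finite fun a ha b hb => by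
    have : (Chan.name a : Chan m) = .name b := Eq.trans ha (Eq.symm hb)
    simpa using this

theorem Proc.finite_mentions {k m : ℕ} (P : Proc N k m) :
    {a : ℕ | P.Mentions (.name a)}.Finite := by
  have hor {p q : ℕ → Prop} (hp : {a | p a}.Finite) (hq : {a | q a}.Finite) :
      {a | p a ∨ q a}.Finite := hp.union hq
  induction P with
  | fwd x y => exact hor x.finite_name_eq y.finite_name_eq
  | spawn f e y Q ih =>
    refine hor ?_ ih
    rw [Set.ofPred_exists]
    exact Set.finite_iUnion fun i => (y i).finite_name_eq
  | send x p P ih =>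
    refine hor x.finite_name_eq (hor ?_ ih)
    cases p with
    | chan w => simpa [eq_comm] using w.finite_name_eq
    | _ => simp
  | case x L Q ih =>
    refine hor x.finite_name_eq ?_
    rw [Set.ofPred_exists]
    exact Set.finite_iUnion fun l => ih l
  | close x => exact x.finite_name_eq
  | work r P ih => exact ih
  | impossible => simp [Proc.Mentions]
  | recv x Q ih | wait x Q ih | recvIdx x Q ih | assume x φ Q ih | get x r Q ih =>
    exact hor x.finite_name_eq ih

theorem Obj.finite_mentions (o : Obj N) : {a : ℕ | o.Mentions (.name a)}.Finite := by
  cases o with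
  | proc c w P => exact c.finite_name_eq.union P.finite_mentions
  | msg c w P => exact c.finite_name_eq.union P.finite_mentions

theorem exists_fresh {U : Set Name} (hU : U.Finite) (S : Conf N) :
    ∃ a : Name, a ∉ U ∧ ∀ o ∈ S, ¬ o.Mentions a := by
  have h₁ : (Chan.name ⁻¹' U : Set ℕ).Finite :=
    hU.preimage fun a _ b _ h => by simpa using h
  have h₂ : {a : ℕ | ∃ o ∈ S, o.Mentions (.name a)}.Finite := by
    classical
    have : {a : ℕ | ∃ o ∈ S, o.Mentions (.name a)} =
        ⋃ o ∈ {o | o ∈ S}, {a : ℕ | o.Mentions (.name a)} := by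
      ext a; simp
    rw [this]
    refine Set.Finite.biUnion ?_ fun o _ => o.finite_mentions
    exact S.finite_toSet
  obtain ⟨a, ha⟩ := (h₁.union h₂).exists_notMem
  refine ⟨.name a, fun h => ha (.inl h), fun o ho h => ha (.inr ⟨o, ho, h⟩)⟩

theorem Chain.finite_dom {Sg : Sig N} {Δ Δ' : Ctx N 0 0} {E : ℕ} {L : List (Obj N)}
    (h : Chain Sg Δ E L Δ') (hΔ : Δ.dom.Finite) : Δ'.dom.Finite := by
  induction h with
  | nil he => exact hΔ.subset fun c hc hn => hc (he.eq_none hn)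
  | @cons Δ Γ Δ' n E E' o L A ho hs hn _ hE ih =>
    refine ih ((hΔ.insert o.chan).subset fun c hc => ?_)
    by_cases hco : c = o.chan
    · exact .inl hco
    · exact .inr fun hn => hc (Ctx.after_eq_none hn (Ne.symm hco))

/-! ### Progress -/

/-- The provider of a channel of this (unfolded) type sends. -/
def Ty.IsPos {k : ℕ} : Ty N k → Prop
  | .plus _ _ | .tensor _ _ | .one | .ex _ | .assert _ _ | .pay _ _ => True
  | _ => False

/-- The provider of a channel of this (unfolded) type receives. -/
def Ty.IsNeg {k : ℕ} : Ty N k → Prop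
  | .amp _ _ | .lolli _ _ | .all _ | .assume _ _ | .get _ _ => True
  | _ => False

theorem Ty.IsPos.not_isNeg {A : Ty N 0} (h : A.IsPos) : ¬ A.IsNeg := by
  cases A <;> simp_all [Ty.IsPos, Ty.IsNeg]

theorem Sim.isNeg {R : Ty N 0 → Ty N 0 → Prop} {A B : Ty N 0} (h : Sim R A B) (hA : A.IsNeg) :
    B.IsNeg := by
  cases h <;> simp_all [Ty.IsNeg]

theorem Emits.isPos {Sg : Sig N} {U A' : Ty N 0} {u : Payload 0 0} {W : Ctx N 0 0} {m : ℕ}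
    (h : Emits Sg true U u W m A') : U.IsPos := by
  cases h <;> trivial

theorem Emits.isNeg {Sg : Sig N} {U A' : Ty N 0} {u : Payload 0 0} {W : Ctx N 0 0} {m : ℕ}
    (h : Emits Sg false U u W m A') : U.IsNeg := by
  cases h <;> trivial

/-- A client that receives along `c` can react to what a provider of `c` sends. -/
theorem Receives.left {Sg : Sig N} {c d : Name} {R : Proc N 0 0} (h : Receives c R)
    {Γ : Ctx N 0 0} {p : Exp 0} {D : Ty N 0} (hR : Typed Sg .top Γ p R d D) (hcd : c ≠ d) :
    ∃ A, Γ c = some A ∧ (Sg.unfold A).IsPos ∧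
      (∀ U u W m A' c', Sim Sg.Equal U (Sg.unfold A) → Emits Sg true U u W m A' →
        ∃ R', Reacts c c' R u R') ∧
      (Sim Sg.Equal .one (Sg.unfold A) → ∃ Q, R = .wait c Q) := by
  cases h with
  | case =>
    cases hR with
    | ampR => exact (hcd rfl).elim
    | plusL hx hA =>
      refine ⟨_, hx, by rw [hA]; trivial, fun U u W m A' c' hs hE => ?_, fun hs => ?_⟩ <;>
        rw [hA] at hs <;> cases hs
      cases hE with
      | plus l hl => exact ⟨_, .case l hl⟩
  | recv =>
    cases hR with
    | lolliR => exact (hcd rfl).elim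
    | tensorL hx hA =>
      refine ⟨_, hx, by rw [hA]; trivial, fun U u W m A' c' hs hE => ?_, fun hs => ?_⟩ <;>
        rw [hA] at hs <;> cases hs
      cases hE with
      | tensor => exact ⟨_, .recv⟩
  | wait Q =>
    cases hR with
    | oneL hx hA =>
      refine ⟨_, hx, by rw [hA]; trivial, fun U u W m A' c' hs hE => ?_, fun _ => ⟨Q, rfl⟩⟩
      rw [hA] at hs
      cases hs
      cases hE
  | recvIdx =>
    cases hR with
    | allR => exact (hcd rfl).elim
    | exL hx hA =>
      refine ⟨_, hx, by rw [hA]; trivial, fun U u W m A' c' hs hE => ?_, fun hs => ?_⟩ <;>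
        rw [hA] at hs <;> cases hs
      cases hE with
      | ex => exact ⟨_, .recvIdx⟩
  | assume =>
    cases hR with
    | assumeR => exact (hcd rfl).elim
    | assertL hx hA =>
      refine ⟨_, hx, by rw [hA]; trivial, fun U u W m A' c' hs hE => ?_, fun hs => ?_⟩ <;>
        rw [hA] at hs <;> cases hs
      cases hE with
      | assert => exact ⟨_, .assume⟩
  | get s Q =>
    cases hR with
    | getR => exact (hcd rfl).elim
    | payL hx hA he =>
      refine ⟨_, hx, by rw [hA]; trivial, fun U u W m A' c' hs hE => ?_, fun hs => ?_⟩ <;>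
        rw [hA] at hs <;> cases hs
      rename_i hr _
      cases hE with
      | pay h₁ h₂ =>
        have h₃ := entails_eq_closed.1 hr
        have h₄ := entails_eq_closed.1 he
        exact ⟨_, .get (by omega)⟩

/-- A provider that receives along `c` can react to what a client of `c` sends. -/
theorem Receives.right {Sg : Sig N} {c : Name} {R : Proc N 0 0} (h : Receives c R)
    {Γ : Ctx N 0 0} {p : Exp 0} {A : Ty N 0} (hR : Typed Sg .top Γ p R c A) (hc : Γ c = none) :
    (Sg.unfold A).IsNeg ∧
      ∀ U u W m A' c', Sim Sg.Equal U (Sg.unfold A) → Emits Sg false U u W m A' →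
        ∃ R', Reacts c c' R u R' := by
  cases h with
  | case =>
    cases hR with
    | plusL hx => simp [hc] at hx
    | ampR hA =>
      refine ⟨by rw [hA]; trivial, fun U u W m A' c' hs hE => ?_⟩
      rw [hA] at hs
      cases hs
      cases hE with
      | amp l hl => exact ⟨_, .case l hl⟩
  | recv =>
    cases hR with
    | tensorL hx => simp [hc] at hx
    | lolliR hA =>
      refine ⟨by rw [hA]; trivial, fun U u W m A' c' hs hE => ?_⟩
      rw [hA] at hs
      cases hs
      cases hE with
      | lolli => exact ⟨_, .recv⟩
  | wait Q =>
    cases hR with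
    | oneL hx => simp [hc] at hx
  | recvIdx =>
    cases hR with
    | exL hx => simp [hc] at hx
    | allR hA =>
      refine ⟨by rw [hA]; trivial, fun U u W m A' c' hs hE => ?_⟩
      rw [hA] at hs
      cases hs
      cases hE with
      | all => exact ⟨_, .recvIdx⟩
  | assume =>
    cases hR with
    | assertL hx => simp [hc] at hx
    | assumeR hA =>
      refine ⟨by rw [hA]; trivial, fun U u W m A' c' hs hE => ?_⟩
      rw [hA] at hs
      cases hs
      cases hE with
      | assume => exact ⟨_, .assume⟩
  | get s Q =>
    cases hR with
    | payL hx => simp [hc] at hx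
    | getR hA he =>
      refine ⟨by rw [hA]; trivial, fun U u W m A' c' hs hE => ?_⟩
      rw [hA] at hs
      cases hs
      rename_i hr _
      cases hE with
      | get h₁ h₂ =>
        have h₃ := entails_eq_closed.1 hr
        have h₄ := entails_eq_closed.1 he
        exact ⟨_, .get (by omega)⟩

theorem Reacts.rewrite_left {Sg : Sig N} {fresh : Name → Prop} {c c' d : Name}
    {R R' : Proc N 0 0} {u : Payload 0 0} (h : Reacts c c' R u R') (w w' : ℕ) :
    Rewrite Sg fresh [.msg c w' (.send c u (.fwd c c')), .proc d w R] [.proc d (w + w') R'] := by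
  cases h with
  | case l hl => exact .plusC (l := ⟨l, hl⟩)
  | recv => exact .tensorC
  | recvIdx => exact .exC
  | assume => exact .assertC
  | get h => exact .payC h

theorem Reacts.rewrite_right {Sg : Sig N} {fresh : Name → Prop} {c c' : Name}
    {R R' : Proc N 0 0} {u : Payload 0 0} (h : Reacts c c' R u R') (w w' : ℕ) :
    Rewrite Sg fresh [.proc c w R, .msg c' w' (.send c u (.fwd c' c))]
      [.proc c' (w + w') R'] := by
  cases h with
  | case l hl => exact .ampC (l := ⟨l, hl⟩)
  | recv => exact .lolliC
  | recvIdx => exact .allC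
  | assume => exact .assumeC
  | get h => exact .getC h

/-- An object that provides a channel of type `A` and is about to communicate along it: it sends if
`A` is positive, and receives or forwards if `A` is negative. -/
inductive Ready (Sg : Sig N) (A : Ty N 0) : Obj N → Prop
  | send {c c' : Name} {w : ℕ} {u : Payload 0 0} {W : Ctx N 0 0} {m : ℕ} {A' : Ty N 0} :
      Emits Sg true (Sg.unfold A) u W m A' → Ready Sg A (.msg c w (.send c u (.fwd c c')))
  | close {c : Name} {w : ℕ} : Sg.unfold A = .one → Ready Sg A (.msg c w (.close c))
  | recv {c : Name} {w : ℕ} {R : Proc N 0 0} {Γ : Ctx N 0 0} {p : Exp 0} :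
      Receives c R → Typed Sg .top Γ p R c A → Γ c = none → Ready Sg A (.proc c w R)
  | fwd {c d : Name} {w : ℕ} : (Sg.unfold A).IsNeg → Ready Sg A (.proc c w (.fwd c d))

theorem Ready.poised {Sg : Sig N} {A : Ty N 0} {o : Obj N} (h : Ready Sg A o) : o.Poised := by
  cases h with
  | send => exact .send
  | close => exact .close
  | recv h => exact .recv h
  | fwd => exact .fwd

theorem exists_eq_add_pair {S : Conf N} {o₁ o₂ : Obj N} (h₁ : o₁ ∈ S) (h₂ : o₂ ∈ S)
    (h : o₁ ≠ o₂) : ∃ K : Conf N, S = K + ([o₁, o₂] : List _) := by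
  obtain ⟨T, rfl⟩ := Multiset.exists_cons_of_mem h₁
  obtain ⟨K, rfl⟩ := Multiset.exists_cons_of_mem ((Multiset.mem_cons.1 h₂).resolve_left h.symm)
  refine ⟨K, ?_⟩
  rw [← Multiset.cons_coe, ← Multiset.cons_coe, Multiset.add_cons, Multiset.add_cons]
  simp

theorem exists_eq_add_single {S : Conf N} {o : Obj N} (h : o ∈ S) :
    ∃ K : Conf N, S = K + ([o] : List _) := by
  obtain ⟨K, rfl⟩ := Multiset.exists_cons_of_mem h
  exact ⟨K, by rw [Multiset.coe_singleton, add_comm, Multiset.singleton_add]⟩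

/-- In a configuration without steps, an object waits for the outside or is ready, provided that
this holds for the providers of the channels that it uses. -/
theorem ObjTyped.ready {Sg : Sig N} {Δ₁ : Ctx N 0 0} {S : Conf N} {fresh : Name → Prop}
    (hfresh : ∃ a, fresh a) (hns : ∀ K l r, Rewrite Sg fresh l r → S ≠ K + (l : Conf N))
    {o : Obj N} {Γ : Ctx N 0 0} {n : ℕ} {A : Ty N 0} (ho : ObjTyped Sg o Γ n A) (hoS : o ∈ S)
    (hΓ : ∀ c B, Γ c = some B → c ∈ Δ₁.dom ∨ ∃ o' ∈ S, o'.chan = c ∧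
      (WaitsOutside Δ₁ S o' ∨ ∃ B', Ready Sg B' o' ∧ Sg.Equal B' B)) :
    WaitsOutside Δ₁ S o ∨ Ready Sg A o := by
  obtain ⟨a, ha⟩ := hfresh
  have one {r : List (Obj N)} (h : Rewrite Sg fresh [o] r) : False := by
    obtain ⟨K, hK⟩ := exists_eq_add_single hoS
    exact hns _ _ _ h hK
  have two {o' : Obj N} {r : List (Obj N)} (ho' : o' ∈ S) (hne : o' ≠ o)
      (h : Rewrite Sg fresh [o', o] r) : False := by
    obtain ⟨K, hK⟩ := exists_eq_add_pair ho' hoS hne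
    exact hns _ _ _ h hK
  have wait {c : Name} {B : Ty N 0} (hc : Γ c = some B) (hw : o.WaitsFor c) :
      WaitsOutside Δ₁ S o ∨ ∃ o' ∈ S, o'.chan = c ∧ ∃ B', Ready Sg B' o' ∧ Sg.Equal B' B := by
    rcases hΓ c B hc with h | ⟨o', ho', rfl, h | h⟩
    · exact .inl (.direct hw h)
    · exact .inl (.through hw ho' h)
    · exact .inr ⟨o', ho', rfl, h⟩
  cases ho with
  | @proc _ p n _ w c P _ hP hp hc hn =>
    have recv {x : Name} (hx : Receives x P) :
        WaitsOutside Δ₁ S (.proc c w P) ∨ Ready Sg A (.proc c w P) := by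
      by_cases hxc : x = c
      · subst hxc
        exact .inr (.recv hx hP hc)
      obtain ⟨B, hB, hpos, hsend, hclose⟩ := hx.left hP hxc
      refine (wait hB (.recv hxc hx)).imp_right ?_
      rintro ⟨o', ho', rfl, B', hr, hBB⟩
      exfalso
      cases hr with
      | @send c c' w' u W m A' hE =>
        obtain ⟨R', hR'⟩ := hsend _ _ _ _ _ c' hBB.sim hE
        exact two ho' (by simp) (hR'.rewrite_left _ _)
      | close h =>
        obtain ⟨Q, rfl⟩ := hclose (h ▸ hBB.sim)
        exact two ho' (by simp) .oneC
      | recv hx' hR hc' => exact hpos.not_isNeg (hBB.sim.isNeg (hx'.right hR hc').1)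
      | fwd hneg => exact hpos.not_isNeg (hBB.sim.isNeg hneg)
    cases P with
    | fwd x y =>
      obtain ⟨rfl, B, rfl, -, hBA⟩ := hP.fwd_inv
      refine (wait (c := y) (B := B) (by simp [Ctx.set_apply]) .fwd).imp_right ?_
      rintro ⟨o', ho', rfl, B', hr, hBB⟩
      cases hr with
      | send hE => exact (two ho' (by simp) .idPos).elim
      | close h => exact (two ho' (by simp) .idPos).elim
      | recv hx' hR hc' => exact .fwd (hBA.sim.isNeg (hBB.sim.isNeg (hx'.right hR hc').1))
      | fwd hneg => exact .fwd (hBA.sim.isNeg (hBB.sim.isNeg hneg))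
    | spawn f e y Q => exact (one (.spawn ha)).elim
    | send x u P =>
      by_cases hxc : c = x
      · subst hxc
        exact (one (.sendR ha)).elim
      · exact (one (.sendL ha hxc)).elim
    | case x L Q => exact recv (.case x L Q)
    | recv x Q => exact recv (.recv x Q)
    | close x => cases hP with | oneR => exact (one .oneS).elim
    | wait x Q => exact recv (.wait x Q)
    | recvIdx x Q => exact recv (.recvIdx x Q)
    | assume x φ Q => exact recv (.assume x φ Q)
    | get x r Q => exact recv (.get x r Q)
    | work r P =>
      cases hP with
      | work hr =>
        obtain ⟨m, hm⟩ := Int.eq_ofNat_of_zero_le (isNat_closed.1 hr)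
        exact (one (.work hm)).elim
    | impossible => cases hP with | unsat h => exact ((entails_closed _).1 h).elim
  | @msg _ p n _ w c M _ hM hP hp hc hn =>
    cases hM with
    | pos c' u =>
      obtain ⟨W, m, A', B, hE, -⟩ := hP.message_right_inv hc (by omega)
      exact .inr (.send hE)
    | neg d u =>
      have hcd : c ≠ d := by
        intro he
        subst he
        obtain ⟨W, m, A', B, -, rfl, -⟩ := hP.message_right_inv hc (by omega)
        simp [Ctx.set_apply] at hc
      obtain ⟨W, m, A', B, hE, rfl, -⟩ := hP.message_left_inv hcd (by omega)
      refine (wait (c := d) (B := B) (by simp [Ctx.set_apply]) (.send hcd.symm)).imp_right ?_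
      rintro ⟨o', ho', rfl, B', hr, hBB⟩
      exfalso
      have hneg := hBB.symm.sim.isNeg hE.isNeg
      cases hr with
      | send hE' => exact hE'.isPos.not_isNeg hneg
      | close h => simp [h, Ty.IsNeg] at hneg
      | recv hx' hR hc' =>
        obtain ⟨R', hR'⟩ := (hx'.right hR hc').2 _ _ _ _ _ c hBB.symm.sim hE
        exact two ho' (by simp) (hR'.rewrite_right _ _)
      | fwd => exact two ho' (by simp) (.idNeg (.inl rfl))
    | close => cases hP with | oneR hA => exact .inr (.close hA)

/-- The induction along a chain: the invariant is that every available channel is provided by the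
outside, by an object that waits for the outside, or by a ready object. -/
theorem Chain.ready {Sg : Sig N} {Δ₁ : Ctx N 0 0} {S : Conf N} {fresh : Name → Prop}
    (hfresh : ∃ a, fresh a) (hns : ∀ K l r, Rewrite Sg fresh l r → S ≠ K + (l : Conf N))
    {Δ Δ' : Ctx N 0 0} {E : ℕ} {L : List (Obj N)} (h : Chain Sg Δ E L Δ') (hLS : ∀ o ∈ L, o ∈ S)
    (hΔ : ∀ c B, Δ c = some B → c ∈ Δ₁.dom ∨ ∃ o ∈ S, o.chan = c ∧
      (WaitsOutside Δ₁ S o ∨ Ready Sg B o)) :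
    ∀ o ∈ L, WaitsOutside Δ₁ S o ∨ ∃ A, Ready Sg A o := by
  induction h with
  | nil => simp
  | @cons Δ Γ Δ' n E E' o L A ho hs hn _ hE ih =>
    have hoS := hLS o (by simp)
    have hr := ho.ready (Δ₁ := Δ₁) hfresh hns hoS fun c B hB => by
      obtain ⟨B', hB', hBB⟩ := hs c B hB
      refine (hΔ c B' hB').imp_right ?_
      rintro ⟨o', ho', hc, h⟩
      exact ⟨o', ho', hc, h.imp_right fun h => ⟨B', h, hBB⟩⟩
    have ih := ih (fun o' ho' => hLS o' (by simp [ho'])) fun c B hB => by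
      simp only [Ctx.after] at hB
      split_ifs at hB with h₁
      · cases hB
        exact .inr ⟨o, hoS, h₁.symm, hr⟩
      · exact hΔ c B hB
    intro o' ho'
    rcases List.mem_cons.1 ho' with rfl | ho'
    · exact hr.imp_right fun h => ⟨A, h⟩
    · exact ih o' ho'

theorem WellTyped.progress {Sg : Sig N} (hSg : Sg.WF) {Δ₁ Δ₂ : Ctx N 0 0} {E : ℕ} {S : Conf N}
    (h : WellTyped Sg Δ₁ E S Δ₂) : Poised Δ₁ S ∨ ∃ S', Step Sg (Δ₁.dom ∪ Δ₂.dom) S S' := by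
  by_contra! hn
  obtain ⟨hp, hns⟩ := hn
  obtain ⟨L, rfl, hch, hout, hnd⟩ := h.exists_chain hSg
  have hns' (K : Conf N) (l r : List (Obj N))
      (hr : Rewrite Sg (fun a => a ∉ Δ₁.dom ∪ Δ₂.dom ∧ ∀ o ∈ (L : Conf N), ¬ o.Mentions a) l r) :
      (L : Conf N) ≠ K + (l : Conf N) := fun hS => hns (K + r) ⟨K, l, r, hr, hS, rfl⟩
  refine hp fun o ho => ?_
  have := hch.ready (Δ₁ := Δ₁) (S := (L : Conf N))
    (exists_fresh (h.finite.union (hch.finite_dom h.finite)) (L : Conf N)) hns' (fun o ho => ho)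
    (fun c B hB => .inl (by simp [Ctx.dom, hB])) o ho
  exact this.symm.imp_left fun ⟨A, hA⟩ => hA.poised

end SessionTypes

theorem theorem1 (N : SessionTypes.Names) (Sg : SessionTypes.Sig N) (hSg : Sg.WF)
    (Δ₁ Δ₂ : SessionTypes.Ctx N 0 0) (E : ℕ) (S : SessionTypes.Conf N)
    (hS : SessionTypes.WellTyped Sg Δ₁ E S Δ₂) :
    (SessionTypes.Poised Δ₁ S ∨
      ∃ S' : SessionTypes.Conf N, SessionTypes.Step Sg (Δ₁.dom ∪ Δ₂.dom) S S') ∧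
    (∀ S' : SessionTypes.Conf N, SessionTypes.Step Sg (Δ₁.dom ∪ Δ₂.dom) S S' →
      SessionTypes.WellTyped Sg Δ₁ E S' Δ₂) :=
  ⟨hS.progress hSg, fun _ h => hS.step hSg h⟩
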